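/- Let $k$ be a field and let $\mathbb G$ be $\mathbb Z$ or $\mathbb Z/2$. All dg categories are small, $k$-linear, $\mathbb G$-graded and have identities. For such $\mathcal A$ let $C(\mathcal A)$ be its Hochschild complex, spanned by the cyclically composable words $a_0[a_1|\cdots|a_n]$, $n\ge 0$ (multilinear in the homogeneous morphisms $a_i$), of degree $\sum_i|a_i|-n$, with Hochschild differential $b$. Put $$t^{-1}(a_0[a_1|\cdots|a_n])=(-1)^{(|a_n|-1)\sum_{l<n}(|a_l|-1)}\,a_n[a_0|\cdots|a_{n-1}],\qquad s(a_0[a_1|\cdots|a_n])=1_{\mathrm{cod}(a_0)}[a_0|\cdots|a_n],$$ $N=\sum_{m=0}^{n}t^{-m}$ on words of length $n+1$, and $B=(1-t^{-1})sN$. The negative cyclic complex is $(C(\mathcal A)[[u]],b+uB)$ with $|u|=2$ (a series $\sum_m c_mu^m$ has degree $g$ if $|c_m|=g-2m$ for all $m$), and $HN_*(\mathcal A)$ is its cohomology. $\overline C(\mathcal A)$ is the normalized complex, i.e. the quotient of $C(\mathcal A)$ by the words $a_0[a_1|\cdots|a_n]$ with some $a_m$ ($m\ge1$) an identity, $quot: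 C(\mathcal A)[[u]]\to\overline C(\mathcal A)[[u]]$ is the quotient map, and $\overline{HN}_*(\mathcal A)$ is the cohomology of $(\overline C(\mathcal A)[[u]],b+uB)$. Let $\mathcal A^+$ be obtained from $\mathcal A$ by adjoining a new identity $e_x$ to each object $x$, and let $C^e(\mathcal A)=C(\mathcal A^+)/D$, where $D$ is spanned by the chains $e_x$ and the words $a_0[a_1|\cdots|a_n]$ with $a_m=e_x$ for some $m>0$ and some $x$. Let $\iota(u):C(\mathcal A)[[u]]\to C^e(\mathcal A)[[u]]$ and $p(u):C^e(\mathcal A)[[u]]\to C(\mathcal A)[[u]]$ be the $k[[u]]$-linear extensions of $$\iota(u)(a)=a+u\,s^e s N(a),\quad s^e(a_0[a_1|\cdots|a_n])=e_{\mathrm{cod}(a_0)}[a_0|\cdots|a_n],$$ $$p(u)(a)=a\ \ (a\in C(\mathcal A)),\qquad p(u)(e_x[a_1|\cdots|a_n])=(1-t^{-1})\bigl(1_x[a_1|\cdots|a_n]\bigr)\ \ (n\ge1).$$ A non-unital dg functor (semifunctor) $F:\mathcal A\to\mathcal B$ induces $F_*:C(\mathcal A)\to C(\mathcal B)$, $a_0[a_1|\cdots|a_n]\mapsto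 F(a_0)[F(a_1)|\cdots|F(a_n)]$, and, by putting $F(e_x)=e_{F(x)}$, a map $F^e_*:C^e(\mathcal A)\to C^e(\mathcal B)$. **Lemma.** Let $P,N$ be objects of a dg category $\mathcal A$ and let $P$ be a direct summand of $N$: there are closed morphisms $i:P\to N$, $j:N\to P$ of degree $0$ with $j\circ i=1_P$. Put $\pi=i\circ j$. Let $\{P,N\}$ and $\{N\}$ be the full dg subcategories on the indicated objects (with $P$ and $N$ regarded as two distinct objects of $\{P,N\}$), let $inc:\{N\}\to\{P,N\}$ be the inclusion, and let $F:\{P,N\}\to\{N\}$ be the semifunctor $$f\mapsto i\circ f\circ j\ (f\in\mathrm{End}\,P),\quad f'\mapsto i\circ f'\ (f'\in\mathrm{Hom}(N,P)),\quad f''\mapsto f''\circ j\ (f''\in\mathrm{Hom}(P,N)),\quad g\mapsto g\ (g\in\mathrm{End}\,N).$$ Put $$\gamma_P=1_P+\sum_{m\ge1}(-1)^m\frac{(2m)!}{2(m!)}\,2\cdot1_P[\underbrace{1_P|\cdots|1_P}_{2m}]\,u^m\in C\{P,N\}[[u]],$$ $$\eta_\pi=\pi+\sum_{m\ge1}(-1)^m\frac{(2m)!}{2(m!)}\,(2\pi-1_N)[\underbrace{\pi|\cdots|\pi}_{2m}]\,u^m\in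 C\{N\}[[u]],$$ where the coefficients $(2m)!/(2(m!))$ are integers. Then $$F_*(u):=p(u)\circ F^e_*\circ\iota(u):\ (C\{P,N\}[[u]],b+uB)\to(C\{N\}[[u]],b+uB)$$ is a ($k[[u]]$-linear, degree $0$) cochain map, and 1. $F_*(u)\circ inc_*$ induces the identity on $HN_*\{N\}$; 2. $F_*(u)|_{u=0}=F_*$; 3. $quot(F_*(u)(\gamma_P))=quot(\eta_\pi)$ in $\overline C\{N\}[[u]]$. In particular, the images of $1_P$ and $\eta_\pi$ in $\overline C\{P,N\}[[u]]$ are cocycles of degree $0$ and $[1_P]=[\eta_\pi]$ in $\overline{HN}_*\{P,N\}$. -/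

import Mathlib

namespace NegCyc

universe uk u v w u' v' u₁

/-- A grading ring: a commutative ring `G` with a parity homomorphism to `ℤ/2`.  The two cases of
interest are `G = ℤ` and `G = ℤ/2` (instances below). -/
class GradingRing (G : Type w) extends CommRing G where
  parity : G →+* ZMod 2

instance : GradingRing ℤ := { (inferInstance : CommRing ℤ) with parity := Int.castRingHom (ZMod 2) }

instance : GradingRing (ZMod 2) :=
  { (inferInstance : CommRing (ZMod 2)) with parity := RingHom.id (ZMod 2) }

/-- The sign `(-1) ^ g` of a degree `g`. -/
def sgn (k : Type*) [Field k] {G : Type*} [GradingRing G] (g : G) : k :=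
  open Classical in if GradingRing.parity (G := G) g = 0 then 1 else -1

/-- A `G`-graded `k`-linear quiver. `Hom x y n` is the space of morphisms `x ⟶ y` of degree `n`. -/
structure GradedQuiver (k : Type*) [Field k] (G : Type w) [GradingRing G] where
  Obj : Type u
  Hom : Obj → Obj → G → Type v
  [addCommGroup : ∀ x y n, AddCommGroup (Hom x y n)]
  [module : ∀ x y n, Module k (Hom x y n)]

attribute [instance] GradedQuiver.addCommGroup GradedQuiver.module

/-- A small dg category over `k` (with identities), graded by `G`.  Composition is written in the
usual order, `comp h f g = f ∘ g`. -/
structure DGCat (k : Type*) [Field k] (G : Type w) [GradingRing G]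
    extends GradedQuiver.{u, v} k G where
  d : ∀ {x y : Obj} {n : G}, Hom x y n →ₗ[k] Hom x y (n + 1)
  comp : ∀ {x y z : Obj} {m n p : G}, m + n = p → (Hom y z m →ₗ[k] Hom x y n →ₗ[k] Hom x z p)
  one : ∀ x : Obj, Hom x x 0
  d_d : ∀ {x y : Obj} {n : G} (f : Hom x y n), d (d f) = 0
  leibniz : ∀ {x y z : Obj} {m n p : G} (h : m + n = p) (h₁ : (m + 1) + n = p + 1)
    (h₂ : m + (n + 1) = p + 1) (f : Hom y z m) (g : Hom x y n),
    d (comp h f g) = comp h₁ (d f) g + sgn k m • comp h₂ f (d g)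
  assoc : ∀ {x y z t : Obj} {l m n lm mn p : G} (h₁ : l + m = lm) (h₂ : lm + n = p)
    (h₃ : m + n = mn) (h₄ : l + mn = p) (e : Hom z t l) (f : Hom y z m) (g : Hom x y n),
    comp h₂ (comp h₁ e f) g = comp h₄ e (comp h₃ f g)
  one_comp : ∀ {x y : Obj} {n : G} (h : 0 + n = n) (f : Hom x y n), comp h (one y) f = f
  comp_one : ∀ {x y : Obj} {n : G} (h : n + 0 = n) (f : Hom x y n), comp h f (one x) = f

section Chains

variable {k : Type uk} [Field k] {G : Type w} [GradingRing G]

theorem DGCat.d_one (A : DGCat.{u, v} k G) (x : A.Obj) : A.d (A.one x) = 0 := by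
  have h := A.leibniz (add_zero 0) (by simp) (by simp) (A.one x) (A.one x)
  rw [A.one_comp, A.comp_one (by simp), A.one_comp (by simp)] at h
  simpa [sgn] using h

/-- A homogeneous morphism together with its domain, codomain and degree. -/
structure Letter (Q : GradedQuiver.{u, v} k G) where
  cod : Q.Obj
  dom : Q.Obj
  deg : G
  hom : Q.Hom dom cod deg

/-- A homogeneous morphism seen as a letter. -/
def Letter.of (Q : GradedQuiver.{u, v} k G) {x y : Q.Obj} {n : G} (f : Q.Hom x y n) : Letter Q :=
  ⟨y, x, n, f⟩

/-- A word `[a₀, a₁, …, aₙ]`, standing for `a₀[a₁|…|aₙ]`, is cyclically composable if it is not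
empty, `dom aᵢ = cod aᵢ₊₁` for all `i < n`, and `dom aₙ = cod a₀`. -/
def IsCyclic {Q : GradedQuiver.{u, v} k G} : List (Letter Q) → Prop
  | [] => False
  | a :: l => List.IsChain (fun s t => s.dom = t.cod) (a :: (l ++ [a]))

/-- The relations among words: multilinearity in each letter (within a fixed space of homogeneous
morphisms), and vanishing of the words that are not cyclically composable. -/
def chainRelations (Q : GradedQuiver.{u, v} k G) : Set (List (Letter Q) →₀ k) :=
  {r | ∃ (p q : List (Letter Q)) (x y : Q.Obj) (n : G) (c : k) (f g : Q.Hom x y n),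
      r = Finsupp.single (p ++ Letter.of Q (c • f + g) :: q) 1
        - c • Finsupp.single (p ++ Letter.of Q f :: q) 1
        - Finsupp.single (p ++ Letter.of Q g :: q) 1} ∪
  {r | ∃ l : List (Letter Q), ¬ IsCyclic l ∧ r = Finsupp.single l 1}

/-- The Hochschild chains: the direct sum over all `n ≥ 0`, all objects `x₀, …, xₙ` and all degrees
of the tensor products `Hom(x₁,x₀) ⊗ Hom(x₂,x₁)[1] ⊗ ⋯ ⊗ Hom(x₀,xₙ)[1]`, presented by generators
(the words) and relations. -/
def Chains (Q : GradedQuiver.{u, v} k G) : Type _ :=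
  (List (Letter Q) →₀ k) ⧸ Submodule.span k (chainRelations Q)

noncomputable instance (Q : GradedQuiver.{u, v} k G) : AddCommGroup (Chains Q) :=
  inferInstanceAs (AddCommGroup (_ ⧸ Submodule.span k (chainRelations Q)))

noncomputable instance (Q : GradedQuiver.{u, v} k G) : Module k (Chains Q) :=
  inferInstanceAs (Module k (_ ⧸ Submodule.span k (chainRelations Q)))

/-- The chain `a₀[a₁|…|aₙ]` given by the word `[a₀, a₁, …, aₙ]`. -/
noncomputable def mk {Q : GradedQuiver.{u, v} k G} (l : List (Letter Q)) : Chains Q :=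
  Submodule.Quotient.mk (p := Submodule.span k (chainRelations Q)) (Finsupp.single l 1)

/-- A function on words respects the relations. -/
structure Respects {Q : GradedQuiver.{u, v} k G} {M : Type*} [AddCommGroup M] [Module k M]
    (φ : List (Letter Q) → M) : Prop where
  lin : ∀ (p q : List (Letter Q)) (x y : Q.Obj) (n : G) (c : k) (f g : Q.Hom x y n),
    φ (p ++ Letter.of Q (c • f + g) :: q) =
      c • φ (p ++ Letter.of Q f :: q) + φ (p ++ Letter.of Q g :: q)
  nc : ∀ l, ¬ IsCyclic l → φ l = 0

/-- A function on words that respects the relations defines a linear map on chains. -/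
noncomputable def Chains.lift {Q : GradedQuiver.{u, v} k G} {M : Type*} [AddCommGroup M]
    [Module k M] (φ : List (Letter Q) → M) (h : Respects φ) : Chains Q →ₗ[k] M :=
  Submodule.liftQ (Submodule.span k (chainRelations Q)) (Finsupp.linearCombination k φ) (by
    rw [Submodule.span_le]
    rintro r (⟨p, q, x, y, n, c, f, g, rfl⟩ | ⟨l, hl, rfl⟩)
    · simp [h.lin]
    · simp [h.nc l hl])

@[simp] theorem Chains.lift_mk {Q : GradedQuiver.{u, v} k G} {M : Type*} [AddCommGroup M]
    [Module k M] (φ : List (Letter Q) → M) (h : Respects φ) (l : List (Letter Q)) :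
    Chains.lift φ h (mk l) = φ l := by
  refine (Submodule.liftQ_apply (Submodule.span k (chainRelations Q))
    (Finsupp.linearCombination k φ) (Finsupp.single l 1)).trans ?_
  simp

theorem respects_mk (Q : GradedQuiver.{u, v} k G) : Respects (mk (Q := Q)) where
  lin p q x y n c f g := by
    have h : Finsupp.single (p ++ Letter.of Q (c • f + g) :: q) 1
        - (c • Finsupp.single (p ++ Letter.of Q f :: q) 1
        + Finsupp.single (p ++ Letter.of Q g :: q) 1) ∈ Submodule.span k (chainRelations Q) :=
      Submodule.subset_span (Or.inl ⟨p, q, x, y, n, c, f, g, by abel⟩)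
    exact (Submodule.Quotient.eq _).2 h
  nc l hl := (Submodule.Quotient.mk_eq_zero _).2
    (Submodule.subset_span (Or.inr ⟨l, hl, rfl⟩))

theorem mk_lin_of_eq {Q : GradedQuiver.{u, v} k G} (p q : List (Letter Q)) {x y : Q.Obj} {n : G}
    {c : k} {e f g : Q.Hom x y n} (h : e = c • f + g) :
    mk (p ++ Letter.of Q e :: q) = c • mk (p ++ Letter.of Q f :: q) + mk (p ++ Letter.of Q g :: q) := by
  rw [h]
  exact (respects_mk Q).lin p q x y n c f g

theorem mk_zero {Q : GradedQuiver.{u, v} k G} (p q : List (Letter Q)) (x y : Q.Obj) (n : G) :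
    mk (p ++ Letter.of Q (0 : Q.Hom x y n) :: q) = 0 := by
  have h := (respects_mk Q).lin p q x y n 1 0 0
  simpa using h

/-- The sum of the shifted degrees `|aᵢ| - 1` of the letters of a word. -/
def sdeg {Q : GradedQuiver.{u, v} k G} (l : List (Letter Q)) : G :=
  (l.map (fun a => a.deg - 1)).sum

/-- The chains of degree `g`; the word `a₀[a₁|…|aₙ]` has degree `|a₀| + ⋯ + |aₙ| - n`. -/
noncomputable def Chains.grade (Q : GradedQuiver.{u, v} k G) (g : G) : Submodule k (Chains Q) :=
  Submodule.span k {c | ∃ l : List (Letter Q), sdeg l + 1 = g ∧ c = mk l}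

/-! ### Cyclic composability -/

theorem isCyclic_iff {Q : GradedQuiver.{u, v} k G} (l : List (Letter Q)) :
    IsCyclic l ↔ l ≠ [] ∧ Cycle.Chain (fun s t => s.dom = t.cod) (l : Cycle (Letter Q)) := by
  cases l <;> simp [IsCyclic]

theorem isCyclic_swap {Q : GradedQuiver.{u, v} k G} (p q : List (Letter Q)) :
    IsCyclic (p ++ q) ↔ IsCyclic (q ++ p) := by
  rw [isCyclic_iff, isCyclic_iff]
  have : ((p ++ q : List (Letter Q)) : Cycle (Letter Q)) = (q ++ p : List (Letter Q)) :=
    Quotient.sound List.isRotated_append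
  rw [this]
  simp [and_comm]

/-- Cyclic composability depends only on the domains and codomains of the letters. -/
theorem isCyclic_congr {Q : GradedQuiver.{u, v} k G} {Q' : GradedQuiver.{u', v'} k G}
    (e : Q'.Obj → Q.Obj) (he : Function.Injective e)
    (l : List (Letter Q)) (l' : List (Letter Q'))
    (h : l.map (fun a => (a.cod, a.dom)) = l'.map (fun a => (e a.cod, e a.dom))) :
    IsCyclic l ↔ IsCyclic l' := by
  have h1 : l = [] ↔ l' = [] := by
    rw [← List.map_eq_nil_iff (f := fun a : Letter Q => (a.cod, a.dom)), h, List.map_eq_nil_iff]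
  rw [isCyclic_iff, isCyclic_iff, ne_eq, ne_eq, h1]
  refine and_congr_right fun _ => ?_
  have h2 := Cycle.chain_map (r := fun s t : Q.Obj × Q.Obj => s.2 = t.1)
    (fun a : Letter Q => (a.cod, a.dom)) (s := (l : Cycle (Letter Q)))
  have h3 := Cycle.chain_map (r := fun s t : Q.Obj × Q.Obj => s.2 = t.1)
    (fun a : Letter Q' => (e a.cod, e a.dom)) (s := (l' : Cycle (Letter Q')))
  rw [Cycle.map_coe] at h2 h3
  rw [h, h3] at h2
  simp only [he.eq_iff] at h2
  exact h2.symm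

theorem isCyclic_congr' {Q : GradedQuiver.{u, v} k G} (l l' : List (Letter Q))
    (h : l.map (fun a => (a.cod, a.dom)) = l'.map (fun a => (a.cod, a.dom))) :
    IsCyclic l ↔ IsCyclic l' :=
  isCyclic_congr id Function.injective_id l l' h

theorem isCyclic_merge {Q : GradedQuiver.{u, v} k G} (p q : List (Letter Q)) (a b c : Letter Q)
    (hab : a.dom = b.cod) (h1 : c.cod = a.cod) (h2 : c.dom = b.dom) :
    IsCyclic (p ++ a :: b :: q) ↔ IsCyclic (p ++ c :: q) := by
  rw [isCyclic_swap, isCyclic_swap p]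
  change List.IsChain _ (a :: (b :: (q ++ p) ++ [a])) ↔ List.IsChain _ (c :: ((q ++ p) ++ [c]))
  rcases q ++ p with _ | ⟨z, r⟩
  · simp [hab, h1, h2, eq_comm]
  · simp only [List.cons_append, List.isChain_cons_cons, hab, h2, true_and]
    refine and_congr_right fun _ => ?_
    rw [← List.cons_append, ← List.cons_append, List.isChain_append, List.isChain_append]
    simp [h1]

/-! ### The Hochschild differential -/

section Operators

variable (A : DGCat.{u, v} k G)

/-- The differential of a letter. -/
def Letter.diff (a : Letter A.toGradedQuiver) : Letter A.toGradedQuiver :=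
  Letter.of A.toGradedQuiver (A.d a.hom)

/-- The composition `a ∘ b` of two letters (the zero morphism if they are not composable). -/
noncomputable def Letter.mul (a b : Letter A.toGradedQuiver) : Letter A.toGradedQuiver :=
  open Classical in
  if h : b.cod = a.dom then
    Letter.of A.toGradedQuiver (A.comp (p := a.deg + b.deg) rfl a.hom (h ▸ b.hom))
  else Letter.of A.toGradedQuiver (0 : A.Hom b.dom a.cod (a.deg + b.deg))

/-- The identity of `x` as a letter. -/
def Letter.id (x : A.Obj) : Letter A.toGradedQuiver := Letter.of A.toGradedQuiver (A.one x)

/-- The part of the Hochschild differential that does not involve the cyclic face: for a word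
`a₀ … aₙ`, with `p = a₀ … aᵢ₋₁` the letters already passed, it is the sum over `j ≥ i` of the terms
`(-1) ^ (∑_{l<j} (|a_l| - 1)) · a₀[…|d aⱼ|…]` and
`(-1) ^ (∑_{l<j} (|a_l| - 1) + |aⱼ|) · a₀[…|aⱼ aⱼ₊₁|…]`. -/
noncomputable def barDiff :
    List (Letter A.toGradedQuiver) → List (Letter A.toGradedQuiver) → Chains A.toGradedQuiver
  | _, [] => 0
  | p, [a] => sgn k (sdeg p) • mk (p ++ [a.diff A])
  | p, a :: b :: l =>
      sgn k (sdeg p) • mk (p ++ a.diff A :: b :: l)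
        + (sgn k (sdeg p) * sgn k a.deg) • mk (p ++ a.mul A b :: l)
        + barDiff (p ++ [a]) (b :: l)

/-- The cyclic face
`(-1) ^ (|aₙ| + (|aₙ| - 1) * ∑_{l<n} (|a_l| - 1)) · (aₙ a₀)[a₁|…|aₙ₋₁]` of `a₀[a₁|…|aₙ]`, `n ≥ 1`;
the list is rotated to `aₙ, a₀, …, aₙ₋₁` first. -/
noncomputable def lastFace (l : List (Letter A.toGradedQuiver)) : Chains A.toGradedQuiver :=
  match l.rotate (l.length - 1) with
  | z :: a :: q =>
      (sgn k z.deg * sgn k ((z.deg - 1) * sdeg (a :: q))) • mk (z.mul A a :: q)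
  | _ => 0

/-- The inverse cyclic operator `t⁻¹` on words:
`a₀[a₁|…|aₙ] ↦ (-1) ^ ((|aₙ| - 1) * ∑_{l<n} (|a_l| - 1)) · aₙ[a₀|…|aₙ₋₁]`. -/
noncomputable def tInvWord {Q : GradedQuiver.{u, v} k G} (l : List (Letter Q)) : Chains Q :=
  match l.rotate (l.length - 1) with
  | z :: q => sgn k ((z.deg - 1) * sdeg q) • mk (z :: q)
  | [] => 0

theorem rotate_concat {α : Type*} (q : List α) (z : α) :
    (q ++ [z]).rotate ((q ++ [z]).length - 1) = z :: q := by
  simp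

@[simp] theorem mul_cod (a b : Letter A.toGradedQuiver) : (a.mul A b).cod = a.cod := by
  unfold Letter.mul; split_ifs <;> rfl

@[simp] theorem mul_dom (a b : Letter A.toGradedQuiver) : (a.mul A b).dom = b.dom := by
  unfold Letter.mul; split_ifs <;> rfl

theorem mk_diff_lin (p q : List (Letter A.toGradedQuiver)) (x y : A.Obj) (n : G) (c : k)
    (f g : A.Hom x y n) :
    mk (p ++ (Letter.of A.toGradedQuiver (c • f + g)).diff A :: q) =
      c • mk (p ++ (Letter.of A.toGradedQuiver f).diff A :: q)
        + mk (p ++ (Letter.of A.toGradedQuiver g).diff A :: q) := by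
  have := (respects_mk A.toGradedQuiver).lin p q x y (n + 1) c (A.d f) (A.d g)
  rw [← map_smul, ← map_add] at this
  exact this

theorem mul_of {x y z : A.Obj} {m n : G} (f : A.Hom y z m) (g : A.Hom x y n) :
    (Letter.of A.toGradedQuiver f).mul A (Letter.of A.toGradedQuiver g) =
      Letter.of A.toGradedQuiver (A.comp (p := m + n) rfl f g) :=
  dif_pos rfl

theorem mul_of_ne (a b : Letter A.toGradedQuiver) (h : ¬ b.cod = a.dom) :
    a.mul A b = Letter.of A.toGradedQuiver (0 : A.Hom b.dom a.cod (a.deg + b.deg)) :=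
  dif_neg h

theorem mk_mul_lin_left (p q : List (Letter A.toGradedQuiver)) (b : Letter A.toGradedQuiver)
    (x y : A.Obj) (n : G) (c : k) (f g : A.Hom x y n) :
    mk (p ++ (Letter.of A.toGradedQuiver (c • f + g)).mul A b :: q) =
      c • mk (p ++ (Letter.of A.toGradedQuiver f).mul A b :: q)
        + mk (p ++ (Letter.of A.toGradedQuiver g).mul A b :: q) := by
  by_cases h : b.cod = x
  · obtain ⟨bc, bd, bn, bh⟩ := b
    change bc = x at h
    subst h
    have h : A.comp (p := n + bn) rfl (c • f + g) bh = c • A.comp rfl f bh + A.comp rfl g bh := by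
      rw [map_add, map_smul]; rfl
    have e := fun f : A.Hom bc y n => mul_of A f bh
    change ∀ f, (Letter.of A.toGradedQuiver f).mul A ⟨bc, bd, bn, bh⟩ = _ at e
    rw [e, e, e]
    exact mk_lin_of_eq p q h
  · have e := fun f : A.Hom x y n => mul_of_ne A (Letter.of A.toGradedQuiver f) b h
    have z := fun f : A.Hom x y n =>
      mk_zero p q b.dom (Letter.of A.toGradedQuiver f).cod
        ((Letter.of A.toGradedQuiver f).deg + b.deg)
    rw [e, e, e, z, z, z, smul_zero, add_zero]

theorem mk_mul_lin_right (p q : List (Letter A.toGradedQuiver)) (a : Letter A.toGradedQuiver)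
    (x y : A.Obj) (n : G) (c : k) (f g : A.Hom x y n) :
    mk (p ++ a.mul A (Letter.of A.toGradedQuiver (c • f + g)) :: q) =
      c • mk (p ++ a.mul A (Letter.of A.toGradedQuiver f) :: q)
        + mk (p ++ a.mul A (Letter.of A.toGradedQuiver g) :: q) := by
  by_cases h : y = a.dom
  · obtain ⟨ac, ad, an, ah⟩ := a
    change y = ad at h
    subst h
    have h : A.comp (p := an + n) rfl ah (c • f + g) = c • A.comp rfl ah f + A.comp rfl ah g := by
      rw [map_add, map_smul]
    have e := fun f : A.Hom x y n => mul_of A ah f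
    change ∀ f, Letter.mul A ⟨ac, y, an, ah⟩ (Letter.of A.toGradedQuiver f) = _ at e
    rw [e, e, e]
    exact mk_lin_of_eq p q h
  · have e := fun f : A.Hom x y n => mul_of_ne A a (Letter.of A.toGradedQuiver f) h
    have z := fun f : A.Hom x y n =>
      mk_zero p q (Letter.of A.toGradedQuiver f).dom a.cod
        (a.deg + (Letter.of A.toGradedQuiver f).deg)
    rw [e, e, e, z, z, z, smul_zero, add_zero]

theorem sdeg_lin {Q : GradedQuiver.{u, v} k G} (p q : List (Letter Q)) {x y : Q.Obj} {n : G}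
    (f g : Q.Hom x y n) :
    sdeg (p ++ Letter.of Q f :: q) = sdeg (p ++ Letter.of Q g :: q) := by
  simp [sdeg, Letter.of]

theorem barDiff_lin_pre (p p' l : List (Letter A.toGradedQuiver)) (x y : A.Obj) (n : G) (c : k)
    (f g : A.Hom x y n) :
    barDiff A (p ++ Letter.of A.toGradedQuiver (c • f + g) :: p') l =
      c • barDiff A (p ++ Letter.of A.toGradedQuiver f :: p') l
        + barDiff A (p ++ Letter.of A.toGradedQuiver g :: p') l := by
  have L := fun q => (respects_mk A.toGradedQuiver).lin p q x y n c f g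
  have e1 := sdeg_lin p p' f (c • f + g)
  have e2 := sdeg_lin p p' g (c • f + g)
  induction l generalizing p' with
  | nil => simp [barDiff]
  | cons a l ih =>
    cases l with
    | nil =>
      simp only [barDiff, List.append_assoc, List.cons_append, L, e1, e2]
      module
    | cons b l =>
      have := ih (p' ++ [a]) (sdeg_lin p _ _ _) (sdeg_lin p _ _ _)
      simp only [barDiff, List.append_assoc, List.cons_append, L, e1, e2] at this ⊢
      rw [this]
      module

theorem barDiff_lin (r p q : List (Letter A.toGradedQuiver)) (x y : A.Obj) (n : G) (c : k)
    (f g : A.Hom x y n) :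
    barDiff A r (p ++ Letter.of A.toGradedQuiver (c • f + g) :: q) =
      c • barDiff A r (p ++ Letter.of A.toGradedQuiver f :: q)
        + barDiff A r (p ++ Letter.of A.toGradedQuiver g :: q) := by
  induction p generalizing r with
  | nil =>
    cases q with
    | nil =>
      simp only [barDiff, List.nil_append, mk_diff_lin]
      module
    | cons b q =>
      simp only [barDiff, List.nil_append, mk_diff_lin, mk_mul_lin_left, barDiff_lin_pre]
      simp only [Letter.of]
      module
  | cons a p ih =>
    cases p with
    | nil =>
      have L := (respects_mk A.toGradedQuiver).lin (r ++ [a.diff A]) q x y n c f g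
      have := ih (r ++ [a])
      simp only [List.nil_append, List.append_assoc, List.cons_append] at L this
      simp only [barDiff, List.nil_append, List.cons_append, mk_mul_lin_right, L, this]
      module
    | cons b p =>
      have L1 := (respects_mk A.toGradedQuiver).lin (r ++ a.diff A :: b :: p) q x y n c f g
      have L2 := (respects_mk A.toGradedQuiver).lin (r ++ a.mul A b :: p) q x y n c f g
      have := ih (r ++ [a])
      simp only [List.append_assoc, List.cons_append] at L1 L2 this
      simp only [barDiff, List.cons_append, L1, L2, this]
      module

theorem mk_eq_zero_of_not {Q : GradedQuiver.{u, v} k G} {l : List (Letter Q)}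
    (h : ¬ IsCyclic l) : mk l = 0 := (respects_mk Q).nc l h

theorem not_isCyclic_diff {p q : List (Letter A.toGradedQuiver)} {a : Letter A.toGradedQuiver}
    (h : ¬ IsCyclic (p ++ a :: q)) : ¬ IsCyclic (p ++ a.diff A :: q) := by
  rwa [isCyclic_congr' (p ++ a.diff A :: q) (p ++ a :: q)]
  simp [Letter.diff, Letter.of]

theorem mk_mul_eq_zero {p q : List (Letter A.toGradedQuiver)} {a b : Letter A.toGradedQuiver}
    (h : ¬ IsCyclic (p ++ a :: b :: q)) : mk (p ++ a.mul A b :: q) = 0 := by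
  by_cases hab : b.cod = a.dom
  · exact mk_eq_zero_of_not
      (mt (isCyclic_merge p q a b _ hab.symm (mul_cod A a b) (mul_dom A a b)).2 h)
  · rw [mul_of_ne A a b hab, mk_zero]

theorem barDiff_nc (p l : List (Letter A.toGradedQuiver)) (h : ¬ IsCyclic (p ++ l)) :
    barDiff A p l = 0 := by
  induction l generalizing p with
  | nil => rfl
  | cons a l ih =>
    cases l with
    | nil => simp [barDiff, mk_eq_zero_of_not (not_isCyclic_diff A h)]
    | cons b l =>
      simp [barDiff, mk_eq_zero_of_not (not_isCyclic_diff A h), mk_mul_eq_zero A h,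
        ih (p ++ [a]) (by simpa using h)]

theorem respects_lastFace : Respects (lastFace A) where
  lin p q x y n c f g := by
    have key : ∀ (q : List (Letter A.toGradedQuiver)) (z : Letter A.toGradedQuiver),
        lastFace A (q ++ [z]) = match q with
          | a :: q => (sgn k z.deg * sgn k ((z.deg - 1) * sdeg (a :: q))) • mk (z.mul A a :: q)
          | [] => 0 := by
      intro q z
      unfold lastFace
      rw [rotate_concat]
      cases q <;> rfl
    rcases List.eq_nil_or_concat q with rfl | ⟨q, z, rfl⟩
    · rw [key, key, key]
      cases p with
      | nil => simp
      | cons a p =>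
        have := mk_mul_lin_left A [] p a x y n c f g
        simp only [List.nil_append] at this
        simp only [this]
        simp only [Letter.of]
        module
    · have e : ∀ w : Letter A.toGradedQuiver, p ++ w :: q.concat z = (p ++ w :: q) ++ [z] := by
        intro w; simp
      rw [e, e, e, key, key, key]
      cases p with
      | nil =>
        have := mk_mul_lin_right A [] q z x y n c f g
        simp only [List.nil_append] at this ⊢
        simp only [this, sdeg, List.map_cons]
        simp only [Letter.of]
        module
      | cons a p =>
        have L := (respects_mk A.toGradedQuiver).lin (z.mul A a :: p) q x y n c f g
        have e1 := sdeg_lin (a :: p) q f (c • f + g)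
        have e2 := sdeg_lin (a :: p) q g (c • f + g)
        simp only [List.cons_append] at L e1 e2 ⊢
        simp only [L, e1, e2]
        module
  nc l hl := by
    rcases List.eq_nil_or_concat l with rfl | ⟨q, z, rfl⟩
    · rfl
    · rw [List.concat_eq_append] at hl ⊢
      unfold lastFace
      rw [rotate_concat]
      rw [isCyclic_swap] at hl
      cases q with
      | nil => rfl
      | cons a q =>
        have := mk_mul_eq_zero A (p := []) (q := q) (a := z) (b := a) hl
        simp only [List.nil_append] at this
        simp [this]

theorem respects_b : Respects (fun l => barDiff A [] l + lastFace A l) where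
  lin p q x y n c f g := by
    simp only [barDiff_lin, (respects_lastFace A).lin]
    module
  nc l hl := by
    simp only [(respects_lastFace A).nc l hl, barDiff_nc A [] l hl, add_zero]

/-- The Hochschild differential `b`. -/
noncomputable def hochB : Chains A.toGradedQuiver →ₗ[k] Chains A.toGradedQuiver :=
  Chains.lift _ (respects_b A)

theorem tInvWord_concat {Q : GradedQuiver.{u, v} k G} (q : List (Letter Q)) (z : Letter Q) :
    tInvWord (q ++ [z]) = sgn k ((z.deg - 1) * sdeg q) • mk (z :: q) := by
  unfold tInvWord
  rw [rotate_concat]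

theorem respects_tInvWord (Q : GradedQuiver.{u, v} k G) : Respects (tInvWord (Q := Q)) where
  lin p q x y n c f g := by
    rcases List.eq_nil_or_concat q with rfl | ⟨q, z, rfl⟩
    · have L := (respects_mk Q).lin [] p x y n c f g
      simp only [List.nil_append] at L
      simp only [tInvWord_concat, L]
      simp only [Letter.of]
      module
    · have e : ∀ w : Letter Q, p ++ w :: q.concat z = (p ++ w :: q) ++ [z] := by
        intro w; simp
      have L := (respects_mk Q).lin (z :: p) q x y n c f g
      have e1 := sdeg_lin p q f (c • f + g)
      have e2 := sdeg_lin p q g (c • f + g)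
      simp only [List.cons_append] at L
      simp only [e, tInvWord_concat, L, e1, e2]
      module
  nc l hl := by
    rcases List.eq_nil_or_concat l with rfl | ⟨q, z, rfl⟩
    · rfl
    · rw [List.concat_eq_append] at hl ⊢
      rw [isCyclic_swap] at hl
      rw [tInvWord_concat, mk_eq_zero_of_not (by simpa using hl), smul_zero]

/-- The inverse cyclic operator `t⁻¹`. -/
noncomputable def tInv (Q : GradedQuiver.{u, v} k G) : Chains Q →ₗ[k] Chains Q :=
  Chains.lift _ (respects_tInvWord Q)

theorem respects_norm (Q : GradedQuiver.{u, v} k G) :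
    Respects (fun l : List (Letter Q) => ∑ i ∈ Finset.range l.length, (tInv Q ^ i) (mk l)) where
  lin p q x y n c f g := by
    simp only [(respects_mk Q).lin, map_add, map_smul, Finset.sum_add_distrib, Finset.smul_sum,
      List.length_append, List.length_cons]
  nc l hl := by simp [mk_eq_zero_of_not hl]

/-- The norm operator `N = 1 + t⁻¹ + ⋯ + t⁻ⁿ` on words `a₀[a₁|…|aₙ]`. -/
noncomputable def normOp (Q : GradedQuiver.{u, v} k G) : Chains Q →ₗ[k] Chains Q :=
  Chains.lift _ (respects_norm Q)

/-- The operator `1 - t⁻¹`. -/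
noncomputable def oneSubT (Q : GradedQuiver.{u, v} k G) : Chains Q →ₗ[k] Chains Q :=
  LinearMap.id - tInv Q

/-- `a₀[a₁|…|aₙ] ↦ 1_{cod a₀}[a₀|…|aₙ]` on words. -/
noncomputable def sWord : List (Letter A.toGradedQuiver) → Chains A.toGradedQuiver
  | [] => 0
  | a :: l => mk (Letter.id A a.cod :: a :: l)

theorem respects_sWord : Respects (sWord A) where
  lin p q x y n c f g := by
    cases p with
    | nil => exact (respects_mk _).lin [Letter.id A y] q x y n c f g
    | cons a p => exact (respects_mk _).lin (Letter.id A a.cod :: a :: p) q x y n c f g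
  nc l hl := by
    cases l with
    | nil => rfl
    | cons a l =>
      refine mk_eq_zero_of_not fun h => hl ?_
      exact (isCyclic_merge [] l (Letter.id A a.cod) a a rfl rfl rfl).1 h

/-- The extra degeneracy `s : a₀[a₁|…|aₙ] ↦ 1_{cod a₀}[a₀|…|aₙ]`. -/
noncomputable def sOp : Chains A.toGradedQuiver →ₗ[k] Chains A.toGradedQuiver :=
  Chains.lift _ (respects_sWord A)

/-- Connes' operator `B = (1 - t⁻¹) s N`. -/
noncomputable def connesB : Chains A.toGradedQuiver →ₗ[k] Chains A.toGradedQuiver :=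
  oneSubT A.toGradedQuiver ∘ₗ sOp A ∘ₗ normOp A.toGradedQuiver

/-! ### The normalized complex -/

/-- The submodule spanned by the words `a₀[a₁|…|aₙ]` with an identity among `a₁, …, aₙ`. -/
noncomputable def degenerate : Submodule k (Chains A.toGradedQuiver) :=
  Submodule.span k {c | ∃ (a : Letter A.toGradedQuiver) (p q : List (Letter A.toGradedQuiver))
    (x : A.Obj), c = mk (a :: (p ++ Letter.id A x :: q))}

theorem mk_mem_degenerate (a : Letter A.toGradedQuiver) (p q : List (Letter A.toGradedQuiver))
    (x : A.Obj) : mk (a :: (p ++ Letter.id A x :: q)) ∈ degenerate A :=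
  Submodule.subset_span ⟨a, p, q, x, rfl⟩

theorem barDiff_pre_mem (a : Letter A.toGradedQuiver) (p q l : List (Letter A.toGradedQuiver))
    (x : A.Obj) : barDiff A (a :: (p ++ Letter.id A x :: q)) l ∈ degenerate A := by
  have M := fun r => mk_mem_degenerate A a p r x
  induction l generalizing q with
  | nil => exact zero_mem _
  | cons b l ih =>
    cases l with
    | nil =>
      simp only [barDiff, List.cons_append, List.append_assoc]
      exact Submodule.smul_mem _ _ (M _)
    | cons c l =>
      have := ih (q ++ [b])
      simp only [barDiff, List.cons_append, List.append_assoc] at this ⊢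
      exact add_mem (add_mem (Submodule.smul_mem _ _ (M _)) (Submodule.smul_mem _ _ (M _))) this

theorem letter_mul_id (a : Letter A.toGradedQuiver) : a.mul A (Letter.id A a.dom) = a := by
  obtain ⟨ac, ad, an, ah⟩ := a
  refine (mul_of A ah (A.one ad)).trans ?_
  have : ∀ m (h : an + 0 = m) (h' : m = an), Letter.of A.toGradedQuiver (A.comp h ah (A.one ad)) =
      Letter.of A.toGradedQuiver ah := by
    rintro m h rfl
    rw [A.comp_one]
  exact this _ rfl (add_zero _)

theorem letter_id_mul (a : Letter A.toGradedQuiver) : (Letter.id A a.cod).mul A a = a := by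
  obtain ⟨ac, ad, an, ah⟩ := a
  refine (mul_of A (A.one ac) ah).trans ?_
  have : ∀ m (h : 0 + an = m) (h' : m = an), Letter.of A.toGradedQuiver (A.comp h (A.one ac) ah) =
      Letter.of A.toGradedQuiver ah := by
    rintro m h rfl
    rw [A.one_comp]
  exact this _ rfl (zero_add _)

theorem mk_diff_id (p q : List (Letter A.toGradedQuiver)) (x : A.Obj) :
    mk (p ++ (Letter.id A x).diff A :: q) = 0 := by
  have : (Letter.id A x).diff A = Letter.of A.toGradedQuiver (0 : A.Hom x x (0 + 1)) :=
    congrArg (Letter.of A.toGradedQuiver) (A.d_one x)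
  rw [this, mk_zero]

theorem sgn_mul_self (g : G) : sgn k g * sgn k g = 1 := by
  unfold sgn; split_ifs <;> simp

theorem sgn_add (g h : G) : sgn k (g + h) = sgn k g * sgn k h := by
  unfold sgn
  rw [map_add]
  generalize GradingRing.parity (G := G) g = a
  generalize GradingRing.parity (G := G) h = b
  have ha : ∀ a : ZMod 2, a = 0 ∨ a = 1 := by decide
  have h2 : (1 + 1 : ZMod 2) = 0 := by decide
  rcases ha a with rfl | rfl <;> rcases ha b with rfl | rfl <;> simp [h2]

theorem sgn_zero : sgn k (0 : G) = 1 := by simp [sgn]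

theorem sgn_one : sgn k (1 : G) = -1 := by simp [sgn]

theorem sgn_neg (g : G) : sgn k (-g) = sgn k g := by
  simp [sgn]

theorem sdeg_concat {Q : GradedQuiver.{u, v} k G} (p : List (Letter Q)) (a : Letter Q) :
    sgn k (sdeg (p ++ [a])) = -(sgn k (sdeg p) * sgn k a.deg) := by
  have : sdeg (p ++ [a]) = sdeg p + (a.deg + -1) := by simp [sdeg, sub_eq_add_neg]
  rw [this, sgn_add, sgn_add, sgn_neg, sgn_one]
  ring

theorem isCyclic_adj {Q : GradedQuiver.{u, v} k G} {p q : List (Letter Q)} {a b : Letter Q}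
    (h : IsCyclic (p ++ a :: b :: q)) : a.dom = b.cod := by
  rw [isCyclic_swap] at h
  exact (List.isChain_cons_cons.1 h).1

theorem barDiff_degenerate_head (p q : List (Letter A.toGradedQuiver))
    (a c : Letter A.toGradedQuiver) (x : A.Obj)
    (hc : IsCyclic (p ++ a :: Letter.id A x :: c :: q)) :
    barDiff A p (a :: Letter.id A x :: c :: q) ∈ degenerate A := by
  have h1 : a.dom = x := isCyclic_adj hc
  have h2 : x = c.cod := by
    have : IsCyclic ((p ++ [a]) ++ Letter.id A x :: c :: q) := by simpa using hc
    exact isCyclic_adj this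
  have M : ∀ (b : Letter A.toGradedQuiver) l, mk (p ++ b :: Letter.id A x :: l) ∈ degenerate A := by
    intro b l
    cases p with
    | nil => exact mk_mem_degenerate A b [] l x
    | cons z p => simpa using mk_mem_degenerate A z (p ++ [b]) l x
  have R : barDiff A (p ++ [a] ++ [Letter.id A x]) (c :: q) ∈ degenerate A := by
    cases p with
    | nil => exact barDiff_pre_mem A a [] [] (c :: q) x
    | cons z p => simpa using barDiff_pre_mem A z (p ++ [a]) [] (c :: q) x
  have e1 : a.mul A (Letter.id A x) = a := by rw [← h1, letter_mul_id]
  have e2 : (Letter.id A x).mul A c = c := by rw [h2, letter_id_mul]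
  have e3 : (Letter.id A x).deg = 0 := rfl
  have e4 := mk_diff_id A (p ++ [a]) (c :: q) x
  simp only [barDiff, e1, e2, e3, e4, sgn_zero, sdeg_concat, smul_zero, zero_add, mul_one]
  have : (sgn k (sdeg p) * sgn k a.deg) • mk (p ++ a :: c :: q)
      + (-(sgn k (sdeg p) * sgn k a.deg) • mk (p ++ [a] ++ c :: q)
        + barDiff A (p ++ [a] ++ [Letter.id A x]) (c :: q)) =
      barDiff A (p ++ [a] ++ [Letter.id A x]) (c :: q) := by
    simp only [List.append_assoc, List.cons_append, List.nil_append]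
    module
  rw [add_assoc, this]
  exact add_mem (Submodule.smul_mem _ _ (M _ _)) R

theorem barDiff_degenerate_last (p : List (Letter A.toGradedQuiver))
    (a : Letter A.toGradedQuiver) (x : A.Obj)
    (hc : IsCyclic (p ++ [a, Letter.id A x])) :
    barDiff A p [a, Letter.id A x] - (sgn k (sdeg p) * sgn k a.deg) • mk (p ++ [a])
      ∈ degenerate A := by
  have h1 : a.dom = x := isCyclic_adj hc
  have M : ∀ (b : Letter A.toGradedQuiver) l, mk (p ++ b :: Letter.id A x :: l) ∈ degenerate A := by
    intro b l
    cases p with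
    | nil => exact mk_mem_degenerate A b [] l x
    | cons z p => simpa using mk_mem_degenerate A z (p ++ [b]) l x
  have e1 : a.mul A (Letter.id A x) = a := by rw [← h1, letter_mul_id]
  have e4 := mk_diff_id A (p ++ [a]) [] x
  simp only [barDiff, e1, e4, smul_zero, add_zero, add_sub_cancel_right]
  exact Submodule.smul_mem _ _ (M _ _)

theorem barDiff_degenerate (r p q : List (Letter A.toGradedQuiver))
    (a c : Letter A.toGradedQuiver) (x : A.Obj)
    (hc : IsCyclic (r ++ (p ++ a :: Letter.id A x :: c :: q))) :
    barDiff A r (p ++ a :: Letter.id A x :: c :: q) ∈ degenerate A := by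
  induction p generalizing r with
  | nil => exact barDiff_degenerate_head A r q a c x hc
  | cons y p ih =>
    have M : ∀ (b : Letter A.toGradedQuiver) l l',
        mk (r ++ b :: (l ++ Letter.id A x :: l')) ∈ degenerate A := by
      intro b l l'
      cases r with
      | nil => exact mk_mem_degenerate A b l l' x
      | cons z r => simpa using mk_mem_degenerate A z (r ++ b :: l) l' x
    have := ih (r ++ [y]) (by simpa using hc)
    cases p with
    | nil =>
      simp only [List.nil_append, List.cons_append, barDiff] at this ⊢
      exact add_mem (add_mem (Submodule.smul_mem _ _ (M _ [a] _))
        (Submodule.smul_mem _ _ (M _ [] _))) this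
    | cons z p =>
      simp only [List.cons_append, barDiff] at this ⊢
      exact add_mem (add_mem (Submodule.smul_mem _ _ (by simpa using M _ (z :: (p ++ [a])) (c :: q)))
        (Submodule.smul_mem _ _ (by simpa using M _ (p ++ [a]) (c :: q)))) this

theorem barDiff_degenerate' (r p : List (Letter A.toGradedQuiver))
    (a : Letter A.toGradedQuiver) (x : A.Obj)
    (hc : IsCyclic (r ++ (p ++ [a, Letter.id A x]))) :
    barDiff A r (p ++ [a, Letter.id A x])
      + sgn k (sdeg (r ++ (p ++ [a]))) • mk (r ++ (p ++ [a])) ∈ degenerate A := by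
  induction p generalizing r with
  | nil =>
    have := barDiff_degenerate_last A r a x hc
    simp only [List.nil_append, sdeg_concat]
    rwa [neg_smul, ← sub_eq_add_neg]
  | cons y p ih =>
    have M : ∀ (b : Letter A.toGradedQuiver) l l',
        mk (r ++ b :: (l ++ Letter.id A x :: l')) ∈ degenerate A := by
      intro b l l'
      cases r with
      | nil => exact mk_mem_degenerate A b l l' x
      | cons z r => simpa using mk_mem_degenerate A z (r ++ b :: l) l' x
    have := ih (r ++ [y]) (by simpa using hc)
    cases p with
    | nil =>
      simp only [List.nil_append, List.cons_append, List.append_assoc, barDiff] at this ⊢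
      rw [add_assoc]
      exact add_mem (add_mem (Submodule.smul_mem _ _ (M _ [a] _))
        (Submodule.smul_mem _ _ (M _ [] _))) this
    | cons z p =>
      simp only [List.cons_append, List.append_assoc, List.nil_append, barDiff] at this ⊢
      rw [add_assoc]
      exact add_mem (add_mem (Submodule.smul_mem _ _ (by simpa using M _ (z :: (p ++ [a])) []))
        (Submodule.smul_mem _ _ (by simpa using M _ (p ++ [a]) []))) this

theorem lastFace_concat (q : List (Letter A.toGradedQuiver)) (a z : Letter A.toGradedQuiver) :
    lastFace A (a :: (q ++ [z])) =
      (sgn k z.deg * sgn k ((z.deg - 1) * sdeg (a :: q))) • mk (z.mul A a :: q) := by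
  unfold lastFace
  rw [← List.cons_append, rotate_concat]

theorem hochB_degenerate : degenerate A ≤ (degenerate A).comap (hochB A) := by
  refine Submodule.span_le.2 ?_
  rintro _ ⟨a, p, q, x, rfl⟩
  change hochB A (mk _) ∈ degenerate A
  by_cases hc : IsCyclic (a :: (p ++ Letter.id A x :: q))
  swap
  · rw [mk_eq_zero_of_not hc, map_zero]
    exact zero_mem _
  rw [hochB, Chains.lift_mk]
  -- the letter in front of the identity
  obtain ⟨p', a', hp⟩ : ∃ p' a', a :: p = p' ++ [a'] := by
    rcases List.eq_nil_or_concat (a :: p) with h | ⟨p', a', h⟩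
    · simp at h
    · exact ⟨p', a', by simpa using h⟩
  have hw : ∀ l, a :: (p ++ Letter.id A x :: l) = p' ++ a' :: Letter.id A x :: l := by
    intro l
    rw [← List.cons_append, hp]; simp
  rcases List.eq_nil_or_concat q with rfl | ⟨q, z, rfl⟩
  · rw [lastFace_concat, hw [], hp]
    have key := barDiff_degenerate' A [] p' a' x (by simpa [hw [], hp] using hc)
    have hx : x = a.cod := by
      rw [← List.cons_append, isCyclic_swap] at hc
      exact isCyclic_adj (p := []) hc
    have e : (Letter.id A x).mul A a = a := by rw [hx, letter_id_mul]
    have e3 : (Letter.id A x).deg = 0 := rfl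
    rw [e, e3, sgn_zero, one_mul, zero_sub, neg_one_mul, sgn_neg, hp]
    exact key
  · rw [List.concat_eq_append] at hc ⊢
    refine add_mem ?_ ?_
    · rw [hw] at hc ⊢
      cases q with
      | nil => exact barDiff_degenerate A [] p' [] a' z x hc
      | cons c q => exact barDiff_degenerate A [] p' (q ++ [z]) a' c x hc
    · have e : a :: (p ++ Letter.id A x :: (q ++ [z])) =
          a :: ((p ++ Letter.id A x :: q) ++ [z]) := by simp
      rw [e, lastFace_concat]
      exact Submodule.smul_mem _ _ (mk_mem_degenerate A _ p q x)

/-- The span of the words that contain an identity (in any position). -/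
noncomputable def withId : Submodule k (Chains A.toGradedQuiver) :=
  Submodule.span k {c | ∃ (p q : List (Letter A.toGradedQuiver)) (x : A.Obj),
    c = mk (p ++ Letter.id A x :: q)}

theorem tInv_withId (c : Chains A.toGradedQuiver) (hc : c ∈ withId A) :
    tInv A.toGradedQuiver c ∈ withId A := by
  suffices h : withId A ≤ (withId A).comap (tInv A.toGradedQuiver) from h hc
  refine Submodule.span_le.2 ?_
  rintro _ ⟨p, q, x, rfl⟩
  change tInv A.toGradedQuiver (mk _) ∈ withId A
  rw [tInv, Chains.lift_mk]
  rcases List.eq_nil_or_concat q with rfl | ⟨q, z, rfl⟩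
  · rw [tInvWord_concat]
    exact Submodule.smul_mem _ _ (Submodule.subset_span ⟨[], p, x, rfl⟩)
  · rw [List.concat_eq_append, ← List.cons_append, ← List.append_assoc, tInvWord_concat]
    exact Submodule.smul_mem _ _ (Submodule.subset_span ⟨z :: p, q, x, rfl⟩)

theorem connesB_degenerate : degenerate A ≤ (degenerate A).comap (connesB A) := by
  have h1 : degenerate A ≤ (withId A).comap (normOp A.toGradedQuiver) := by
    refine Submodule.span_le.2 ?_
    rintro _ ⟨a, p, q, x, rfl⟩
    change normOp A.toGradedQuiver (mk _) ∈ withId A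
    rw [normOp, Chains.lift_mk]
    refine sum_mem fun i hi => ?_
    clear hi
    induction i with
    | zero => exact Submodule.subset_span ⟨a :: p, q, x, rfl⟩
    | succ i ih =>
      rw [pow_succ']
      exact tInv_withId A _ ih
  have h2 : withId A ≤ (degenerate A).comap
      (oneSubT A.toGradedQuiver ∘ₗ sOp A) := by
    refine Submodule.span_le.2 ?_
    rintro _ ⟨p, q, x, rfl⟩
    change sOp A (mk _) - tInv A.toGradedQuiver (sOp A (mk _)) ∈ degenerate A
    obtain ⟨y, l, hl⟩ : ∃ y l, p ++ Letter.id A x :: q = y :: l := by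
      cases p with
      | nil => exact ⟨_, _, rfl⟩
      | cons y p => exact ⟨_, _, rfl⟩
    have e : sOp A (mk (p ++ Letter.id A x :: q)) =
        mk (Letter.id A y.cod :: (p ++ Letter.id A x :: q)) := by
      rw [sOp, Chains.lift_mk, hl]; rfl
    rw [e]
    refine sub_mem (mk_mem_degenerate A _ p q x) ?_
    rw [tInv, Chains.lift_mk]
    rcases List.eq_nil_or_concat (p ++ Letter.id A x :: q) with h | ⟨r, z, h⟩
    · simp at h
    · rw [h, List.concat_eq_append, ← List.cons_append, tInvWord_concat]
      exact Submodule.smul_mem _ _ (mk_mem_degenerate A z [] r y.cod)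
  intro c hc
  exact h2 (h1 hc)

/-- The normalized Hochschild chains. -/
abbrev NChains : Type _ := Chains A.toGradedQuiver ⧸ degenerate A

/-- The differential of the normalized Hochschild complex. -/
noncomputable def hochBbar : NChains A →ₗ[k] NChains A :=
  Submodule.mapQ _ _ (hochB A) (hochB_degenerate A)

/-- Connes' operator on the normalized Hochschild complex. -/
noncomputable def connesBbar : NChains A →ₗ[k] NChains A :=
  Submodule.mapQ _ _ (connesB A) (connesB_degenerate A)

/-- The normalized chains of degree `g`. -/
noncomputable def NChains.grade (g : G) : Submodule k (NChains A) :=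
  (Chains.grade A.toGradedQuiver g).map (degenerate A).mkQ

end Operators

/-! ### Semifunctors -/

/-- A degree-preserving map of graded quivers. -/
structure QuiverHom (Q : GradedQuiver.{u, v} k G) (Q' : GradedQuiver.{u', v'} k G) where
  obj : Q.Obj → Q'.Obj
  map : ∀ {x y : Q.Obj} {n : G}, Q.Hom x y n →ₗ[k] Q'.Hom (obj x) (obj y) n

/-- A semifunctor (non-unital dg functor): it preserves differentials and compositions, but not
necessarily identities. -/
structure Semifunctor (A : DGCat.{u, v} k G) (B : DGCat.{u', v'} k G)
    extends QuiverHom A.toGradedQuiver B.toGradedQuiver where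
  map_d : ∀ {x y : A.Obj} {n : G} (f : A.Hom x y n), map (A.d f) = B.d (map f)
  map_comp : ∀ {x y z : A.Obj} {m n p : G} (h : m + n = p) (f : A.Hom y z m) (g : A.Hom x y n),
    map (A.comp h f g) = B.comp h (map f) (map g)

/-- The action of a map of quivers on letters. -/
def QuiverHom.letter {Q : GradedQuiver.{u, v} k G} {Q' : GradedQuiver.{u', v'} k G}
    (F : QuiverHom Q Q') (a : Letter Q) : Letter Q' :=
  Letter.of Q' (F.map a.hom)

theorem isCyclic_lin {Q : GradedQuiver.{u, v} k G} (p q : List (Letter Q)) {x y : Q.Obj} {n : G}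
    (f g : Q.Hom x y n) :
    IsCyclic (p ++ Letter.of Q f :: q) ↔ IsCyclic (p ++ Letter.of Q g :: q) :=
  isCyclic_congr' _ _ (by simp [Letter.of])

theorem mk_letter_lin {Q : GradedQuiver.{u, v} k G} {Q' : GradedQuiver.{u', v'} k G}
    (F : QuiverHom Q Q') (p q : List (Letter Q')) (x y : Q.Obj) (n : G) (c : k)
    (f g : Q.Hom x y n) :
    mk (p ++ F.letter (Letter.of Q (c • f + g)) :: q) =
      c • mk (p ++ F.letter (Letter.of Q f) :: q) + mk (p ++ F.letter (Letter.of Q g) :: q) :=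
  mk_lin_of_eq p q (e := F.map (c • f + g)) (f := F.map f) (g := F.map g)
    (by rw [map_add, map_smul])

open Classical in
theorem respects_map {Q : GradedQuiver.{u, v} k G} {Q' : GradedQuiver.{u', v'} k G}
    (F : QuiverHom Q Q') :
    Respects (fun l : List (Letter Q) => if IsCyclic l then mk (l.map F.letter) else 0) where
  lin p q x y n c f g := by
    simp only [isCyclic_lin p q (c • f + g) 0, isCyclic_lin p q f 0, isCyclic_lin p q g 0,
      List.map_append, List.map_cons, mk_letter_lin]
    split_ifs <;> simp
  nc l hl := if_neg hl

open Classical in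
/-- The map `F_*` induced on Hochschild chains,
`a₀[a₁|…|aₙ] ↦ F(a₀)[F(a₁)|…|F(aₙ)]` on cyclically composable words. -/
noncomputable def Chains.map {Q : GradedQuiver.{u, v} k G} {Q' : GradedQuiver.{u', v'} k G}
    (F : QuiverHom Q Q') : Chains Q →ₗ[k] Chains Q' :=
  Chains.lift _ (respects_map F)

theorem Chains.map_mk {Q : GradedQuiver.{u, v} k G} {Q' : GradedQuiver.{u', v'} k G}
    (F : QuiverHom Q Q') (l : List (Letter Q)) (hl : IsCyclic l) :
    Chains.map F (mk l) = mk (l.map F.letter) := by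
  rw [Chains.map, Chains.lift_mk, if_pos hl]

/-! ### The non-unital Hochschild complex -/

open Classical in
/-- The space of multiples of the adjoined identity among the morphisms `x ⟶ y` of degree `n`:
all of `k` if `x = y` and `n = 0`, and `0` otherwise. -/
noncomputable def extra (Q : GradedQuiver.{u, v} k G) (x y : Q.Obj) (n : G) : Submodule k k :=
  if x = y ∧ n = 0 then ⊤ else ⊥

theorem extra_eq_zero {Q : GradedQuiver.{u, v} k G} {x y : Q.Obj} {n : G} (c : extra Q x y n)
    (h : ¬ (x = y ∧ n = 0)) : c.1 = 0 := by
  have e : extra Q x y n = ⊥ := if_neg h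
  rw [← Submodule.mem_bot k, ← e]
  exact c.2

/-- The graded quiver underlying `A⁺`, obtained by adjoining an identity `e_x` to each object. -/
noncomputable def Plus (Q : GradedQuiver.{u, v} k G) : GradedQuiver.{u, max v uk} k G where
  Obj := Q.Obj
  Hom x y n := Q.Hom x y n × extra Q x y n

/-- The adjoined identity `e_x` as a letter. -/
noncomputable def Plus.e (Q : GradedQuiver.{u, v} k G) (x : Q.Obj) : Letter (Plus Q) :=
  Letter.of (Plus Q) (x := x) (y := x) (n := 0) ((0 : Q.Hom x x 0), ⟨1, by simp [extra]⟩)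

/-- The inclusion `A → A⁺`. -/
noncomputable def Plus.inl (Q : GradedQuiver.{u, v} k G) : QuiverHom Q (Plus Q) where
  obj x := x
  map := fun {x y : Q.Obj} {n : G} => LinearMap.inl k (Q.Hom x y n) (extra Q x y n)

/-- The projection `A⁺ → A` that kills the adjoined identities. -/
noncomputable def Plus.fst (Q : GradedQuiver.{u, v} k G) : QuiverHom (Plus Q) Q where
  obj x := x
  map := fun {x y : Q.Obj} {n : G} => LinearMap.fst k (Q.Hom x y n) (extra Q x y n)

/-- The map `F⁺ : A⁺ → B⁺` with `F⁺(e_x) = e_{F x}`. -/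
noncomputable def Plus.map {Q : GradedQuiver.{u, v} k G} {Q' : GradedQuiver.{u', v'} k G}
    (F : QuiverHom Q Q') : QuiverHom (Plus Q) (Plus Q') where
  obj := F.obj
  map {x y n} := LinearMap.prodMap F.map (Submodule.inclusion (by
    unfold extra
    split_ifs with h1 h2
    · exact le_rfl
    · exact absurd ⟨congrArg F.obj h1.1, h1.2⟩ h2
    · exact bot_le
    · exact le_rfl))

/-- The submodule `D` of the chains of `A⁺` spanned by the chains `e_x` and the words
`a₀[a₁|…|aₙ]` with `aᵢ = e_x` for some `i > 0` and some `x`. -/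
noncomputable def Plus.D (Q : GradedQuiver.{u, v} k G) : Submodule k (Chains (Plus Q)) :=
  Submodule.span k ({c | ∃ x : Q.Obj, c = mk [Plus.e Q x]} ∪
    {c | ∃ (a : Letter (Plus Q)) (p q : List (Letter (Plus Q))) (x : Q.Obj),
      c = mk (a :: (p ++ Plus.e Q x :: q))})

/-- The non-unital Hochschild chains `C^e(A) = C(A⁺) / D`. -/
abbrev EChains (Q : GradedQuiver.{u, v} k G) : Type _ := Chains (Plus Q) ⧸ Plus.D Q

/-- The natural map `C(A) → C(A⁺) → C^e(A)`. -/
noncomputable def jMap (Q : GradedQuiver.{u, v} k G) : Chains Q →ₗ[k] EChains Q :=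
  (Plus.D Q).mkQ ∘ₗ Chains.map (Plus.inl Q)

theorem map_e {Q : GradedQuiver.{u, v} k G} {Q' : GradedQuiver.{u', v'} k G}
    (F : QuiverHom Q Q') (x : Q.Obj) :
    (Plus.map F).letter (Plus.e Q x) = Plus.e Q' (F.obj x) := by
  change Letter.of (Plus Q') (x := F.obj x) (y := F.obj x) (n := (0 : G))
    (F.map (0 : Q.Hom x x 0), _) = _
  simp only [map_zero]
  rfl

theorem map_D {Q : GradedQuiver.{u, v} k G} {Q' : GradedQuiver.{u', v'} k G}
    (F : QuiverHom Q Q') : Plus.D Q ≤ (Plus.D Q').comap (Chains.map (Plus.map F)) := by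
  have h0 : ∀ l : List (Letter (Plus Q)), mk (l.map (Plus.map F).letter) ∈ Plus.D Q' →
      Chains.map (Plus.map F) (mk l) ∈ Plus.D Q' := by
    intro l hl
    by_cases hc : IsCyclic l
    · rwa [Chains.map_mk _ _ hc]
    · rw [mk_eq_zero_of_not hc, map_zero]
      exact zero_mem _
  refine Submodule.span_le.2 ?_
  rintro _ (⟨x, rfl⟩ | ⟨a, p, q, x, rfl⟩)
  · refine h0 _ (Submodule.subset_span (Or.inl ⟨F.obj x, ?_⟩))
    rw [← map_e]; rfl
  · refine h0 _ (Submodule.subset_span (Or.inr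
      ⟨(Plus.map F).letter a, p.map (Plus.map F).letter, q.map (Plus.map F).letter, F.obj x, ?_⟩))
    rw [← map_e]
    simp only [List.map_cons, List.map_append]

/-- The map `F^e_* : C^e(A) → C^e(B)` induced by `F⁺`. -/
noncomputable def EChains.map {Q : GradedQuiver.{u, v} k G} {Q' : GradedQuiver.{u', v'} k G}
    (F : QuiverHom Q Q') : EChains Q →ₗ[k] EChains Q' :=
  Submodule.mapQ _ _ (Chains.map (Plus.map F)) (map_D F)

/-- `a₀[a₁|…|aₙ] ↦ e_{cod a₀}[a₀|…|aₙ]` on words. -/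
noncomputable def seWord (Q : GradedQuiver.{u, v} k G) : List (Letter Q) → Chains (Plus Q)
  | [] => 0
  | a :: l => mk (Plus.e Q a.cod :: (a :: l).map (Plus.inl Q).letter)

theorem respects_seWord (Q : GradedQuiver.{u, v} k G) : Respects (seWord Q) where
  lin p q x y n c f g := by
    cases p with
    | nil => exact mk_letter_lin (Plus.inl Q) [Plus.e Q y] (q.map (Plus.inl Q).letter) x y n c f g
    | cons a p =>
      have := mk_letter_lin (Plus.inl Q)
        (Plus.e Q a.cod :: (a :: p).map (Plus.inl Q).letter) (q.map (Plus.inl Q).letter) x y n c f g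
      simpa only [List.cons_append, seWord, List.map_cons, List.map_append] using this
  nc l hl := by
    cases l with
    | nil => rfl
    | cons a l =>
      refine mk_eq_zero_of_not fun h => hl ?_
      have h1 := (isCyclic_merge [] (l.map (Plus.inl Q).letter) (Plus.e Q a.cod)
        ((Plus.inl Q).letter a) ((Plus.inl Q).letter a) rfl rfl rfl).1 h
      refine (isCyclic_congr (Q := Q) (Q' := Plus Q) (fun x => x) (fun _ _ h => h) (a :: l)
        ((a :: l).map (Plus.inl Q).letter) ?_).2 h1
      rw [List.map_map]
      rfl

/-- The operator `s^e : C(A) → C^e(A)`, `a₀[a₁|…|aₙ] ↦ e_{cod a₀}[a₀|…|aₙ]`. -/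
noncomputable def seOp (Q : GradedQuiver.{u, v} k G) : Chains Q →ₗ[k] EChains Q :=
  (Plus.D Q).mkQ ∘ₗ Chains.lift _ (respects_seWord Q)

section PMap

variable (A : DGCat.{u, v} k G)

/-- The map `p` on words of `A⁺`: for `a₀ = (a, c e_x)` and `a₁, …, aₙ` in `A`, the word
`a₀[a₁|…|aₙ]` goes to `a[a₁|…|aₙ] + c (1 - t⁻¹) 1_x[a₁|…|aₙ]`. -/
noncomputable def pWord : List (Letter (Plus A.toGradedQuiver)) → Chains A.toGradedQuiver
  | [] => 0
  | a :: l => mk ((a :: l).map (Plus.fst A.toGradedQuiver).letter)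
      + a.hom.2.1 • oneSubT A.toGradedQuiver
          (mk (Letter.id A a.cod :: l.map (Plus.fst A.toGradedQuiver).letter))

theorem isCyclic_fst (l : List (Letter (Plus A.toGradedQuiver))) :
    IsCyclic (l.map (Plus.fst A.toGradedQuiver).letter) ↔ IsCyclic l := by
  refine isCyclic_congr (Q := A.toGradedQuiver) (Q' := Plus A.toGradedQuiver) (fun x => x) (fun _ _ h => h) _ _ ?_
  rw [List.map_map]
  rfl

theorem respects_pWord : Respects (pWord A) where
  lin p q x y n c f g := by
    cases p with
    | nil =>
      have := mk_letter_lin (Plus.fst A.toGradedQuiver) []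
        (q.map (Plus.fst A.toGradedQuiver).letter) x y n c f g
      simp only [List.nil_append] at this
      have h2 : (c • f + g).2.1 = c * f.2.1 + g.2.1 := rfl
      simp only [List.nil_append, pWord, List.map_cons, this]
      change _ + (c • f + g).2.1 • _ = c • (_ + f.2.1 • _) + (_ + g.2.1 • _)
      rw [h2]
      change _ + _ • oneSubT A.toGradedQuiver (mk (Letter.id A y :: _)) =
        c • (_ + _ • oneSubT A.toGradedQuiver (mk (Letter.id A y :: _))) +
          (_ + _ • oneSubT A.toGradedQuiver (mk (Letter.id A y :: _)))
      module
    | cons a p =>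
      have L1 := mk_letter_lin (Plus.fst A.toGradedQuiver)
        ((a :: p).map (Plus.fst A.toGradedQuiver).letter)
        (q.map (Plus.fst A.toGradedQuiver).letter) x y n c f g
      have L2 := mk_letter_lin (Plus.fst A.toGradedQuiver)
        (Letter.id A a.cod :: p.map (Plus.fst A.toGradedQuiver).letter)
        (q.map (Plus.fst A.toGradedQuiver).letter) x y n c f g
      simp only [List.cons_append, List.map_cons] at L1 L2
      simp only [List.cons_append, pWord, List.map_cons, List.map_append, L1, L2, map_add,
        map_smul]
      module
  nc l hl := by
    cases l with
    | nil => rfl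
    | cons a l =>
      have h1 : mk ((a :: l).map (Plus.fst A.toGradedQuiver).letter) = 0 :=
        mk_eq_zero_of_not (mt (isCyclic_fst A _).1 hl)
      by_cases h : a.dom = a.cod ∧ a.deg = 0
      · have h2 : mk (Letter.id A a.cod :: l.map (Plus.fst A.toGradedQuiver).letter) = 0 := by
          refine mk_eq_zero_of_not fun hc => hl ?_
          rw [← isCyclic_fst]
          refine (isCyclic_congr' _ _ ?_).1 hc
          change (a.cod, a.cod) :: _ = (a.cod, a.dom) :: _
          rw [h.1]
        simp only [pWord, h1, h2, map_zero, smul_zero, add_zero]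
      · have h2 := extra_eq_zero a.hom.2 h
        simp only [pWord, h1, h2, zero_smul, add_zero]

theorem pWord_D : Plus.D A.toGradedQuiver ≤ LinearMap.ker (Chains.lift _ (respects_pWord A)) := by
  have h0 : ∀ p q (x : A.Obj), mk (p ++ (Plus.fst A.toGradedQuiver).letter
      (Plus.e A.toGradedQuiver x) :: q) = 0 := fun p q x => mk_zero p q x x 0
  refine Submodule.span_le.2 ?_
  rintro _ (⟨x, rfl⟩ | ⟨a, p, q, x, rfl⟩)
  · change Chains.lift _ (respects_pWord A) (mk _) = 0
    rw [Chains.lift_mk]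
    have h1 := h0 [] [] x
    have h2 : tInv A.toGradedQuiver (mk [Letter.id A x]) = mk [Letter.id A x] := by
      have := tInvWord_concat [] (Letter.id A x)
      rw [List.nil_append] at this
      rw [tInv, Chains.lift_mk, this]
      simp [sdeg, sgn_zero]
    simp only [List.nil_append] at h1
    simp only [pWord, List.map_cons, List.map_nil, h1, zero_add]
    change _ • (mk [Letter.id A x] - tInv A.toGradedQuiver (mk [Letter.id A x])) = 0
    rw [h2, sub_self, smul_zero]
  · change Chains.lift _ (respects_pWord A) (mk _) = 0
    rw [Chains.lift_mk]
    have h1 := h0 ((a :: p).map (Plus.fst A.toGradedQuiver).letter)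
      (q.map (Plus.fst A.toGradedQuiver).letter) x
    have h2 := h0 (Letter.id A a.cod :: p.map (Plus.fst A.toGradedQuiver).letter)
      (q.map (Plus.fst A.toGradedQuiver).letter) x
    simp only [List.cons_append, List.map_cons] at h1 h2
    simp only [pWord, List.map_cons, List.map_append, h1, h2, map_zero, smul_zero, add_zero]

/-- The map `p : C^e(A) → C(A)`: it is `a ↦ a` on words in `A`, and
`e_x[a₁|…|aₙ] ↦ (1 - t⁻¹) 1_x[a₁|…|aₙ]` for `n ≥ 1`. -/
noncomputable def pMap : EChains A.toGradedQuiver →ₗ[k] Chains A.toGradedQuiver :=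
  Submodule.liftQ _ (Chains.lift _ (respects_pWord A)) (pWord_D A)

end PMap

/-! ### Negative cyclic complexes -/

section Series

variable {M : Type u} [AddCommGroup M] [Module k M] {M' : Type v} [AddCommGroup M'] [Module k M']
  {M'' : Type u₁} [AddCommGroup M''] [Module k M'']

/-- The `k[[u]]`-linear extension `M[[u]] → M'[[u]]` of a linear map `M → M'`; a power series
`∑ mᵢ uⁱ` is represented by the sequence of its coefficients. -/
def constU (φ : M →ₗ[k] M') : (ℕ → M) →ₗ[k] (ℕ → M') := φ.compLeft ℕ

/-- Multiplication by `u` on `M[[u]]`. -/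
def mulU : (ℕ → M) →ₗ[k] (ℕ → M) where
  toFun f n := match n with
    | 0 => 0
    | n + 1 => f n
  map_add' f g := by
    funext n
    cases n <;> simp
  map_smul' c f := by
    funext n
    cases n <;> simp

/-- The action of `k[[u]]` on `M[[u]]`. -/
noncomputable def smulU (r : PowerSeries k) (f : ℕ → M) : ℕ → M := fun n =>
  ∑ ij ∈ Finset.HasAntidiagonal.antidiagonal n, PowerSeries.coeff ij.1 r • f ij.2

/-- The operator `b + u B` on `M[[u]]`. -/
def negD (b B : M →ₗ[k] M) : (ℕ → M) →ₗ[k] (ℕ → M) := constU b + mulU ∘ₗ constU B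

/-- The elements of `M[[u]]` of degree `g`, where `u` has degree `2`: the series `∑ mᵢ uⁱ` with
`mᵢ` of degree `g - 2 i` for all `i`. -/
def gradeU (gr : G → Submodule k M) (g : G) : Submodule k (ℕ → M) where
  carrier := {f | ∀ n : ℕ, f n ∈ gr (g - 2 * (n : G))}
  add_mem' hf hg n := add_mem (hf n) (hg n)
  zero_mem' n := zero_mem _
  smul_mem' c _ hf n := Submodule.smul_mem _ c (hf n)

/-- The cocycles of degree `g` of the operator `D`. -/
def cocycles (gr : G → Submodule k M) (D : (ℕ → M) →ₗ[k] (ℕ → M)) (g : G) :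
    Submodule k (ℕ → M) :=
  gradeU gr g ⊓ LinearMap.ker D

/-- The coboundaries of degree `g` of the operator `D`. -/
def coboundaries (gr : G → Submodule k M) (D : (ℕ → M) →ₗ[k] (ℕ → M)) (g : G) :
    Submodule k (ℕ → M) :=
  (gradeU gr (g - 1)).map D

/-- The degree `g` cohomology of `M[[u]]` with differential `D`. -/
abbrev Coh (gr : G → Submodule k M) (D : (ℕ → M) →ₗ[k] (ℕ → M)) (g : G) : Type _ :=
  ↥(cocycles gr D g) ⧸ (coboundaries gr D g).comap (cocycles gr D g).subtype

/-- The cohomology class of a cocycle. -/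
def Coh.cls (gr : G → Submodule k M) (D : (ℕ → M) →ₗ[k] (ℕ → M)) {g : G} (z : ℕ → M)
    (hz : z ∈ cocycles gr D g) : Coh gr D g :=
  Submodule.Quotient.mk ⟨z, hz⟩

/-- `φ` is a (degree-preserving, `k[[u]]`-linear) cochain map. -/
structure IsCochainMap (gr : G → Submodule k M) (D : (ℕ → M) →ₗ[k] (ℕ → M))
    (gr' : G → Submodule k M') (D' : (ℕ → M') →ₗ[k] (ℕ → M'))
    (φ : (ℕ → M) →ₗ[k] (ℕ → M')) : Prop where
  map_smulU : ∀ (r : PowerSeries k) (f : ℕ → M), φ (smulU r f) = smulU r (φ f)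
  map_grade : ∀ (g : G) (f : ℕ → M), f ∈ gradeU gr g → φ f ∈ gradeU gr' g
  comm : ∀ f : ℕ → M, φ (D f) = D' (φ f)

theorem IsCochainMap.map_cocycles {gr : G → Submodule k M} {D : (ℕ → M) →ₗ[k] (ℕ → M)}
    {gr' : G → Submodule k M'} {D' : (ℕ → M') →ₗ[k] (ℕ → M')} {φ : (ℕ → M) →ₗ[k] (ℕ → M')}
    (h : IsCochainMap gr D gr' D' φ) (g : G) (f : ℕ → M) (hf : f ∈ cocycles gr D g) :
    φ f ∈ cocycles gr' D' g := by
  refine ⟨h.map_grade g f hf.1, ?_⟩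
  have := LinearMap.mem_ker.1 hf.2
  refine LinearMap.mem_ker.2 ?_
  rw [← h.comm, this, map_zero]

/-- The map induced on cohomology by a cochain map. -/
def Coh.map {gr : G → Submodule k M} {D : (ℕ → M) →ₗ[k] (ℕ → M)}
    {gr' : G → Submodule k M'} {D' : (ℕ → M') →ₗ[k] (ℕ → M')} {φ : (ℕ → M) →ₗ[k] (ℕ → M')}
    (h : IsCochainMap gr D gr' D' φ) (g : G) : Coh gr D g →ₗ[k] Coh gr' D' g :=
  Submodule.mapQ _ _ (φ.restrict (h.map_cocycles g)) (by
    rintro ⟨f, hf⟩ ⟨y, hy, hyf⟩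
    exact ⟨φ y, h.map_grade _ y hy, (h.comm y).symm.trans (congrArg φ hyf)⟩)

end Series

/-- The differential `b + u B` of the negative cyclic complex `C(A)[[u]]`. -/
noncomputable def negCyc (A : DGCat.{u, v} k G) :
    (ℕ → Chains A.toGradedQuiver) →ₗ[k] (ℕ → Chains A.toGradedQuiver) :=
  negD (hochB A) (connesB A)

/-- The differential of the normalized negative cyclic complex. -/
noncomputable def negCycBar (A : DGCat.{u, v} k G) : (ℕ → NChains A) →ₗ[k] (ℕ → NChains A) :=
  negD (hochBbar A) (connesBbar A)

/-- Negative cyclic homology `HN` of `A` in (cohomological) degree `g`. -/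
abbrev HN (A : DGCat.{u, v} k G) (g : G) : Type _ :=
  Coh (Chains.grade A.toGradedQuiver) (negCyc A) g

/-- Normalized negative cyclic homology of `A` in degree `g`. -/
abbrev HNbar (A : DGCat.{u, v} k G) (g : G) : Type _ :=
  Coh (NChains.grade A) (negCycBar A) g

/-- A cochain map between the negative cyclic complexes of `A` and `B`. -/
abbrev IsNegCycMap (A : DGCat.{u, v} k G) (B : DGCat.{u', v'} k G)
    (φ : (ℕ → Chains A.toGradedQuiver) →ₗ[k] (ℕ → Chains B.toGradedQuiver)) : Prop :=
  IsCochainMap (Chains.grade A.toGradedQuiver) (negCyc A)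
    (Chains.grade B.toGradedQuiver) (negCyc B) φ

/-- The quotient map from the negative cyclic complex to the normalized one. -/
noncomputable def quotU (A : DGCat.{u, v} k G) :
    (ℕ → Chains A.toGradedQuiver) →ₗ[k] (ℕ → NChains A) :=
  constU (degenerate A).mkQ

/-- `ι(u) = j + u s^e s N : C(A)[[u]] → C^e(A)[[u]]`. -/
noncomputable def iotaU (A : DGCat.{u, v} k G) :
    (ℕ → Chains A.toGradedQuiver) →ₗ[k] (ℕ → EChains A.toGradedQuiver) :=
  constU (jMap A.toGradedQuiver)
    + mulU ∘ₗ constU (seOp A.toGradedQuiver ∘ₗ sOp A ∘ₗ normOp A.toGradedQuiver)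

/-- The map `F_*(u) = p(u) ∘ F^e_* ∘ ι(u) : C(A)[[u]] → C(B)[[u]]` of a semifunctor `F`. -/
noncomputable def Semifunctor.mapU {A : DGCat.{u, v} k G} {B : DGCat.{u', v'} k G}
    (F : Semifunctor A B) :
    (ℕ → Chains A.toGradedQuiver) →ₗ[k] (ℕ → Chains B.toGradedQuiver) :=
  constU (pMap B) ∘ₗ constU (EChains.map F.toQuiverHom) ∘ₗ iotaU A

/-! ### Direct summands -/

/-- The full dg subcategory of `A` on a family of objects (the index set is the set of objects). -/
def DGCat.full (A : DGCat.{u, v} k G) {I : Type u₁} (o : I → A.Obj) : DGCat.{u₁, v} k G where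
  Obj := I
  Hom x y n := A.Hom (o x) (o y) n
  d := A.d
  comp := A.comp
  one x := A.one (o x)
  d_d := A.d_d
  leibniz := A.leibniz
  assoc := A.assoc
  one_comp := A.one_comp
  comp_one := A.comp_one

/-- `P` is a direct summand of `N` in `A`: closed morphisms `i : P ⟶ N`, `j : N ⟶ P` of degree `0`
with `j ∘ i = 1_P`. -/
structure DirectSummand (A : DGCat.{u, v} k G) (P N : A.Obj) where
  i : A.Hom P N 0
  j : A.Hom N P 0
  d_i : A.d i = 0
  d_j : A.d j = 0
  j_i : A.comp (add_zero 0) j i = A.one P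

/-- The two objects of the category `{P, N}`. -/
inductive PN
  | P
  | N

/-- The objects `P` and `N` of `A` as a family. -/
def pairObj {A : DGCat.{u, v} k G} (P N : A.Obj) : PN → A.Obj
  | .P => P
  | .N => N

/-- The full dg subcategory `{P, N}`. -/
abbrev pairCat (A : DGCat.{u, v} k G) (P N : A.Obj) : DGCat.{0, v} k G :=
  A.full (pairObj P N)

/-- The full dg subcategory `{N}`. -/
abbrev singleCat (A : DGCat.{u, v} k G) (N : A.Obj) : DGCat.{0, v} k G :=
  A.full (fun _ : Unit => N)

/-- The inclusion `{N} → {P, N}`. -/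
def inclusion (A : DGCat.{u, v} k G) (P N : A.Obj) :
    Semifunctor (singleCat A N) (pairCat A P N) where
  obj _ := PN.N
  map := LinearMap.id
  map_d _ := rfl
  map_comp _ _ _ := rfl

namespace DirectSummand

variable {A : DGCat.{u, v} k G} {P N : A.Obj} (S : DirectSummand A P N)

/-- The idempotent `π = i ∘ j`. -/
def idem : A.Hom N N 0 := A.comp (add_zero 0) S.i S.j

/-- The morphism `i : P ⟶ N`, respectively the identity of `N`. -/
def up : (x : PN) → A.Hom (pairObj P N x) N 0
  | .P => S.i
  | .N => A.one N

/-- The morphism `j : N ⟶ P`, respectively the identity of `N`. -/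
def down : (x : PN) → A.Hom N (pairObj P N x) 0
  | .P => S.j
  | .N => A.one N

theorem d_up (x : PN) : A.d (S.up x) = 0 := by
  cases x
  · exact S.d_i
  · exact A.d_one N

theorem d_down (x : PN) : A.d (S.down x) = 0 := by
  cases x
  · exact S.d_j
  · exact A.d_one N

theorem down_up (x : PN) : A.comp (add_zero 0) (S.down x) (S.up x) = A.one (pairObj P N x) := by
  cases x
  · exact S.j_i
  · exact A.one_comp _ _

/-- The map `f ↦ i ∘ f ∘ j` on morphisms of `{P, N}`: it sends `f ∈ End P` to `i ∘ f ∘ j`,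
`f ∈ Hom(N, P)` to `i ∘ f`, `f ∈ Hom(P, N)` to `f ∘ j` and `f ∈ End N` to `f` (compositions with
`1_N` are written out). -/
def conj (x y : PN) (n : G) : A.Hom (pairObj P N x) (pairObj P N y) n →ₗ[k] A.Hom N N n :=
  A.comp (zero_add n) (S.up y) ∘ₗ (A.comp (add_zero n)).flip (S.down x)

theorem conj_apply (x y : PN) (n : G) (f : A.Hom (pairObj P N x) (pairObj P N y) n) :
    S.conj x y n f = A.comp (zero_add n) (S.up y) (A.comp (add_zero n) f (S.down x)) := rfl

theorem conj_d (x y : PN) (n : G) (f : A.Hom (pairObj P N x) (pairObj P N y) n) :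
    S.conj x y (n + 1) (A.d f) = A.d (S.conj x y n f) := by
  rw [conj_apply, conj_apply, A.leibniz (zero_add n) (by ring) (by ring),
    A.leibniz (add_zero n) (by ring) (by ring), d_up, d_down, sgn_zero]
  simp

theorem conj_comp {x y z : PN} {m n p : G} (h : m + n = p)
    (f : A.Hom (pairObj P N y) (pairObj P N z) m) (g : A.Hom (pairObj P N x) (pairObj P N y) n) :
    S.conj x z p (A.comp h f g) = A.comp h (S.conj y z m f) (S.conj x y n g) := by
  subst h
  rw [conj_apply, conj_apply, conj_apply, A.assoc (zero_add m) rfl rfl (zero_add (m + n)),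
    A.assoc (add_zero m) rfl (zero_add n) rfl,
    ← A.assoc (add_zero 0) (zero_add n) (zero_add n) (zero_add n) (S.down y), S.down_up,
    A.one_comp, A.assoc rfl (add_zero (m + n)) (add_zero n) rfl]

/-- The semifunctor `F : {P, N} → {N}`, `f ↦ i ∘ f ∘ j`. -/
def functor : Semifunctor (pairCat A P N) (singleCat A N) where
  obj _ := ()
  map := fun {x y : PN} {n : G} => S.conj x y n
  map_d := fun {x y : PN} {n : G} f => S.conj_d x y n f
  map_comp := fun {x y z : PN} {_ _ _ : G} h f g => S.conj_comp (x := x) (y := y) (z := z) h f g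

end DirectSummand

/-- The integer `(2 i)! / (2 (i !))` (the division is exact for `i ≥ 1`) with sign `(-1) ^ i`. -/
def coef (k : Type*) [Field k] (i : ℕ) : k :=
  (-1) ^ i * ((Nat.factorial (2 * i) / (2 * Nat.factorial i) : ℕ) : k)

/-- The series `γ_x = 1_x + ∑_{i ≥ 1} (-1)^i ((2 i)! / (2 (i !))) 2 · 1_x[1_x|⋯|1_x] u^i`, with
`2 i` letters in the brackets. -/
noncomputable def gammaSeries (A : DGCat.{u, v} k G) (x : A.Obj) : ℕ → Chains A.toGradedQuiver
  | 0 => mk [Letter.id A x]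
  | i + 1 => coef k (i + 1) • (2 : k) •
      mk (Letter.id A x :: List.replicate (2 * (i + 1)) (Letter.id A x))

/-- The series `η_π = π + ∑_{i ≥ 1} (-1)^i ((2 i)! / (2 (i !))) (2 π - 1_x)[π|⋯|π] u^i`, with
`2 i` letters in the brackets. -/
noncomputable def etaSeries (A : DGCat.{u, v} k G) (x : A.Obj) (π : A.Hom x x 0) :
    ℕ → Chains A.toGradedQuiver
  | 0 => mk [Letter.of A.toGradedQuiver π]
  | i + 1 => coef k (i + 1) •
      mk (Letter.of A.toGradedQuiver ((2 : k) • π - A.one x) ::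
        List.replicate (2 * (i + 1)) (Letter.of A.toGradedQuiver π))

/-- The constant series `1_x`. -/
noncomputable def unitSeries (A : DGCat.{u, v} k G) (x : A.Obj) : ℕ → Chains A.toGradedQuiver
  | 0 => mk [Letter.id A x]
  | _ + 1 => 0

end Chains

end NegCyc

open NegCyc

/-! Write D = b + uB. Both b and the acyclic differential b' are sums of conjugates, by powers of
t⁻¹, of operations on the first letters of a word (`hochB_len`, `barB_len`). So b(1-t⁻¹) = (1-t⁻¹)b'
and b'N = Nb reduce to reindexing sums of powers of t⁻¹. Together with b's + sb' = 1 and N(1-t⁻¹) =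
0 = (1-t⁻¹)N they make the identities for B and F_*(u) formal.

Eliminating the adjoined identities gives F_*(u) = F_* + uF₁ with F₁ = (1-t⁻¹) s F_* s N
(`mapU_eq`). A semifunctor commutes with t⁻¹, N, b and b', but not with s; the term F₁ repairs the
failure of F_* to commute with B (`mapB_hochB`), and the u² terms contain N(1-t⁻¹) = 0. The
inclusion is unital and F ∘ inc is the identity, so F_*(u) inc_* = 1 + u(1-t⁻¹)ssN, and u(1-t⁻¹)sssN
is a homotopy from this to the identity (`mapU_inclusion`).

The equality of classes needs the other composite, inc_* F_*(u). The endofunctor inc ∘ F has the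
form f ↦ up ∘ f ∘ down with down ∘ up = 1, and inserting the letter `up` in all positions gives H
with bH + Hb = 1 - inc_* F_* (`Conj.hochB_hom`). H need not anticommute with B, but inc_* F_*(u) +
DH + HD = 1 + uΔ exactly, where Δ commutes with b and B, and 1 + uΔ is invertible on power series.
Hence each cocycle is cohomologous to inc_* F_*(u) of some cocycle and, by the first homotopy, to
its own image under inc_* F_*(u) (`exists_negCyc_eq_sub_map_mapU`).

The chain 1_P need not be a cocycle before normalization, and F_*(u) need not descend to normalized
complexes, F not being unital. This is the role of γ_P: it is an unnormalized cocycle with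
normalization 1_P (`gammaSeries_mem_cocycles`, `quotU_gammaSeries`), and F_*(u)γ_P agrees with η_π
modulo degenerate words (`quotU_mapU_gammaSeries`). Normalizing γ_P ~ inc_* F_*(u)γ_P gives [1_P] =
[η_π]. -/

namespace NegCyc

universe uk u v w u' v' u₁

/-! ### Signs, rotations of words and the norm operator -/

section Rotation

open Finset

variable {k : Type uk} [Field k] {G : Type w} [GradingRing G]

theorem sgn_two_mul (g : G) : sgn k (2 * g) = 1 := by
  rw [two_mul, sgn_add, sgn_mul_self]

/-- Koszul exponents live in the commutative ring of degrees, so once the even discrepancy is named,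
a sign comparison is a ring identity. -/
theorem sgn_eq_of_eq_add {g h r : G} (e : g = h + 2 * r) : sgn k g = sgn k h := by
  rw [e, sgn_add, sgn_two_mul, mul_one]

theorem sgn_sub (g h : G) : sgn k (g - h) = sgn k g * sgn k h := by
  rw [sub_eq_add_neg, sgn_add, sgn_neg]

@[simp] theorem sdeg_nil {Q : GradedQuiver.{u, v} k G} : sdeg ([] : List (Letter Q)) = 0 := rfl

@[simp] theorem sdeg_cons {Q : GradedQuiver.{u, v} k G} (a : Letter Q) (l : List (Letter Q)) :
    sdeg (a :: l) = (a.deg - 1) + sdeg l := by simp [sdeg]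

@[simp] theorem sdeg_append {Q : GradedQuiver.{u, v} k G} (p q : List (Letter Q)) :
    sdeg (p ++ q) = sdeg p + sdeg q := by simp [sdeg]

/-- Chains agree on all words if two linear maps do. -/
theorem Chains.hom_ext {Q : GradedQuiver.{u, v} k G} {M : Type*} [AddCommGroup M] [Module k M]
    {φ ψ : Chains Q →ₗ[k] M} (h : ∀ l, IsCyclic l → φ (mk l) = ψ (mk l)) : φ = ψ := by
  refine Submodule.linearMap_qext _ (Finsupp.lhom_ext' fun l => LinearMap.ext_ring ?_)
  change φ (mk l) = ψ (mk l)
  by_cases hl : IsCyclic l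
  · exact h l hl
  · rw [mk_eq_zero_of_not hl, map_zero, map_zero]

section

variable {Q : GradedQuiver.{u, v} k G}

theorem tInv_concat (q : List (Letter Q)) (z : Letter Q) :
    tInv Q (mk (q ++ [z])) = sgn k ((z.deg - 1) * sdeg q) • mk (z :: q) := by
  rw [tInv, Chains.lift_mk, tInvWord_concat]

/-- Rotating letter by letter moves the block q past the block p, and the accumulated sign is the
Koszul sign of the two blocks. Later rotation signs come from this block form. -/
theorem tInv_pow_append (p q : List (Letter Q)) :
    (tInv Q ^ q.length) (mk (p ++ q)) = sgn k (sdeg p * sdeg q) • mk (q ++ p) := by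
  induction q using List.reverseRecOn generalizing p with
  | nil => simp [sgn_zero]
  | append_singleton q z ih =>
    rw [List.length_append, List.length_singleton, pow_succ, Module.End.mul_apply,
      ← List.append_assoc, tInv_concat, map_smul, ← List.cons_append, ih, smul_smul, ← sgn_add]
    simp only [List.append_assoc, List.cons_append, List.nil_append]
    congr 1
    -- z passes q in the first rotation and q passes z in the remaining ones, so this product occurs
    -- twice.
    refine sgn_eq_of_eq_add (r := (z.deg - 1) * sdeg q) ?_
    simp
    ring

theorem tInv_pow_length (l : List (Letter Q)) : (tInv Q ^ l.length) (mk l) = mk l := by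
  simpa [sgn_zero] using tInv_pow_append [] l

/-- The chains spanned by the words with `n` letters. -/
noncomputable def Chains.len (Q : GradedQuiver.{u, v} k G) (n : ℕ) : Submodule k (Chains Q) :=
  Submodule.span k {c | ∃ l : List (Letter Q), l.length = n ∧ c = mk l}

theorem mk_mem_len (l : List (Letter Q)) : mk l ∈ Chains.len Q l.length :=
  Submodule.subset_span ⟨l, rfl, rfl⟩

theorem mk_mem_len' {l : List (Letter Q)} {n : ℕ} (h : l.length = n) : mk l ∈ Chains.len Q n :=
  h ▸ mk_mem_len l

/-- Two linear maps agree on the chains of words with `n` letters if they do on words. -/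
theorem Chains.len_ext {M : Type*} [AddCommGroup M] [Module k M] {φ ψ : Chains Q →ₗ[k] M} {n : ℕ}
    (h : ∀ l : List (Letter Q), l.length = n → φ (mk l) = ψ (mk l)) (c : Chains Q)
    (hc : c ∈ Chains.len Q n) : φ c = ψ c := by
  have : Chains.len Q n ≤ LinearMap.eqLocus φ ψ :=
    Submodule.span_le.2 (by rintro _ ⟨l, hl, rfl⟩; exact h l hl)
  exact this hc

theorem len_le_comap {Q' : GradedQuiver.{u', v'} k G} {φ : Chains Q →ₗ[k] Chains Q'} {n m : ℕ}
    (h : ∀ l : List (Letter Q), l.length = n → φ (mk l) ∈ Chains.len Q' m) (c : Chains Q)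
    (hc : c ∈ Chains.len Q n) : φ c ∈ Chains.len Q' m := by
  have : Chains.len Q n ≤ (Chains.len Q' m).comap φ :=
    Submodule.span_le.2 (by rintro _ ⟨l, hl, rfl⟩; exact h l hl)
  exact this hc

theorem tInv_mem_len {n : ℕ} (c : Chains Q) (hc : c ∈ Chains.len Q n) :
    tInv Q c ∈ Chains.len Q n := by
  refine len_le_comap (fun l hl => ?_) c hc
  rcases List.eq_nil_or_concat l with rfl | ⟨q, z, rfl⟩
  · rw [tInv, Chains.lift_mk]
    exact zero_mem _
  · rw [List.concat_eq_append] at hl ⊢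
    rw [tInv_concat]
    exact Submodule.smul_mem _ _ (mk_mem_len' (by simpa using hl))

theorem tInv_pow_mem_len {n : ℕ} (i : ℕ) (c : Chains Q) (hc : c ∈ Chains.len Q n) :
    (tInv Q ^ i) c ∈ Chains.len Q n := by
  induction i with
  | zero => exact hc
  | succ i ih => rw [pow_succ', Module.End.mul_apply]; exact tInv_mem_len _ ih

theorem tInv_pow_len {n : ℕ} (c : Chains Q) (hc : c ∈ Chains.len Q n) : (tInv Q ^ n) c = c :=
  Chains.len_ext (ψ := LinearMap.id)
    (fun l hl => by subst hl; exact tInv_pow_length l) c hc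

/-- The number of summands of N depends on the word, so N is a polynomial in t⁻¹ only at a fixed
length. There its properties follow from t⁻ⁿ = 1. -/
theorem normOp_len {n : ℕ} (c : Chains Q) (hc : c ∈ Chains.len Q n) :
    normOp Q c = ∑ i ∈ range n, (tInv Q ^ i) c := by
  have := Chains.len_ext (φ := normOp Q) (ψ := ∑ i ∈ range n, tInv Q ^ i) (n := n)
    (fun l hl => by
      subst hl
      rw [normOp, Chains.lift_mk, LinearMap.sum_apply]) c hc
  rwa [LinearMap.sum_apply] at this

theorem normOp_tInv : normOp Q ∘ₗ tInv Q = normOp Q := by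
  refine Chains.hom_ext fun l _ => ?_
  have hl := mk_mem_len l
  rw [LinearMap.comp_apply, normOp_len _ (tInv_mem_len _ hl), normOp_len _ hl]
  simp only [← Module.End.mul_apply, ← pow_succ]
  -- With the term of exponent 0 added, both sides are the sum over the exponents 0, …, n, the top
  -- one being trivial.
  rw [← add_right_cancel_iff (a := (tInv Q ^ 0) (mk l)), ← sum_range_succ' (fun i => (tInv Q ^ i) (mk l)),
    sum_range_succ, tInv_pow_len _ hl]
  rfl

theorem tInv_normOp : tInv Q ∘ₗ normOp Q = normOp Q := by
  refine Chains.hom_ext fun l _ => ?_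
  have hl := mk_mem_len l
  rw [LinearMap.comp_apply, normOp_len _ hl, map_sum]
  simp only [← Module.End.mul_apply, ← pow_succ']
  rw [← add_right_cancel_iff (a := (tInv Q ^ 0) (mk l)), ← sum_range_succ' (fun i => (tInv Q ^ i) (mk l)),
    sum_range_succ, tInv_pow_len _ hl]
  rfl

theorem normOp_tInv_apply (c : Chains Q) : normOp Q (tInv Q c) = normOp Q c :=
  LinearMap.congr_fun normOp_tInv c

theorem tInv_normOp_apply (c : Chains Q) : tInv Q (normOp Q c) = normOp Q c :=
  LinearMap.congr_fun tInv_normOp c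

theorem oneSubT_apply (c : Chains Q) : oneSubT Q c = c - tInv Q c := rfl

theorem tInv_pow_succ_apply (i : ℕ) (c : Chains Q) :
    (tInv Q ^ (i + 1)) c = (tInv Q ^ i) (tInv Q c) := by
  rw [pow_succ, Module.End.mul_apply]

theorem tInv_pow_succ_apply' (i : ℕ) (c : Chains Q) :
    (tInv Q ^ (i + 1)) c = tInv Q ((tInv Q ^ i) c) := by
  rw [pow_succ', Module.End.mul_apply]

/-- All composites that could contribute in u² (B with B, with F₁, or with (1-t⁻¹)sssN) contain
N(1-t⁻¹), so this one identity kills them. -/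
theorem normOp_oneSubT (c : Chains Q) : normOp Q (oneSubT Q c) = 0 := by
  rw [oneSubT_apply, map_sub, normOp_tInv_apply, sub_self]

theorem oneSubT_normOp (c : Chains Q) : oneSubT Q (normOp Q c) = 0 := by
  rw [oneSubT_apply, tInv_normOp_apply, sub_self]

end

/-! ### The differentials b and b' in terms of rotations and first letters -/

section

variable (A : DGCat.{u, v} k G)

/-- The differential applied to the first letter of a word. -/
noncomputable def diffFirstWord : List (Letter A.toGradedQuiver) → Chains A.toGradedQuiver
  | [] => 0
  | a :: l => mk (a.diff A :: l)

/-- The composition of the first two letters of a word. -/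
noncomputable def mulFirstWord : List (Letter A.toGradedQuiver) → Chains A.toGradedQuiver
  | a :: b :: l => sgn k a.deg • mk (a.mul A b :: l)
  | _ => 0

theorem respects_diffFirst : Respects (diffFirstWord A) where
  lin p q x y n c f g := by
    cases p with
    | nil => exact mk_diff_lin A [] q x y n c f g
    | cons a p => exact (respects_mk _).lin (a.diff A :: p) q x y n c f g
  nc l hl := by
    cases l with
    | nil => rfl
    | cons a l => exact mk_eq_zero_of_not (not_isCyclic_diff A (p := []) hl)

theorem respects_mulFirst : Respects (mulFirstWord A) where
  lin p q x y n c f g := by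
    match p with
    | [] =>
      cases q with
      | nil => simp [mulFirstWord]
      | cons b q =>
        have := mk_mul_lin_left A [] q b x y n c f g
        simp only [List.nil_append] at this
        simp only [List.nil_append, mulFirstWord, this]
        simp only [Letter.of]
        module
    | [a] =>
      have := mk_mul_lin_right A [] q a x y n c f g
      simp only [List.nil_append] at this
      simp only [List.nil_append, List.cons_append, mulFirstWord, this]
      module
    | a :: b :: p =>
      have := (respects_mk _).lin (a.mul A b :: p) q x y n c f g
      simp only [List.cons_append] at this
      simp only [List.cons_append, mulFirstWord, this]
      module
  nc l hl := by
    match l with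
    | [] => rfl
    | [a] => rfl
    | a :: b :: l =>
      have := mk_mul_eq_zero A (p := []) hl
      simp only [List.nil_append] at this
      simp [mulFirstWord, this]

/-- The operator `a₀[a₁|…] ↦ (d a₀)[a₁|…]`. -/
noncomputable def diffFirst : Chains A.toGradedQuiver →ₗ[k] Chains A.toGradedQuiver :=
  Chains.lift _ (respects_diffFirst A)

/-- The operator `a₀[a₁|…] ↦ (-1) ^ |a₀| (a₀ a₁)[…]`. -/
noncomputable def mulFirst : Chains A.toGradedQuiver →ₗ[k] Chains A.toGradedQuiver :=
  Chains.lift _ (respects_mulFirst A)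

@[simp] theorem diffFirst_mk (a : Letter A.toGradedQuiver) (l : List (Letter A.toGradedQuiver)) :
    diffFirst A (mk (a :: l)) = mk (a.diff A :: l) := Chains.lift_mk _ _ _

@[simp] theorem mulFirst_mk (a b : Letter A.toGradedQuiver) (l : List (Letter A.toGradedQuiver)) :
    mulFirst A (mk (a :: b :: l)) = sgn k a.deg • mk (a.mul A b :: l) := Chains.lift_mk _ _ _

@[simp] theorem mulFirst_mk_singleton (a : Letter A.toGradedQuiver) :
    mulFirst A (mk [a]) = 0 := Chains.lift_mk _ _ _

theorem diffFirst_mem_len {n : ℕ} (c : Chains A.toGradedQuiver)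
    (hc : c ∈ Chains.len A.toGradedQuiver n) : diffFirst A c ∈ Chains.len A.toGradedQuiver n := by
  refine len_le_comap (fun l hl => ?_) c hc
  cases l with
  | nil =>
    rw [diffFirst, Chains.lift_mk]
    exact zero_mem _
  | cons a l => rw [diffFirst_mk]; exact mk_mem_len' (by simpa using hl)

theorem mulFirst_mem_len {n : ℕ} (c : Chains A.toGradedQuiver)
    (hc : c ∈ Chains.len A.toGradedQuiver (n + 1)) :
    mulFirst A c ∈ Chains.len A.toGradedQuiver n := by
  refine len_le_comap (fun l hl => ?_) c hc
  match l with
  | [] =>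
    rw [mulFirst, Chains.lift_mk]
    exact zero_mem _
  | [a] =>
    rw [mulFirst_mk_singleton]
    exact zero_mem _
  | a :: b :: l =>
    rw [mulFirst_mk]
    exact Submodule.smul_mem _ _ (mk_mem_len' (by simpa using hl))

/-- The acyclic differential `b'`. -/
noncomputable def barB : Chains A.toGradedQuiver →ₗ[k] Chains A.toGradedQuiver :=
  Chains.lift (barDiff A []) ⟨barDiff_lin A [], barDiff_nc A []⟩

@[simp] theorem barB_mk (l : List (Letter A.toGradedQuiver)) : barB A (mk l) = barDiff A [] l :=
  Chains.lift_mk _ _ _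

theorem hochB_mk (l : List (Letter A.toGradedQuiver)) :
    hochB A (mk l) = barB A (mk l) + lastFace A l := by
  rw [hochB, Chains.lift_mk, barB_mk]

theorem lastFace_eq (l : List (Letter A.toGradedQuiver)) :
    lastFace A l = mulFirst A (tInv A.toGradedQuiver (mk l)) := by
  rcases List.eq_nil_or_concat l with rfl | ⟨q, z, rfl⟩
  · rw [mk_eq_zero_of_not (by simp [IsCyclic]), map_zero, map_zero]; rfl
  · rw [List.concat_eq_append, tInv_concat]
    cases q with
    | nil => simp [lastFace]
    | cons a q =>
      rw [List.cons_append, lastFace_concat, map_smul, mulFirst_mk, smul_smul, mul_comm]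

theorem hochB_eq : hochB A = barB A + mulFirst A ∘ₗ tInv A.toGradedQuiver :=
  Chains.hom_ext fun l _ => by rw [hochB_mk, lastFace_eq]; rfl

/-- The two rotations contribute sdeg p times the shifted degree of the rest, before and after d.
These differ by one, so what is left modulo 2 is sdeg p, the sign in b'. Composing two letters also
raises the shifted degree by one, so `rotate_mul_rotate` works the same way. -/
theorem rotate_diff_rotate (p q : List (Letter A.toGradedQuiver)) (a : Letter A.toGradedQuiver) :
    (tInv A.toGradedQuiver ^ p.length) (diffFirst A ((tInv A.toGradedQuiver ^ (q.length + 1))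
      (mk (p ++ a :: q)))) = sgn k (sdeg p) • mk (p ++ a.diff A :: q) := by
  have h := tInv_pow_append p (a :: q)
  rw [List.length_cons] at h
  rw [h, map_smul, map_smul, List.cons_append, diffFirst_mk, ← List.cons_append, tInv_pow_append,
    smul_smul, ← sgn_add]
  congr 1
  refine sgn_eq_of_eq_add (r := sdeg p * sdeg (a :: q)) ?_
  simp [Letter.diff, Letter.of]
  ring

theorem mul_deg (a b : Letter A.toGradedQuiver) : (a.mul A b).deg = a.deg + b.deg := by
  unfold Letter.mul; split_ifs <;> rfl

theorem rotate_mul_rotate (p q : List (Letter A.toGradedQuiver)) (a b : Letter A.toGradedQuiver) :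
    (tInv A.toGradedQuiver ^ p.length) (mulFirst A ((tInv A.toGradedQuiver ^ (q.length + 2))
      (mk (p ++ a :: b :: q)))) = (sgn k (sdeg p) * sgn k a.deg) • mk (p ++ a.mul A b :: q) := by
  have h := tInv_pow_append p (a :: b :: q)
  rw [List.length_cons, List.length_cons, add_assoc, one_add_one_eq_two] at h
  rw [h, map_smul, map_smul, List.cons_append, List.cons_append, mulFirst_mk, map_smul,
    ← List.cons_append, tInv_pow_append, smul_smul, smul_smul, ← sgn_add, ← sgn_add, ← sgn_add]
  congr 1
  refine sgn_eq_of_eq_add (r := sdeg p * sdeg (a :: b :: q)) ?_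
  simp [mul_deg]
  ring

/-- Each term of b' is a first-letter operation conjugated by rotations. The product sum is one term
shorter because the last letter has no successor inside the word. -/
theorem barDiff_eq_sum (p l : List (Letter A.toGradedQuiver)) :
    barDiff A p l =
      ∑ j ∈ range l.length, (tInv A.toGradedQuiver ^ (p.length + j)) (diffFirst A
        ((tInv A.toGradedQuiver ^ (l.length - j)) (mk (p ++ l))))
      + ∑ j ∈ range (l.length - 1), (tInv A.toGradedQuiver ^ (p.length + j)) (mulFirst A
        ((tInv A.toGradedQuiver ^ (l.length - j)) (mk (p ++ l)))) := by
  induction l generalizing p with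
  | nil => simp [barDiff]
  | cons a l ih =>
    have h := ih (p ++ [a])
    have e1 := rotate_diff_rotate A p l a
    cases l with
    | nil => simpa [barDiff] using e1.symm
    | cons b l =>
      have e2 := rotate_mul_rotate A p l a b
      simp only [barDiff, h, List.length_cons, List.length_append, List.length_nil,
        add_tsub_cancel_right, List.append_assoc, List.cons_append, List.nil_append, zero_add] at e1 e2 ⊢
      rw [sum_range_succ' _ (l.length + 1), sum_range_succ' (fun j =>
        (tInv A.toGradedQuiver ^ (p.length + j)) (mulFirst A
          ((tInv A.toGradedQuiver ^ (l.length + 1 + 1 - j)) (mk (p ++ a :: b :: l))))) l.length]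
      rw [show l.length + 2 = l.length + 1 + 1 from rfl] at e2
      have e3 : ∀ j, p.length + 1 + j = p.length + (j + 1) := fun j => by omega
      have e4 : ∀ j, l.length + 1 + 1 - (j + 1) = l.length + 1 - j := fun j => by omega
      simp only [add_zero, tsub_zero, e1, e2, e3, e4]
      abel

theorem barB_len {n : ℕ} (c : Chains A.toGradedQuiver)
    (hc : c ∈ Chains.len A.toGradedQuiver n) :
    barB A c = ∑ j ∈ range n, (tInv A.toGradedQuiver ^ j) (diffFirst A
        ((tInv A.toGradedQuiver ^ (n - j)) c))
      + ∑ j ∈ range (n - 1), (tInv A.toGradedQuiver ^ j) (mulFirst A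
        ((tInv A.toGradedQuiver ^ (n - j)) c)) := by
  have := Chains.len_ext (φ := barB A) (n := n)
    (ψ := ∑ j ∈ range n, (tInv A.toGradedQuiver ^ j) ∘ₗ diffFirst A ∘ₗ (tInv A.toGradedQuiver ^ (n - j))
      + ∑ j ∈ range (n - 1), (tInv A.toGradedQuiver ^ j) ∘ₗ mulFirst A ∘ₗ
        (tInv A.toGradedQuiver ^ (n - j)))
    (fun l hl => by
      subst hl
      rw [barB_mk, barDiff_eq_sum]
      simp [LinearMap.sum_apply]) c hc
  simpa [LinearMap.sum_apply] using this

/-- The cyclic face is the summand j = n missing from b': a product leaves n letters, where t⁻ⁿ = 1.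
This makes b symmetric under rotation, unlike b'. -/
theorem hochB_len {n : ℕ} (c : Chains A.toGradedQuiver)
    (hc : c ∈ Chains.len A.toGradedQuiver (n + 1)) :
    hochB A c = ∑ j ∈ range (n + 1), (tInv A.toGradedQuiver ^ j) (diffFirst A
        ((tInv A.toGradedQuiver ^ (n + 1 - j)) c))
      + ∑ j ∈ range (n + 1), (tInv A.toGradedQuiver ^ j) (mulFirst A
        ((tInv A.toGradedQuiver ^ (n + 1 - j)) c)) := by
  rw [hochB_eq, LinearMap.add_apply, barB_len A c hc, sum_range_succ (fun j =>
    (tInv A.toGradedQuiver ^ j) (mulFirst A ((tInv A.toGradedQuiver ^ (n + 1 - j)) c))) n,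
    add_tsub_cancel_left, pow_one, tInv_pow_len _ (mulFirst_mem_len A _ (tInv_mem_len _ hc)),
    add_assoc]
  rfl

/-- `b (1 - t⁻¹) = (1 - t⁻¹) b'`. -/
theorem hochB_oneSubT (c : Chains A.toGradedQuiver) :
    hochB A (oneSubT A.toGradedQuiver c) = oneSubT A.toGradedQuiver (barB A c) := by
  suffices h : hochB A ∘ₗ oneSubT A.toGradedQuiver = oneSubT A.toGradedQuiver ∘ₗ barB A from
    LinearMap.congr_fun h c
  refine Chains.hom_ext fun l hl => ?_
  obtain ⟨n, hn⟩ : ∃ n, l.length = n + 1 := by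
    cases l with
    | nil => exact absurd hl (by simp [IsCyclic])
    | cons a l => exact ⟨_, rfl⟩
  have hl := mk_mem_len' hn
  generalize mk l = c at hl
  have h1 := tInv_mem_len _ hl
  -- Replacing c by t⁻¹c shifts the index: for j > 0 the j-th conjugate at t⁻¹c is t⁻¹ of the
  -- (j-1)-st conjugate at c. The terms then pair off with those of (1-t⁻¹)b'c, up to the boundary
  -- terms treated in `e1` and `e2`.
  have D : ∀ φ : Chains A.toGradedQuiver →ₗ[k] Chains A.toGradedQuiver,
      ∑ j ∈ range (n + 1), (tInv A.toGradedQuiver ^ j) (φ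
        ((tInv A.toGradedQuiver ^ (n + 1 - j)) (tInv A.toGradedQuiver c))) =
      φ ((tInv A.toGradedQuiver) c) + ∑ j ∈ range n, tInv A.toGradedQuiver
        ((tInv A.toGradedQuiver ^ j) (φ ((tInv A.toGradedQuiver ^ (n + 1 - j)) c))) := by
    intro φ
    rw [sum_range_succ', add_comm]
    congr 1
    · rw [pow_zero, tsub_zero, tInv_pow_len _ h1]; rfl
    · refine sum_congr rfl fun j hj => ?_
      have : n + 1 - j = n + 1 - (j + 1) + 1 := by have := mem_range.1 hj; omega
      rw [this, ← tInv_pow_succ_apply, tInv_pow_succ_apply']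
  rw [LinearMap.comp_apply, LinearMap.comp_apply, oneSubT, LinearMap.sub_apply, LinearMap.sub_apply,
    map_sub, LinearMap.id_apply, LinearMap.id_apply, hochB_len A _ h1, D, D, hochB_len A _ hl,
    barB_len A _ hl, map_add, map_sum, map_sum, add_tsub_cancel_right, sum_range_succ,
    sum_range_succ, sum_range_succ]
  have e1 : (tInv A.toGradedQuiver ^ n) (mulFirst A ((tInv A.toGradedQuiver ^ (n + 1 - n)) c)) =
      mulFirst A (tInv A.toGradedQuiver c) := by
    rw [add_tsub_cancel_left, pow_one, tInv_pow_len _ (mulFirst_mem_len A _ h1)]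
  have e2 : tInv A.toGradedQuiver ((tInv A.toGradedQuiver ^ n) (diffFirst A
      ((tInv A.toGradedQuiver ^ (n + 1 - n)) c))) = diffFirst A (tInv A.toGradedQuiver c) := by
    rw [← tInv_pow_succ_apply', add_tsub_cancel_left, pow_one,
      tInv_pow_len _ (diffFirst_mem_len A _ h1)]
  rw [e1, e2]
  abel

theorem normOp_tInv_pow {Q : GradedQuiver.{u, v} k G} (i : ℕ) (c : Chains Q) :
    normOp Q ((tInv Q ^ i) c) = normOp Q c := by
  induction i with
  | zero => rfl
  | succ i ih => rw [tInv_pow_succ_apply', normOp_tInv_apply, ih]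

theorem tInv_pow_normOp {Q : GradedQuiver.{u, v} k G} (i : ℕ) (c : Chains Q) :
    (tInv Q ^ i) (normOp Q c) = normOp Q c := by
  induction i with
  | zero => rfl
  | succ i ih => rw [tInv_pow_succ_apply', ih, tInv_normOp_apply]

/-- `b' N = N b`. -/
theorem barB_normOp (c : Chains A.toGradedQuiver) :
    barB A (normOp A.toGradedQuiver c) = normOp A.toGradedQuiver (hochB A c) := by
  suffices h : barB A ∘ₗ normOp A.toGradedQuiver = normOp A.toGradedQuiver ∘ₗ hochB A from
    LinearMap.congr_fun h c
  refine Chains.hom_ext fun l hl => ?_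
  obtain ⟨n, hn⟩ : ∃ n, l.length = n + 1 := by
    cases l with
    | nil => exact absurd hl (by simp [IsCyclic])
    | cons a l => exact ⟨_, rfl⟩
  have hl := mk_mem_len' hn
  generalize mk l = c at hl
  have hN : normOp A.toGradedQuiver c ∈ Chains.len A.toGradedQuiver (n + 1) := by
    rw [normOp_len _ hl]
    exact sum_mem fun i _ => tInv_pow_mem_len i _ hl
  -- Since t⁻¹N = N, the norm may be summed over the exponents 1, …, n+1, which are the exponents
  -- n+1-j in reverse order.
  have K : ∀ (φ : Chains A.toGradedQuiver →ₗ[k] Chains A.toGradedQuiver),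
      ∑ j ∈ range (n + 1), normOp A.toGradedQuiver (φ ((tInv A.toGradedQuiver ^ (n + 1 - j)) c)) =
        normOp A.toGradedQuiver (φ (normOp A.toGradedQuiver c)) := by
    intro φ
    rw [← tInv_normOp_apply c, normOp_len _ hl, map_sum, map_sum, map_sum,
      ← sum_range_reflect]
    refine sum_congr rfl fun j hj => ?_
    have : n + 1 - (n + 1 - 1 - j) = j + 1 := by have := mem_range.1 hj; omega
    rw [this, tInv_pow_succ_apply']
  rw [LinearMap.comp_apply, LinearMap.comp_apply, barB_len A _ hN, hochB_len A _ hl, map_add,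
    map_sum, map_sum]
  simp only [normOp_tInv_pow, tInv_pow_normOp, K]
  -- b' has n+1 differential terms and n product terms, matching the numbers of letters n+1 and n in
  -- the results; so both sums are norms.
  rw [normOp_len _ (diffFirst_mem_len A _ hN), normOp_len _ (mulFirst_mem_len A _ hN),
    add_tsub_cancel_right]

end

end Rotation

end NegCyc

namespace NegCyc

universe uk u v w u' v' u₁ v₁

section Functoriality

open Finset

variable {k : Type uk} [Field k] {G : Type w} [GradingRing G]

/-! ### The contraction s of b' and the relation bB + Bb = 0 -/

section Contraction

variable (A : DGCat.{u, v} k G)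

theorem sOp_mk_of_head {x : A.Obj} {l : List (Letter A.toGradedQuiver)}
    (h : l.head?.map Letter.cod = some x) : sOp A (mk l) = mk (Letter.id A x :: l) := by
  rw [sOp, Chains.lift_mk]
  cases l with
  | nil => simp at h
  | cons a l =>
    obtain rfl : a.cod = x := by simpa using h
    rfl

theorem sOp_mk_cons (a : Letter A.toGradedQuiver) (l : List (Letter A.toGradedQuiver)) :
    sOp A (mk (a :: l)) = mk (Letter.id A a.cod :: a :: l) :=
  sOp_mk_of_head A rfl

/-- The prepended identity has shifted degree -1 and so reverses every sign. No term of b' changes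
the codomain of the first letter, so s puts the same identity in front of each of them. -/
theorem barDiff_id_cons {x : A.Obj} (p l : List (Letter A.toGradedQuiver))
    (h : (p ++ l).head?.map Letter.cod = some x) :
    barDiff A (Letter.id A x :: p) l = -sOp A (barDiff A p l) := by
  have hs : sgn k (sdeg (Letter.id A x :: p)) = -sgn k (sdeg p) := by
    have : (Letter.id A x).deg = 0 := rfl
    rw [sdeg_cons, sgn_add, this, zero_sub, sgn_neg, sgn_one, neg_one_mul]
  induction l generalizing p with
  | nil => simp [barDiff]
  | cons a l ih =>
    have e1 : sOp A (mk (p ++ a.diff A :: l)) = mk (Letter.id A x :: (p ++ a.diff A :: l)) :=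
      sOp_mk_of_head A (by cases p <;> exact h)
    cases l with
    | nil => simp only [barDiff, hs, List.cons_append, map_smul, e1, neg_smul]
    | cons b l =>
      have e2 : sOp A (mk (p ++ a.mul A b :: l)) = mk (Letter.id A x :: (p ++ a.mul A b :: l)) :=
        sOp_mk_of_head A (by
          cases p with
          | nil => simpa using h
          | cons => exact h)
      have e3 := ih (p ++ [a]) (by simpa using h) (by
        simp only [sdeg_append, sdeg_cons, sgn_add] at hs ⊢
        rw [← mul_assoc, hs, neg_mul])
      simp only [barDiff, hs, List.cons_append, map_smul, map_add, e1, e2, e3]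
      module

/-- `b' s + s b' = 1`. -/
theorem barB_sOp (c : Chains A.toGradedQuiver) : barB A (sOp A c) = c - sOp A (barB A c) := by
  suffices h : barB A ∘ₗ sOp A = LinearMap.id - sOp A ∘ₗ barB A from LinearMap.congr_fun h c
  refine Chains.hom_ext fun l hl => ?_
  cases l with
  | nil => exact absurd hl (by simp [IsCyclic])
  | cons a l =>
    change barB A (sOp A (mk (a :: l))) = mk (a :: l) - sOp A (barB A (mk (a :: l)))
    have e1 := mk_diff_id A [] (a :: l) a.cod
    have e2 : (Letter.id A a.cod).deg = 0 := rfl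
    have e3 := barDiff_id_cons A (x := a.cod) [] (a :: l) rfl
    simp only [List.nil_append] at e1
    simp only [sOp_mk_cons, barB_mk, barDiff, List.nil_append, e1, e2, e3, letter_id_mul, sdeg_nil,
      sgn_zero, one_mul, one_smul, zero_add]
    abel

/-- b(1-t⁻¹)sN = (1-t⁻¹)b'sN = (1-t⁻¹)(N - sb'N), where (1-t⁻¹)N = 0 and b'N = Nb. -/
theorem hochB_connesB (c : Chains A.toGradedQuiver) :
    hochB A (connesB A c) = - connesB A (hochB A c) := by
  simp only [connesB, LinearMap.comp_apply, hochB_oneSubT, barB_sOp, barB_normOp, map_sub,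
    oneSubT_normOp, zero_sub]

end Contraction

/-! ### Degrees of the operators -/

section Grade

variable {Q : GradedQuiver.{u, v} k G} {Q' : GradedQuiver.{u', v'} k G}

theorem mk_mem_grade {g : G} {l : List (Letter Q)} (h : sdeg l + 1 = g) :
    mk l ∈ Chains.grade Q g :=
  Submodule.subset_span ⟨l, h, rfl⟩

/-- `φ` raises degrees by `e`. -/
def HasDeg (φ : Chains Q →ₗ[k] Chains Q') (e : G) : Prop :=
  ∀ g, ∀ c ∈ Chains.grade Q g, φ c ∈ Chains.grade Q' (g + e)

theorem HasDeg.of_words {φ : Chains Q →ₗ[k] Chains Q'} {e : G}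
    (h : ∀ l : List (Letter Q), IsCyclic l → φ (mk l) ∈ Chains.grade Q' (sdeg l + 1 + e)) :
    HasDeg φ e := by
  intro g c hc
  have : Chains.grade Q g ≤ (Chains.grade Q' (g + e)).comap φ := by
    refine Submodule.span_le.2 ?_
    rintro _ ⟨l, rfl, rfl⟩
    change φ (mk l) ∈ Chains.grade Q' _
    by_cases hl : IsCyclic l
    · exact h l hl
    · rw [mk_eq_zero_of_not hl, map_zero]
      exact zero_mem _
  exact this hc

theorem HasDeg.comp {Q'' : GradedQuiver.{u₁, v₁} k G} {ψ : Chains Q' →ₗ[k] Chains Q''}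
    {φ : Chains Q →ₗ[k] Chains Q'} {d e f : G} (hψ : HasDeg ψ d) (hφ : HasDeg φ e)
    (h : e + d = f) : HasDeg (ψ ∘ₗ φ) f := by
  intro g c hc
  have := hψ _ _ (hφ g c hc)
  rwa [add_assoc, h] at this

theorem HasDeg.add {φ ψ : Chains Q →ₗ[k] Chains Q'} {e : G} (hφ : HasDeg φ e) (hψ : HasDeg ψ e) :
    HasDeg (φ + ψ) e :=
  fun g c hc => add_mem (hφ g c hc) (hψ g c hc)

theorem HasDeg.sub {φ ψ : Chains Q →ₗ[k] Chains Q'} {e : G} (hφ : HasDeg φ e) (hψ : HasDeg ψ e) :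
    HasDeg (φ - ψ) e :=
  fun g c hc => sub_mem (hφ g c hc) (hψ g c hc)

theorem hasDeg_id : HasDeg (LinearMap.id : Chains Q →ₗ[k] Chains Q) 0 :=
  fun g c hc => by rwa [add_zero]

theorem hasDeg_tInv : HasDeg (tInv Q) 0 := by
  refine HasDeg.of_words fun l hl => ?_
  rcases List.eq_nil_or_concat l with rfl | ⟨q, z, rfl⟩
  · exact absurd hl (by simp [IsCyclic])
  · rw [List.concat_eq_append, tInv_concat]
    exact Submodule.smul_mem _ _ (mk_mem_grade (by simp; ring))

theorem hasDeg_oneSubT : HasDeg (oneSubT Q) 0 := hasDeg_id.sub hasDeg_tInv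

theorem hasDeg_normOp : HasDeg (normOp Q) 0 := by
  refine HasDeg.of_words fun l hl => ?_
  rw [normOp, Chains.lift_mk]
  refine sum_mem fun i hi => ?_
  clear hi
  induction i with
  | zero => exact mk_mem_grade (add_zero _).symm
  | succ i ih =>
    rw [tInv_pow_succ_apply']
    have := hasDeg_tInv _ _ ih
    rwa [add_zero] at this

theorem hasDeg_sOp (A : DGCat.{u, v} k G) : HasDeg (sOp A) (-1) := by
  refine HasDeg.of_words fun l hl => ?_
  cases l with
  | nil => exact absurd hl (by simp [IsCyclic])
  | cons a l =>
    rw [sOp_mk_cons]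
    refine mk_mem_grade ?_
    have : (Letter.id A a.cod).deg = 0 := rfl
    simp only [sdeg_cons, this]
    ring

theorem sdeg_map (F : QuiverHom Q Q') (l : List (Letter Q)) :
    sdeg (l.map F.letter) = sdeg l := by
  rw [sdeg, List.map_map]
  rfl

theorem hasDeg_map (F : QuiverHom Q Q') : HasDeg (Chains.map F) 0 := by
  refine HasDeg.of_words fun l hl => ?_
  rw [Chains.map_mk F l hl]
  exact mk_mem_grade (by rw [sdeg_map, add_zero])

theorem hasDeg_connesB (A : DGCat.{u, v} k G) : HasDeg (connesB A) (-1) :=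
  hasDeg_oneSubT.comp ((hasDeg_sOp A).comp hasDeg_normOp (zero_add _)) (add_zero _)

end Grade

/-! ### Maps of quivers commute with rotations -/

section Map

variable {Q : GradedQuiver.{u, v} k G} {Q' : GradedQuiver.{u', v'} k G} (F : QuiverHom Q Q')

/-- The converse can fail, because F may identify objects, as the semifunctor {P, N} → {N} does.
This is why `Chains.map` is evaluated on cyclic words only. -/
theorem isCyclic_map {l : List (Letter Q)} (hl : IsCyclic l) : IsCyclic (l.map F.letter) := by
  cases l with
  | nil => exact hl
  | cons a l =>
    change List.IsChain _ _ at hl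
    change List.IsChain _ (F.letter a :: (l.map F.letter ++ [F.letter a]))
    have e : F.letter a :: (l.map F.letter ++ [F.letter a]) = (a :: (l ++ [a])).map F.letter := by
      simp
    rw [e, List.isChain_map]
    exact hl.imp fun s t h => congrArg F.obj h

theorem map_tInv (c : Chains Q) : Chains.map F (tInv Q c) = tInv Q' (Chains.map F c) := by
  suffices h : Chains.map F ∘ₗ tInv Q = tInv Q' ∘ₗ Chains.map F from LinearMap.congr_fun h c
  refine Chains.hom_ext fun l hl => ?_
  rw [LinearMap.comp_apply, LinearMap.comp_apply, Chains.map_mk F l hl]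
  rcases List.eq_nil_or_concat l with rfl | ⟨q, z, rfl⟩
  · exact absurd hl (by simp [IsCyclic])
  · rw [List.concat_eq_append] at hl ⊢
    rw [isCyclic_swap] at hl
    rw [tInv_concat, map_smul, List.map_append]
    change _ = tInv Q' (mk (q.map F.letter ++ [F.letter z]))
    rw [tInv_concat, sdeg_map]
    change _ • Chains.map F (mk ([z] ++ q)) = _
    rw [Chains.map_mk F _ hl]
    rfl

theorem map_tInv_pow (i : ℕ) (c : Chains Q) :
    Chains.map F ((tInv Q ^ i) c) = (tInv Q' ^ i) (Chains.map F c) := by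
  induction i with
  | zero => rfl
  | succ i ih => rw [tInv_pow_succ_apply', tInv_pow_succ_apply', map_tInv, ih]

theorem map_oneSubT (c : Chains Q) :
    Chains.map F (oneSubT Q c) = oneSubT Q' (Chains.map F c) := by
  rw [oneSubT_apply, oneSubT_apply, map_sub, map_tInv]

theorem map_mem_len {n : ℕ} (c : Chains Q) (hc : c ∈ Chains.len Q n) :
    Chains.map F c ∈ Chains.len Q' n := by
  refine len_le_comap (fun l hl => ?_) c hc
  by_cases h : IsCyclic l
  · rw [Chains.map_mk F l h]
    exact mk_mem_len' (by simpa using hl)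
  · rw [mk_eq_zero_of_not h, map_zero]
    exact zero_mem _

theorem map_normOp (c : Chains Q) : Chains.map F (normOp Q c) = normOp Q' (Chains.map F c) := by
  suffices h : Chains.map F ∘ₗ normOp Q = normOp Q' ∘ₗ Chains.map F from LinearMap.congr_fun h c
  refine Chains.hom_ext fun l hl => ?_
  have hl := mk_mem_len l
  rw [LinearMap.comp_apply, LinearMap.comp_apply, normOp_len _ hl,
    normOp_len _ (map_mem_len F _ hl), map_sum]
  simp only [map_tInv_pow]

end Map

/-! ### Semifunctors, b, and the linear term F₁ -/

section Semifunctors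

variable {A : DGCat.{u, v} k G} {B : DGCat.{u', v'} k G} (F : Semifunctor A B)

theorem of_comp (A : DGCat.{u, v} k G) {x y z : A.Obj} {m n p : G} (h : m + n = p)
    (f : A.Hom y z m) (g : A.Hom x y n) :
    Letter.of A.toGradedQuiver (A.comp h f g) =
      (Letter.of A.toGradedQuiver f).mul A (Letter.of A.toGradedQuiver g) := by
  subst h
  exact (mul_of A f g).symm

theorem letter_mul {a b : Letter A.toGradedQuiver} (h : a.dom = b.cod) :
    F.letter (a.mul A b) = (F.letter a).mul B (F.letter b) := by
  obtain ⟨ac, ad, an, ah⟩ := a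
  obtain ⟨bc, bd, bn, bh⟩ := b
  obtain rfl : ad = bc := h
  have e := mul_of A ah bh
  change Letter.mul A ⟨ac, ad, an, ah⟩ ⟨ad, bd, bn, bh⟩ = _ at e
  rw [e]
  change Letter.of B.toGradedQuiver (F.map (A.comp rfl ah bh)) = _
  rw [F.map_comp, of_comp]
  rfl

theorem letter_diff (a : Letter A.toGradedQuiver) :
    F.letter (a.diff A) = (F.letter a).diff B :=
  congrArg (Letter.of B.toGradedQuiver) (F.map_d a.hom)

theorem map_diffFirst (c : Chains A.toGradedQuiver) :
    Chains.map F.toQuiverHom (diffFirst A c) = diffFirst B (Chains.map F.toQuiverHom c) := by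
  suffices h : Chains.map F.toQuiverHom ∘ₗ diffFirst A = diffFirst B ∘ₗ Chains.map F.toQuiverHom from
    LinearMap.congr_fun h c
  refine Chains.hom_ext fun l hl => ?_
  cases l with
  | nil => exact absurd hl (by simp [IsCyclic])
  | cons a l =>
    have h : IsCyclic (a.diff A :: l) :=
      (isCyclic_congr' (a.diff A :: l) (a :: l) (by simp [Letter.diff, Letter.of])).2 hl
    rw [LinearMap.comp_apply, LinearMap.comp_apply, Chains.map_mk _ _ hl, diffFirst_mk,
      Chains.map_mk _ _ h, List.map_cons, List.map_cons, diffFirst_mk, letter_diff]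

theorem map_mulFirst (c : Chains A.toGradedQuiver) :
    Chains.map F.toQuiverHom (mulFirst A c) = mulFirst B (Chains.map F.toQuiverHom c) := by
  suffices h : Chains.map F.toQuiverHom ∘ₗ mulFirst A = mulFirst B ∘ₗ Chains.map F.toQuiverHom from
    LinearMap.congr_fun h c
  refine Chains.hom_ext fun l hl => ?_
  rw [LinearMap.comp_apply, LinearMap.comp_apply, Chains.map_mk _ _ hl]
  match l with
  | [] => exact absurd hl (by simp [IsCyclic])
  | [a] => simp
  | a :: b :: l =>
    have hab : a.dom = b.cod := isCyclic_adj (p := []) hl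
    have h : IsCyclic (a.mul A b :: l) :=
      (isCyclic_merge [] l a b _ hab (mul_cod A a b) (mul_dom A a b)).1 hl
    rw [mulFirst_mk, map_smul, Chains.map_mk _ _ h, List.map_cons, List.map_cons, List.map_cons,
      mulFirst_mk, letter_mul F hab]
    rfl

/-- The formula for b' involves only rotations, d and composition; identities do not occur in it, so
a semifunctor suffices. -/
theorem map_barB (c : Chains A.toGradedQuiver) :
    Chains.map F.toQuiverHom (barB A c) = barB B (Chains.map F.toQuiverHom c) := by
  suffices h : Chains.map F.toQuiverHom ∘ₗ barB A = barB B ∘ₗ Chains.map F.toQuiverHom from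
    LinearMap.congr_fun h c
  refine Chains.hom_ext fun l _ => ?_
  have hl := mk_mem_len l
  rw [LinearMap.comp_apply, LinearMap.comp_apply, barB_len A _ hl,
    barB_len B _ (map_mem_len _ _ hl), map_add, map_sum, map_sum]
  simp only [map_tInv_pow, map_diffFirst, map_mulFirst]

theorem map_hochB (c : Chains A.toGradedQuiver) :
    Chains.map F.toQuiverHom (hochB A c) = hochB B (Chains.map F.toQuiverHom c) := by
  simp only [hochB_eq, LinearMap.add_apply, LinearMap.comp_apply, map_add, map_barB, map_mulFirst,
    map_tInv]

/-- The operator `(1 - t⁻¹) s F_* s N`, the linear term of `F_*(u)`. -/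
noncomputable def Semifunctor.mapB : Chains A.toGradedQuiver →ₗ[k] Chains B.toGradedQuiver :=
  oneSubT B.toGradedQuiver ∘ₗ sOp B ∘ₗ Chains.map F.toQuiverHom ∘ₗ sOp A ∘ₗ
    normOp A.toGradedQuiver

theorem hasDeg_mapB : HasDeg F.mapB (-2) :=
  have h : (-1 : G) + -1 = -2 := by norm_num
  hasDeg_oneSubT.comp ((hasDeg_sOp B).comp ((hasDeg_map _).comp
    ((hasDeg_sOp A).comp hasDeg_normOp (zero_add _)) (add_zero _)) h) (add_zero _)

theorem mapB_apply (c : Chains A.toGradedQuiver) :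
    F.mapB c = oneSubT B.toGradedQuiver (sOp B (Chains.map F.toQuiverHom (sOp A
      (normOp A.toGradedQuiver c)))) := rfl

theorem connesB_apply (A : DGCat.{u, v} k G) (c : Chains A.toGradedQuiver) :
    connesB A c = oneSubT A.toGradedQuiver (sOp A (normOp A.toGradedQuiver c)) := rfl

/-- Use b's = 1 - sb' once for each s in F₁: bF₁ = (1-t⁻¹)F_*sN - (1-t⁻¹)sF_*N + (1-t⁻¹)sF_*sb'N.
Since F_* commutes with t⁻¹ and N, and b'N = Nb, the three terms are F_*B, -BF_* and F₁b. -/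
theorem mapB_hochB (c : Chains A.toGradedQuiver) :
    Chains.map F.toQuiverHom (connesB A c) + F.mapB (hochB A c) =
      hochB B (F.mapB c) + connesB B (Chains.map F.toQuiverHom c) := by
  simp only [mapB_apply, connesB_apply, hochB_oneSubT, barB_sOp, ← map_barB, barB_normOp,
    map_sub, map_oneSubT, map_normOp]
  abel

theorem mapB_connesB (c : Chains A.toGradedQuiver) : F.mapB (connesB A c) = 0 := by
  simp only [mapB_apply, connesB_apply, normOp_oneSubT, map_zero]

theorem connesB_mapB (c : Chains A.toGradedQuiver) : connesB B (F.mapB c) = 0 := by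
  simp only [mapB_apply, connesB_apply, normOp_oneSubT, map_zero]

end Semifunctors

/-! ### Coefficients of power series -/

section Series

variable {M : Type u} [AddCommGroup M] [Module k M] {M' : Type v} [AddCommGroup M'] [Module k M']

@[simp] theorem constU_apply (φ : M →ₗ[k] M') (f : ℕ → M) (n : ℕ) : constU φ f n = φ (f n) := rfl

@[simp] theorem mulU_zero (f : ℕ → M) : mulU (k := k) f 0 = 0 := rfl

@[simp] theorem mulU_succ (f : ℕ → M) (n : ℕ) : mulU (k := k) f (n + 1) = f n := rfl

@[simp] theorem negD_zero (b B : M →ₗ[k] M) (f : ℕ → M) : negD b B f 0 = b (f 0) :=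
  add_zero _

@[simp] theorem negD_succ (b B : M →ₗ[k] M) (f : ℕ → M) (n : ℕ) :
    negD b B f (n + 1) = b (f (n + 1)) + B (f n) := rfl

theorem constU_smulU (φ : M →ₗ[k] M') (r : PowerSeries k) (f : ℕ → M) :
    constU φ (smulU r f) = smulU r (constU φ f) := by
  funext n
  simp [smulU]

theorem mulU_smulU (r : PowerSeries k) (f : ℕ → M) :
    mulU (k := k) (smulU r f) = smulU r (mulU (k := k) f) := by
  funext n
  cases n with
  | zero => simp [smulU]
  | succ n => simp [smulU, Finset.Nat.sum_antidiagonal_succ']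

theorem smulU_add (r : PowerSeries k) (f g : ℕ → M) :
    smulU r (f + g) = smulU r f + smulU r g := by
  funext n
  simp [smulU, Finset.sum_add_distrib]

end Series

/-! ### Identification of F_*(u) and the cochain map property -/

variable {A : DGCat.{u, v} k G} {B : DGCat.{u', v'} k G} (F : Semifunctor A B)

theorem map_inl_letter {Q : GradedQuiver.{u, v} k G} {Q' : GradedQuiver.{u', v'} k G}
    (F : QuiverHom Q Q') (a : Letter Q) :
    (Plus.map F).letter ((Plus.inl Q).letter a) = (Plus.inl Q').letter (F.letter a) :=
  rfl

theorem pMap_map_jMap (c : Chains A.toGradedQuiver) :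
    pMap B (EChains.map F.toQuiverHom (jMap A.toGradedQuiver c)) =
      Chains.map F.toQuiverHom c := by
  suffices h : pMap B ∘ₗ EChains.map F.toQuiverHom ∘ₗ jMap A.toGradedQuiver =
      Chains.map F.toQuiverHom from LinearMap.congr_fun h c
  refine Chains.hom_ext fun l hl => ?_
  change Chains.lift _ (respects_pWord B) (Chains.map (Plus.map F.toQuiverHom)
    (Chains.map (Plus.inl A.toGradedQuiver) (mk l))) = _
  rw [Chains.map_mk _ _ hl, Chains.map_mk _ _ (isCyclic_map _ hl), Chains.map_mk _ _ hl,
    Chains.lift_mk, List.map_map]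
  have e : (Plus.map F.toQuiverHom).letter ∘ (Plus.inl A.toGradedQuiver).letter =
      (Plus.inl B.toGradedQuiver).letter ∘ F.letter :=
    funext fun a => map_inl_letter F.toQuiverHom a
  rw [e]
  cases l with
  | nil => exact absurd hl (by simp [IsCyclic])
  | cons a l =>
    rw [List.map_cons, pWord, ← List.map_cons (f := (Plus.inl B.toGradedQuiver).letter ∘ F.letter),
      List.map_map]
    -- A letter coming from A has coefficient 0 at the adjoined identity.
    change _ + (0 : k) • _ = _
    rw [zero_smul, add_zero]
    rfl

theorem pMap_map_seOp (c : Chains A.toGradedQuiver) :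
    pMap B (EChains.map F.toQuiverHom (seOp A.toGradedQuiver c)) =
      oneSubT B.toGradedQuiver (sOp B (Chains.map F.toQuiverHom c)) := by
  suffices h : pMap B ∘ₗ EChains.map F.toQuiverHom ∘ₗ seOp A.toGradedQuiver =
      oneSubT B.toGradedQuiver ∘ₗ sOp B ∘ₗ Chains.map F.toQuiverHom from LinearMap.congr_fun h c
  refine Chains.hom_ext fun l hl => ?_
  change Chains.lift _ (respects_pWord B) (Chains.map (Plus.map F.toQuiverHom)
    (Chains.lift _ (respects_seWord A.toGradedQuiver) (mk l))) =
    oneSubT B.toGradedQuiver (sOp B (Chains.map F.toQuiverHom (mk l)))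
  rw [Chains.lift_mk, Chains.map_mk _ _ hl]
  cases l with
  | nil => exact absurd hl (by simp [IsCyclic])
  | cons a l =>
    have hc : IsCyclic (Plus.e A.toGradedQuiver a.cod ::
        (a :: l).map (Plus.inl A.toGradedQuiver).letter) :=
      (isCyclic_merge [] (l.map (Plus.inl A.toGradedQuiver).letter) (Plus.e A.toGradedQuiver a.cod)
        ((Plus.inl A.toGradedQuiver).letter a) ((Plus.inl A.toGradedQuiver).letter a) rfl rfl
        rfl).2 (isCyclic_map _ hl)
    have e : (Plus.map F.toQuiverHom).letter ∘ (Plus.inl A.toGradedQuiver).letter =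
        (Plus.inl B.toGradedQuiver).letter ∘ F.letter :=
      funext fun a => map_inl_letter F.toQuiverHom a
    rw [seWord, Chains.map_mk _ _ hc, List.map_cons, map_e, List.map_map, e, Chains.lift_mk, pWord,
      List.map_map, List.map_cons (f := F.letter), sOp_mk_cons]
    -- The adjoined identity has component 0 in B, so the summand of `pWord` that keeps the first
    -- letter vanishes; the other one has coefficient 1.
    have z := mk_zero (Q := B.toGradedQuiver) []
      ((a :: l).map F.letter) (F.obj a.cod) (F.obj a.cod) 0
    have z' : mk ((Plus.e B.toGradedQuiver (F.obj a.cod) ::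
        (a :: l).map ((Plus.inl B.toGradedQuiver).letter ∘ F.letter)).map
          (Plus.fst B.toGradedQuiver).letter) = 0 := by
      rw [List.map_cons, List.map_map]
      exact z
    rw [z', zero_add]
    change (1 : k) • _ = _
    rw [one_smul]
    rfl

/-- F⁺ carries e_x to e_{F x} and p carries e_{F x}[…] to (1-t⁻¹)1_{F x}[…], so p F^e_* s^e =
(1-t⁻¹)sF_*. From here on C^e plays no role. -/
theorem mapU_eq : F.mapU = constU (Chains.map F.toQuiverHom) + mulU ∘ₗ constU F.mapB := by
  refine LinearMap.ext fun f => funext fun n => ?_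
  cases n with
  | zero =>
    change pMap B (EChains.map F.toQuiverHom (jMap A.toGradedQuiver (f 0) + 0)) = _ + 0
    rw [add_zero, add_zero, pMap_map_jMap]
    rfl
  | succ n =>
    change pMap B (EChains.map F.toQuiverHom (jMap A.toGradedQuiver (f (n + 1)) +
      seOp A.toGradedQuiver (sOp A (normOp A.toGradedQuiver (f n))))) = _
    rw [map_add, map_add, pMap_map_jMap, pMap_map_seOp]
    rfl

@[simp] theorem mapU_zero (f : ℕ → Chains A.toGradedQuiver) :
    F.mapU f 0 = Chains.map F.toQuiverHom (f 0) := by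
  rw [mapU_eq]
  exact add_zero _

@[simp] theorem mapU_succ (f : ℕ → Chains A.toGradedQuiver) (n : ℕ) :
    F.mapU f (n + 1) = Chains.map F.toQuiverHom (f (n + 1)) + F.mapB (f n) := by
  rw [mapU_eq]
  rfl

/-- Compare coefficients of u: the constant one is the compatibility of F_* with b, the linear one
is `mapB_hochB`, and the quadratic one holds because F₁B and BF₁ both vanish. -/
theorem isNegCycMap_mapU : IsNegCycMap A B F.mapU where
  map_smulU r f := by
    simp only [mapU_eq, LinearMap.add_apply, LinearMap.comp_apply, constU_smulU, mulU_smulU,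
      smulU_add]
  map_grade g f hf n := by
    cases n with
    | zero =>
      rw [mapU_zero]
      simpa using hasDeg_map _ _ _ (hf 0)
    | succ n =>
      rw [mapU_succ]
      refine add_mem ?_ ?_
      · simpa using hasDeg_map _ _ _ (hf (n + 1))
      · have := hasDeg_mapB F _ _ (hf n)
        rwa [show g - 2 * (n : G) + -2 = g - 2 * ((n + 1 : ℕ) : G) by push_cast; ring] at this
  comm f := by
    funext n
    match n with
    | 0 => simp [negCyc, map_hochB]
    | 1 =>
      have := mapB_hochB F (f 0)
      simp only [negCyc, mapU_succ, mapU_zero, negD_succ, negD_zero, map_add, map_hochB]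
      rw [add_assoc, this, add_assoc]
    | n + 2 =>
      have := mapB_hochB F (f (n + 1))
      simp only [negCyc, mapU_succ, negD_succ, map_add, map_hochB, mapB_connesB, connesB_mapB,
        add_zero]
      exact (add_assoc _ _ _).trans ((congrArg _ this).trans (add_assoc _ _ _).symm)

end Functoriality

end NegCyc

namespace NegCyc

universe uk u v w u' v' u₁ v₁

section Summands

open Finset

variable {k : Type uk} [Field k] {G : Type w} [GradingRing G]

/-! ### Unital semifunctors -/

section Unital

variable {A : DGCat.{u, v} k G} {B : DGCat.{u', v'} k G} (F : Semifunctor A B)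

/-- The semifunctor preserves identities. -/
def Semifunctor.IsUnital : Prop := ∀ x : A.Obj, F.map (A.one x) = B.one (F.obj x)

variable {F}

theorem Semifunctor.IsUnital.letter_id (hF : F.IsUnital) (x : A.Obj) :
    F.letter (Letter.id A x) = Letter.id B (F.obj x) :=
  congrArg (Letter.of B.toGradedQuiver) (hF x)

theorem isCyclic_id_cons {a : Letter A.toGradedQuiver} {l : List (Letter A.toGradedQuiver)}
    (h : IsCyclic (a :: l)) : IsCyclic (Letter.id A a.cod :: a :: l) :=
  (isCyclic_merge [] l (Letter.id A a.cod) a a rfl rfl rfl).2 h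

/-- Commutation with s is what a general semifunctor lacks. With it F_* commutes with B, and no
correction in u is needed. -/
theorem Semifunctor.IsUnital.map_sOp (hF : F.IsUnital) (c : Chains A.toGradedQuiver) :
    Chains.map F.toQuiverHom (sOp A c) = sOp B (Chains.map F.toQuiverHom c) := by
  suffices h : Chains.map F.toQuiverHom ∘ₗ sOp A = sOp B ∘ₗ Chains.map F.toQuiverHom from
    LinearMap.congr_fun h c
  refine Chains.hom_ext fun l hl => ?_
  cases l with
  | nil => exact absurd hl (by simp [IsCyclic])
  | cons a l =>
    rw [LinearMap.comp_apply, LinearMap.comp_apply, Chains.map_mk _ _ hl, sOp_mk_cons,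
      Chains.map_mk _ _ (isCyclic_id_cons hl), List.map_cons, hF.letter_id, List.map_cons,
      sOp_mk_cons]
    rfl

theorem Semifunctor.IsUnital.map_connesB (hF : F.IsUnital) (c : Chains A.toGradedQuiver) :
    Chains.map F.toQuiverHom (connesB A c) = connesB B (Chains.map F.toQuiverHom c) := by
  simp only [connesB_apply, map_oneSubT, hF.map_sOp, map_normOp]

theorem Semifunctor.IsUnital.isNegCycMap (hF : F.IsUnital) :
    IsNegCycMap A B (constU (Chains.map F.toQuiverHom)) where
  map_smulU r f := constU_smulU _ r f
  map_grade g f hf n := by simpa using hasDeg_map F.toQuiverHom _ _ (hf n)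
  comm f := by
    funext n
    cases n with
    | zero => simp [negCyc, map_hochB]
    | succ n => simp [negCyc, map_hochB, hF.map_connesB]

theorem Semifunctor.IsUnital.map_degenerate (hF : F.IsUnital) (c : Chains A.toGradedQuiver)
    (hc : c ∈ degenerate A) : Chains.map F.toQuiverHom c ∈ degenerate B := by
  have : degenerate A ≤ (degenerate B).comap (Chains.map F.toQuiverHom) := by
    refine Submodule.span_le.2 ?_
    rintro _ ⟨a, p, q, x, rfl⟩
    change Chains.map F.toQuiverHom (NegCyc.mk _) ∈ degenerate B
    by_cases h : IsCyclic (a :: (p ++ Letter.id A x :: q))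
    · rw [Chains.map_mk _ _ h, List.map_cons, List.map_append, List.map_cons, hF.letter_id]
      exact mk_mem_degenerate B _ _ _ _
    · rw [mk_eq_zero_of_not h, map_zero]
      exact zero_mem _
  exact this hc

end Unital

/-! ### Passage to the normalized complex -/

section Normalized

variable (A : DGCat.{u, v} k G)

theorem quotU_apply (f : ℕ → Chains A.toGradedQuiver) (n : ℕ) :
    quotU A f n = (degenerate A).mkQ (f n) := rfl

theorem quotU_eq_iff (f f' : ℕ → Chains A.toGradedQuiver) :
    quotU A f = quotU A f' ↔ ∀ n, f n - f' n ∈ degenerate A := by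
  rw [funext_iff]
  refine forall_congr' fun n => ?_
  exact Submodule.Quotient.eq _

theorem quotU_negCyc (f : ℕ → Chains A.toGradedQuiver) :
    quotU A (negCyc A f) = negCycBar A (quotU A f) := by
  funext n
  cases n with
  | zero =>
    rw [quotU_apply, negCyc, negCycBar, negD_zero, negD_zero]
    rfl
  | succ n =>
    rw [quotU_apply, negCyc, negCycBar, negD_succ, negD_succ, map_add]
    rfl

theorem quotU_mem_gradeU {g : G} {f : ℕ → Chains A.toGradedQuiver}
    (hf : f ∈ gradeU (Chains.grade A.toGradedQuiver) g) : quotU A f ∈ gradeU (NChains.grade A) g :=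
  fun n => Submodule.mem_map_of_mem (hf n)

theorem quotU_mem_cocycles {g : G} {f : ℕ → Chains A.toGradedQuiver}
    (hf : f ∈ cocycles (Chains.grade A.toGradedQuiver) (negCyc A) g) :
    quotU A f ∈ cocycles (NChains.grade A) (negCycBar A) g := by
  refine ⟨quotU_mem_gradeU A hf.1, LinearMap.mem_ker.2 ?_⟩
  rw [← quotU_negCyc, LinearMap.mem_ker.1 hf.2, map_zero]

end Normalized

/-! ### The homotopy u(1-t⁻¹)sssN -/

section Homotopy

variable (A : DGCat.{u, v} k G)

/-- The operator `(1 - t⁻¹) s s s N`. -/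
noncomputable def tripleS : Chains A.toGradedQuiver →ₗ[k] Chains A.toGradedQuiver :=
  oneSubT A.toGradedQuiver ∘ₗ sOp A ∘ₗ sOp A ∘ₗ sOp A ∘ₗ normOp A.toGradedQuiver

theorem tripleS_apply (c : Chains A.toGradedQuiver) :
    tripleS A c = oneSubT A.toGradedQuiver (sOp A (sOp A (sOp A (normOp A.toGradedQuiver c)))) :=
  rfl

theorem hasDeg_tripleS : HasDeg (tripleS A) (-3) := by
  have h1 : (-1 : G) + -1 = -2 := by norm_num
  have h2 : (-2 : G) + -1 = -3 := by norm_num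
  exact hasDeg_oneSubT.comp ((hasDeg_sOp A).comp ((hasDeg_sOp A).comp
    ((hasDeg_sOp A).comp hasDeg_normOp (zero_add _)) h1) h2) (add_zero _)

/-- Moving b' through three copies of s by b's = 1 - sb' produces ssN three times with alternating
signs, so one copy survives, and then -sssb'N = -sssNb. -/
theorem hochB_tripleS (c : Chains A.toGradedQuiver) :
    hochB A (tripleS A c) =
      oneSubT A.toGradedQuiver (sOp A (sOp A (normOp A.toGradedQuiver c)))
        - tripleS A (hochB A c) := by
  simp only [tripleS_apply, hochB_oneSubT, barB_sOp, barB_normOp, map_sub]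
  abel

theorem connesB_tripleS (c : Chains A.toGradedQuiver) : connesB A (tripleS A c) = 0 := by
  simp only [tripleS_apply, connesB_apply, normOp_oneSubT, map_zero]

theorem tripleS_connesB (c : Chains A.toGradedQuiver) : tripleS A (connesB A c) = 0 := by
  simp only [tripleS_apply, connesB_apply, normOp_oneSubT, map_zero]

/-- The homotopy `u (1 - t⁻¹) s s s N`. -/
noncomputable def tripleSU :
    (ℕ → Chains A.toGradedQuiver) →ₗ[k] (ℕ → Chains A.toGradedQuiver) :=
  mulU ∘ₗ constU (tripleS A)

@[simp] theorem tripleSU_zero (f : ℕ → Chains A.toGradedQuiver) : tripleSU A f 0 = 0 := rfl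

@[simp] theorem tripleSU_succ (f : ℕ → Chains A.toGradedQuiver) (n : ℕ) :
    tripleSU A f (n + 1) = tripleS A (f n) := rfl

theorem tripleSU_mem {g : G} {f : ℕ → Chains A.toGradedQuiver}
    (hf : f ∈ gradeU (Chains.grade A.toGradedQuiver) g) :
    tripleSU A f ∈ gradeU (Chains.grade A.toGradedQuiver) (g - 1) := by
  intro n
  cases n with
  | zero => exact zero_mem _
  | succ n =>
    have := hasDeg_tripleS A _ _ (hf n)
    rwa [show g - 2 * (n : G) + -3 = g - 1 - 2 * ((n + 1 : ℕ) : G) by push_cast; ring] at this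

theorem negCyc_tripleSU (f : ℕ → Chains A.toGradedQuiver) :
    negCyc A (tripleSU A f) + tripleSU A (negCyc A f) =
      mulU (k := k) (constU (oneSubT A.toGradedQuiver ∘ₗ sOp A ∘ₗ sOp A ∘ₗ normOp A.toGradedQuiver) f) := by
  funext n
  match n with
  | 0 => simp [negCyc]
  | 1 =>
    rw [Pi.add_apply, negCyc, negD_succ, tripleSU_succ, tripleSU_zero, tripleSU_succ, negD_zero,
      map_zero, add_zero, hochB_tripleS, sub_add_cancel]
    rfl
  | n + 2 =>
    rw [Pi.add_apply, negCyc, negD_succ, tripleSU_succ, tripleSU_succ, tripleSU_succ, negD_succ,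
      map_add, connesB_tripleS, tripleS_connesB, add_zero, add_zero, hochB_tripleS, sub_add_cancel]
    rfl

end Homotopy

/-! ### The composite F_*(u) inc_* -/

section Retraction

variable {A : DGCat.{u, v} k G} {P N : A.Obj} (S : DirectSummand A P N)

theorem isUnital_inclusion (A : DGCat.{u, v} k G) (P N : A.Obj) : (inclusion A P N).IsUnital :=
  fun _ => rfl

theorem functor_letter_inclusion_letter (a : Letter (singleCat A N).toGradedQuiver) :
    S.functor.letter ((inclusion A P N).letter a) = a := by
  refine congrArg (Letter.of (singleCat A N).toGradedQuiver (x := a.dom) (y := a.cod)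
    (n := a.deg)) ?_
  have e : ∀ {n : G} (f : A.Hom N N n),
      A.comp (zero_add _) (A.one N) (A.comp (add_zero _) f (A.one N)) = f := by
    intro n f
    rw [A.comp_one, A.one_comp]
  exact (S.conj_apply PN.N PN.N a.deg a.hom).trans (e (n := a.deg) a.hom)

theorem map_functor_map_inclusion (c : Chains (singleCat A N).toGradedQuiver) :
    Chains.map S.functor.toQuiverHom (Chains.map (inclusion A P N).toQuiverHom c) = c := by
  suffices h : Chains.map S.functor.toQuiverHom ∘ₗ Chains.map (inclusion A P N).toQuiverHom =
    LinearMap.id from LinearMap.congr_fun h c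
  refine Chains.hom_ext fun l hl => ?_
  rw [LinearMap.comp_apply, Chains.map_mk _ _ hl, Chains.map_mk _ _ (isCyclic_map _ hl),
    List.map_map]
  change mk (l.map fun a => S.functor.letter ((inclusion A P N).letter a)) = mk l
  simp only [functor_letter_inclusion_letter, List.map_id']

/-- As F ∘ inc is the identity and inc_* commutes with s and N, the linear term F₁ inc_* collapses
to (1-t⁻¹)ssN, which is the commutator computed in `negCyc_tripleSU`. -/
theorem mapU_inclusion (f : ℕ → Chains (singleCat A N).toGradedQuiver) :
    S.functor.mapU (constU (Chains.map (inclusion A P N).toQuiverHom) f) =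
      f + (negCyc _ (tripleSU _ f) + tripleSU _ (negCyc _ f)) := by
  rw [negCyc_tripleSU]
  funext n
  cases n with
  | zero =>
    rw [mapU_zero, constU_apply, map_functor_map_inclusion]
    exact (add_zero _).symm
  | succ n =>
    rw [mapU_succ, constU_apply, constU_apply, map_functor_map_inclusion, mapB_apply, ← map_normOp,
      ← (isUnital_inclusion A P N).map_sOp, map_functor_map_inclusion]
    rfl

theorem coh_map_comp_inclusion
    (hF : IsNegCycMap (pairCat A P N) (singleCat A N) S.functor.mapU)
    (hinc : IsNegCycMap (singleCat A N) (pairCat A P N)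
      (constU (Chains.map (inclusion A P N).toQuiverHom))) (g : G) :
    Coh.map hF g ∘ₗ Coh.map hinc g =
      (LinearMap.id : HN (singleCat A N) g →ₗ[k] HN (singleCat A N) g) := by
  refine LinearMap.ext fun z => ?_
  obtain ⟨⟨f, hf⟩, rfl⟩ := Submodule.Quotient.mk_surjective _ z
  refine (Submodule.Quotient.eq _).2 ?_
  refine ⟨tripleSU _ f, tripleSU_mem _ hf.1, ?_⟩
  change negCyc _ (tripleSU _ f) =
    S.functor.mapU (constU (Chains.map (inclusion A P N).toQuiverHom) f) - f
  rw [mapU_inclusion, LinearMap.mem_ker.1 hf.2, map_zero, add_zero, add_sub_cancel_left]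

end Retraction

/-! ### The integers (2m)!/(2(m!)) and their recursion -/

section Coefficients

/-- The division is exact only for positive index: at 0 it would be 1/2, truncated to 0. Hence the
shift by one. -/
theorem factorial_div_two (n : ℕ) :
    (2 * (n + 1)).factorial / (2 * (n + 1).factorial) * (2 * (n + 1).factorial) =
      (2 * (n + 1)).factorial := by
  refine Nat.div_mul_cancel ?_
  have e : (2 * (n + 1)).factorial = (2 * n + 2) * ((2 * n + 1) * (2 * n).factorial) := by
    rw [show 2 * (n + 1) = 2 * n + 1 + 1 by ring, Nat.factorial_succ, Nat.factorial_succ]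
  rw [e, Nat.factorial_succ]
  have h : n.factorial ∣ (2 * n).factorial := Nat.factorial_dvd_factorial (by omega)
  obtain ⟨c, hc⟩ := h
  exact ⟨(2 * n + 1) * c, by rw [hc]; ring⟩

variable (k) in
theorem coef_one : coef k 1 = -1 := by
  simp [coef, Nat.factorial]

variable (k) in
theorem coef_succ (n : ℕ) :
    coef k (n + 2) = -(2 * coef k (n + 1) * (2 * ((n + 1 : ℕ) : k) + 1)) := by
  -- The recursion is proved for natural numbers, since the denominator may vanish in k.
  have h : (2 * (n + 2)).factorial / (2 * (n + 2).factorial) =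
      2 * ((2 * (n + 1)).factorial / (2 * (n + 1).factorial)) * (2 * (n + 1) + 1) := by
    have h1 := factorial_div_two n
    have h2 := factorial_div_two (n + 1)
    have e1 : (2 * (n + 2)).factorial =
        (2 * n + 4) * ((2 * n + 3) * (2 * (n + 1)).factorial) := by
      rw [show 2 * (n + 2) = 2 * (n + 1) + 1 + 1 by ring, Nat.factorial_succ, Nat.factorial_succ]
      rfl
    have e2 : (n + 2).factorial = (n + 2) * (n + 1).factorial := Nat.factorial_succ _
    have h3 : 0 < 2 * (n + 2).factorial := by positivity
    refine Nat.eq_of_mul_eq_mul_right h3 ?_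
    rw [h2, e1, e2]
    calc _ = (2 * n + 4) * ((2 * n + 3) * _) := by rw [← h1]
      _ = _ := by ring
  rw [coef, coef, h]
  push_cast
  ring

variable (k) in
/-- The coefficients of the series `γ`. -/
noncomputable def gammaCoef : ℕ → k
  | 0 => 1
  | n + 1 => 2 * coef k (n + 1)

variable (k) in
-- This gives the cocycle condition for γ and also the coefficient of the identity in η. It carries
-- no factor 2, so it keeps its content in characteristic 2; at n = 0 it uses the constant
-- coefficient 1 of γ.
theorem coef_eq_gammaCoef (n : ℕ) :
    coef k (n + 1) = -(gammaCoef k n * (2 * (n : k) + 1)) := by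
  cases n with
  | zero => simp [gammaCoef, coef_one]
  | succ n => exact coef_succ k n

theorem sgn_natCast (n : ℕ) : sgn k (n : G) = (-1) ^ n := by
  induction n with
  | zero => simp [sgn_zero]
  | succ n ih => rw [Nat.cast_succ, sgn_add, ih, sgn_one, pow_succ]

end Coefficients

/-! ### The cocycle γ -/

section Gamma

variable (A : DGCat.{u, v} k G) (x : A.Obj)

/-- The word `1_x[1_x|⋯|1_x]` with `n` letters. -/
noncomputable def idWord (n : ℕ) : Chains A.toGradedQuiver := mk (List.replicate n (Letter.id A x))

theorem gammaSeries_eq (n : ℕ) :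
    gammaSeries A x n = gammaCoef k n • idWord A x (2 * n + 1) := by
  cases n with
  | zero => exact (one_smul _ _).symm
  | succ n =>
    rw [gammaSeries, smul_smul, gammaCoef, mul_comm]
    rfl

theorem sdeg_replicate_id (n : ℕ) :
    sdeg (List.replicate n (Letter.id A x)) = -(n : G) := by
  induction n with
  | zero => simp
  | succ n ih =>
    have : (Letter.id A x).deg = 0 := rfl
    rw [List.replicate_succ, sdeg_cons, ih, this]
    push_cast
    ring

theorem tInv_idWord (n : ℕ) :
    tInv A.toGradedQuiver (idWord A x (n + 1)) = (-1 : k) ^ n • idWord A x (n + 1) := by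
  have : (Letter.id A x).deg = 0 := rfl
  rw [idWord, List.replicate_succ', tInv_concat, sdeg_replicate_id, this, zero_sub, neg_mul_neg,
    one_mul, sgn_natCast, ← List.replicate_succ, ← List.replicate_succ']

theorem sOp_idWord (n : ℕ) : sOp A (idWord A x (n + 1)) = idWord A x (n + 2) :=
  sOp_mk_cons A _ _

theorem tInv_idWord_odd (n : ℕ) :
    tInv A.toGradedQuiver (idWord A x (2 * n + 1)) = idWord A x (2 * n + 1) := by
  rw [tInv_idWord, pow_mul, neg_one_sq, one_pow, one_smul]

theorem normOp_idWord (n : ℕ) :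
    normOp A.toGradedQuiver (idWord A x (2 * n + 1)) =
      (2 * (n : k) + 1) • idWord A x (2 * n + 1) := by
  have h : ∀ i, (tInv A.toGradedQuiver ^ i) (idWord A x (2 * n + 1)) = idWord A x (2 * n + 1) := by
    intro i
    induction i with
    | zero => rfl
    | succ i ih => rw [tInv_pow_succ_apply', ih, tInv_idWord_odd]
  rw [normOp_len (idWord A x (2 * n + 1)) (n := 2 * n + 1) (mk_mem_len' (by simp))]
  simp only [h, sum_const, card_range]
  rw [← Nat.cast_smul_eq_nsmul k]
  push_cast
  rfl

/-- Prepending one more identity is s, so b's + sb' = 1 makes the values of b' alternate, starting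
from d(1_x) = 0. -/
theorem barB_idWord (n : ℕ) :
    barB A (idWord A x (2 * n + 1)) = 0 ∧
      barB A (idWord A x (2 * n + 2)) = idWord A x (2 * n + 1) := by
  have h : barB A (idWord A x (2 * n + 1)) = 0 → 
      barB A (idWord A x (2 * n + 2)) = idWord A x (2 * n + 1) := by
    intro h
    rw [← sOp_idWord, barB_sOp, h, map_zero, sub_zero]
  induction n with
  | zero =>
    have h0 : barB A (idWord A x (2 * 0 + 1)) = 0 := by
      have := mk_diff_id A [] [] x
      rw [idWord, barB_mk]
      change sgn k (0 : G) • mk ([] ++ [(Letter.id A x).diff A]) = 0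
      rw [this, smul_zero]
    exact ⟨h0, h h0⟩
  | succ n ih =>
    have ih := ih fun h => by rw [← sOp_idWord, barB_sOp, h, map_zero, sub_zero]
    have h0 : barB A (idWord A x (2 * (n + 1) + 1)) = 0 := by
      rw [show 2 * (n + 1) + 1 = 2 * n + 1 + 2 by ring, ← sOp_idWord, barB_sOp, ih.2, sOp_idWord,
        sub_self]
    exact ⟨h0, h h0⟩

theorem hochB_idWord_zero : hochB A (idWord A x 1) = 0 := by
  rw [hochB_eq, LinearMap.add_apply, LinearMap.comp_apply, (barB_idWord A x 0).1, zero_add,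
    tInv_idWord A x 0, map_smul]
  exact (congrArg _ (mulFirst_mk_singleton A _)).trans (smul_zero _)

/-- At odd length b' vanishes and rotation is trivial, so only the cyclic face 1_x ∘ 1_x remains. -/
theorem hochB_idWord (n : ℕ) : hochB A (idWord A x (2 * n + 3)) = idWord A x (2 * n + 2) := by
  have e := barB_idWord A x (n + 1)
  have e2 := tInv_idWord_odd A x (n + 1)
  have e3 : (Letter.id A x).deg = 0 := rfl
  have e4 : (Letter.id A x).mul A (Letter.id A x) = Letter.id A x := letter_id_mul A (Letter.id A x)
  rw [show 2 * (n + 1) + 1 = 2 * n + 3 by ring] at e e2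
  rw [hochB_eq, LinearMap.add_apply, LinearMap.comp_apply, e.1, e2, zero_add, idWord,
    List.replicate_succ, List.replicate_succ, mulFirst_mk, e3, sgn_zero, one_smul, e4]
  rfl

/-- N multiplies by the number 2n+1 of letters, rotation being trivial at odd length; after s the
length is even, t⁻¹ is -1, and 1-t⁻¹ doubles. -/
theorem connesB_idWord (n : ℕ) :
    connesB A (idWord A x (2 * n + 1)) = ((2 * (n : k) + 1) * 2) • idWord A x (2 * n + 2) := by
  rw [connesB_apply, normOp_idWord, map_smul, map_smul, sOp_idWord, oneSubT_apply, tInv_idWord,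
    pow_succ, pow_mul, neg_one_sq, one_pow, one_mul]
  module

theorem gammaSeries_mem_cocycles :
    gammaSeries A x ∈ cocycles (Chains.grade A.toGradedQuiver) (negCyc A) 0 := by
  refine ⟨fun n => ?_, LinearMap.mem_ker.2 (funext fun n => ?_)⟩
  · rw [gammaSeries_eq]
    refine Submodule.smul_mem _ _ (mk_mem_grade ?_)
    rw [sdeg_replicate_id]
    push_cast
    ring
  · cases n with
    | zero => rw [negCyc, negD_zero, gammaSeries_eq, map_smul, hochB_idWord_zero, smul_zero]; rfl
    | succ n =>
      rw [negCyc, negD_succ, gammaSeries_eq, gammaSeries_eq, map_smul, map_smul, connesB_idWord]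
      have e := hochB_idWord A x n
      rw [show 2 * n + 3 = 2 * (n + 1) + 1 by ring] at e
      -- With γ = ∑ gₙ 1[1|⋯|1]uⁿ the remaining equation is gₙ₊₁ + 2(2n+1)gₙ = 0.
      rw [e, gammaCoef, coef_eq_gammaCoef, Pi.zero_apply]
      module

theorem quotU_gammaSeries : quotU A (gammaSeries A x) = quotU A (unitSeries A x) := by
  rw [quotU_eq_iff]
  intro n
  cases n with
  | zero =>
    rw [gammaSeries, unitSeries, sub_self]
    exact zero_mem _
  | succ n =>
    rw [unitSeries, sub_zero, gammaSeries_eq]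
    exact Submodule.smul_mem _ _ (mk_mem_degenerate A _ [] _ x)

end Gamma

/-! ### The image of γ and the series η -/

section Idempotent

variable {C : DGCat.{u₁, v₁} k G} {A : DGCat.{u, v} k G} {B : DGCat.{u', v'} k G}
  (F : Semifunctor A B) (x : A.Obj)

theorem isCyclic_of_forall {Q : GradedQuiver.{u, v} k G} {x : Q.Obj} {l : List (Letter Q)}
    (hl : l ≠ []) (h : ∀ a ∈ l, a.dom = x ∧ a.cod = x) : IsCyclic l := by
  cases l with
  | nil => exact absurd rfl hl
  | cons a l =>
    refine List.Pairwise.isChain (List.Pairwise.imp_of_mem (R := fun _ _ => True) ?_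
      (List.pairwise_of_forall fun _ _ => trivial))
    have h' : ∀ b ∈ a :: (l ++ [a]), b.dom = x ∧ b.cod = x := by
      intro b hb
      refine h b ?_
      simp only [List.mem_cons, List.mem_append, List.not_mem_nil, or_false] at hb ⊢
      tauto
    intro b c hb hc _
    rw [(h' b hb).1, (h' c hc).2]

theorem map_idWord (n : ℕ) :
    Chains.map F.toQuiverHom (idWord A x (n + 1)) =
      mk (List.replicate (n + 1) (Letter.of B.toGradedQuiver (F.map (A.one x)))) := by
  refine (Chains.map_mk _ _ (isCyclic_of_forall (x := x) (by simp) fun a ha => ?_)).trans ?_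
  · rw [List.eq_of_mem_replicate ha]
    exact ⟨rfl, rfl⟩
  · rw [List.map_replicate]
    rfl

theorem mk_two_smul_sub (A : DGCat.{u, v} k G) (x : A.Obj) (π : A.Hom x x 0)
    (l : List (Letter A.toGradedQuiver)) :
    mk (Letter.of A.toGradedQuiver ((2 : k) • π - A.one x) :: l) =
      (2 : k) • mk (Letter.of A.toGradedQuiver π :: l) - mk (Letter.id A x :: l) := by
  have h1 := mk_lin_of_eq [] l (Q := A.toGradedQuiver) (c := (-1 : k))
    (e := (2 : k) • π - A.one x) (f := A.one x) (g := (2 : k) • π) (by module)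
  have h2 := mk_lin_of_eq [] l (Q := A.toGradedQuiver) (c := (2 : k))
    (e := (2 : k) • π) (f := π) (g := 0) (by module)
  have h3 := mk_zero [] l (Q := A.toGradedQuiver) x x 0
  simp only [List.nil_append] at h1 h2 h3
  rw [h1, h2, h3, Letter.id]
  module

/-- The t⁻¹ half of (1-t⁻¹)s moves the new identity into the brackets, where it is degenerate. The
factor 2n+1 comes from N. -/
theorem mapB_idWord (n : ℕ) :
    F.mapB (idWord A x (2 * n + 1)) -
      (2 * (n : k) + 1) • mk (Letter.id B (F.obj x) :: List.replicate (2 * (n + 1))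
        (Letter.of B.toGradedQuiver (F.map (A.one x)))) ∈ degenerate B := by
  rw [mapB_apply, normOp_idWord, map_smul, map_smul, map_smul, map_smul, sOp_idWord,
    map_idWord, List.replicate_succ, sOp_mk_cons, oneSubT_apply, ← List.replicate_succ,
    show 2 * (n + 1) = 2 * n + 1 + 1 by ring, ← smul_sub]
  refine Submodule.smul_mem _ _ ?_
  have e : Letter.id B (Letter.of B.toGradedQuiver (F.map (A.one x))).cod =
    Letter.id B (F.obj x) := rfl
  rw [List.replicate_succ', ← List.cons_append, tInv_concat, List.cons_append, e,
    sub_sub_cancel_left]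
  exact neg_mem (Submodule.smul_mem _ _ (mk_mem_degenerate _ _ [] _ _))

/-- Let π = F(1_x) and let c be the coefficient in η at u^{n+1}. There F_* contributes 2c·π[π|⋯|π],
and F₁ applied to the previous term of γ contributes -c·1[π|⋯|π] modulo degenerate words, which add
up to c(2π-1)[π|⋯|π]. -/
theorem quotU_mapU_gammaSeries :
    quotU B (F.mapU (gammaSeries A x)) =
      quotU B (etaSeries B (F.obj x) (F.map (A.one x))) := by
  rw [quotU_eq_iff]
  intro n
  cases n with
  | zero =>
    have := map_idWord F x 0
    rw [mapU_zero, gammaSeries_eq, gammaCoef, one_smul, this, etaSeries]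
    rw [zero_add, List.replicate_one, sub_self]
    exact zero_mem _
  | succ n =>
    have := mapB_idWord F x n
    rw [mapU_succ, gammaSeries_eq, gammaSeries_eq, map_smul, map_smul, map_idWord,
      etaSeries, mk_two_smul_sub]
    have e := Submodule.smul_mem _ (gammaCoef k n) this
    convert e using 1
    rw [gammaCoef, coef_eq_gammaCoef, List.replicate_succ]
    module

variable {F} in
theorem Semifunctor.IsUnital.map_etaSeries (hF : F.IsUnital) (π : A.Hom x x 0) :
    constU (Chains.map F.toQuiverHom) (etaSeries A x π) = etaSeries B (F.obj x) (F.map π) := by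
  have hc : ∀ (f : A.Hom x x 0) (n : ℕ), IsCyclic
      (Letter.of A.toGradedQuiver f :: List.replicate n (Letter.of A.toGradedQuiver π)) := by
    refine fun f n => isCyclic_of_forall (x := x) (by simp) fun a ha => ?_
    rcases List.mem_cons.1 ha with rfl | ha
    · exact ⟨rfl, rfl⟩
    · rw [List.eq_of_mem_replicate ha]
      exact ⟨rfl, rfl⟩
  funext n
  cases n with
  | zero => exact Chains.map_mk _ _ (hc π 0)
  | succ n =>
    rw [constU_apply, etaSeries, etaSeries, map_smul]
    refine congrArg _ ((Chains.map_mk _ _ (hc _ _)).trans ?_)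
    rw [List.map_cons, List.map_replicate, ← hF x, ← map_smul, ← map_sub]
    rfl

variable {P N : C.Obj} (S : DirectSummand C P N)

theorem functor_map_one :
    S.functor.map ((pairCat C P N).one PN.P) = S.idem := by
  refine (S.conj_apply PN.P PN.P 0 (C.one P)).trans ?_
  change C.comp (zero_add _) S.i (C.comp (add_zero _) (C.one P) S.j) = S.idem
  rw [C.one_comp]
  rfl

theorem quotU_mapU_functor_gammaSeries :
    quotU (singleCat C N) (S.functor.mapU (gammaSeries (pairCat C P N) PN.P)) =
      quotU (singleCat C N) (etaSeries (singleCat C N) () S.idem) := by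
  rw [← functor_map_one S]
  exact quotU_mapU_gammaSeries S.functor PN.P

theorem map_inclusion_etaSeries :
    constU (Chains.map (inclusion C P N).toQuiverHom) (etaSeries (singleCat C N) () S.idem) =
      etaSeries (pairCat C P N) PN.N S.idem :=
  (isUnital_inclusion C P N).map_etaSeries () S.idem

end Idempotent

end Summands

end NegCyc

namespace NegCyc

universe uk u v w u' v' u₁ v₁

/-! ### The Hochschild homotopy for a conjugation f ↦ up ∘ f ∘ down -/

section Conjugation

variable {k : Type uk} [Field k] {G : Type w} [GradingRing G]

theorem sgn_eq_one_or (g : G) : sgn k g = 1 ∨ sgn k g = -1 := by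
  unfold sgn; split_ifs <;> simp

theorem letter_mul_assoc {A : DGCat.{u, v} k G} {a b c : Letter A.toGradedQuiver}
    (hab : a.dom = b.cod) (hbc : b.dom = c.cod) :
    (a.mul A b).mul A c = a.mul A (b.mul A c) := by
  obtain ⟨ac, ad, an, ah⟩ := a
  obtain ⟨bc, bd, bn, bh⟩ := b
  obtain ⟨cc, cd, cn, ch⟩ := c
  obtain rfl : ad = bc := hab
  obtain rfl : bd = cc := hbc
  change ((Letter.of A.toGradedQuiver ah).mul A (Letter.of A.toGradedQuiver bh)).mul A
    (Letter.of A.toGradedQuiver ch) = (Letter.of A.toGradedQuiver ah).mul A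
      ((Letter.of A.toGradedQuiver bh).mul A (Letter.of A.toGradedQuiver ch))
  rw [mul_of A ah bh, ← of_comp A (add_assoc an bn cn), A.assoc rfl (add_assoc _ _ _) rfl rfl,
    of_comp, of_comp]

/-- A semifunctor of the form `f ↦ up ∘ f ∘ down` with closed `up` and `down`, and
`down ∘ up = 1`. -/
structure Conj {A : DGCat.{u, v} k G} (F : Semifunctor A A) where
  intro ::
  up : ∀ x, A.Hom x (F.obj x) 0
  down : ∀ x, A.Hom (F.obj x) x 0
  d_up : ∀ x, A.d (up x) = 0
  d_down : ∀ x, A.d (down x) = 0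
  down_up : ∀ x, A.comp (add_zero 0) (down x) (up x) = A.one x
  map_eq : ∀ {x y : A.Obj} {n : G} (f : A.Hom x y n),
    F.map f = A.comp (zero_add n) (up y) (A.comp (add_zero n) f (down x))

namespace Conj

variable {A : DGCat.{u, v} k G} {F : Semifunctor A A} (C : Conj F)

/-- The morphism `up` as a letter. -/
def upL (x : A.Obj) : Letter A.toGradedQuiver := Letter.of A.toGradedQuiver (C.up x)

/-- The morphism `down` as a letter. -/
def downL (x : A.Obj) : Letter A.toGradedQuiver := Letter.of A.toGradedQuiver (C.down x)

/-- The letter `a ∘ down`. -/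
noncomputable def hat (a : Letter A.toGradedQuiver) : Letter A.toGradedQuiver :=
  a.mul A (C.downL a.dom)

theorem downL_mul_upL (x : A.Obj) : (C.downL x).mul A (C.upL x) = Letter.id A x := by
  rw [downL, upL, ← of_comp A (add_zero 0), C.down_up]
  rfl

theorem upL_mul_hat (a : Letter A.toGradedQuiver) :
    (C.upL a.cod).mul A (C.hat a) = F.letter a := by
  obtain ⟨ac, ad, an, ah⟩ := a
  refine Eq.symm ((congrArg (Letter.of A.toGradedQuiver) (C.map_eq ah)).trans ?_)
  rw [of_comp, of_comp]
  rfl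

theorem hat_mul_upL (a : Letter A.toGradedQuiver) : (C.hat a).mul A (C.upL a.dom) = a := by
  rw [hat, letter_mul_assoc rfl rfl, downL_mul_upL, letter_mul_id]

/-- `up` is a natural transformation from the identity to F, because down ∘ up = 1. This makes
neighbouring insertions of `up` cancel in the differential. -/
theorem letter_mul_upL (a : Letter A.toGradedQuiver) :
    (F.letter a).mul A (C.upL a.dom) = (C.upL a.cod).mul A a := by
  have h1 : (C.hat a).cod = a.cod := mul_cod _ _ _
  have h2 : (C.hat a).dom = F.obj a.dom := mul_dom _ _ _
  rw [← upL_mul_hat, letter_mul_assoc h1.symm h2, hat_mul_upL]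

theorem hat_cod (a : Letter A.toGradedQuiver) : (C.hat a).cod = a.cod := mul_cod _ _ _

theorem hat_dom (a : Letter A.toGradedQuiver) : (C.hat a).dom = F.obj a.dom := mul_dom _ _ _

theorem hat_deg (a : Letter A.toGradedQuiver) : (C.hat a).deg = a.deg :=
  (mul_deg A _ _).trans (add_zero _)

theorem mul_hat {a b : Letter A.toGradedQuiver} (h : a.dom = b.cod) :
    a.mul A (C.hat b) = C.hat (a.mul A b) := by
  rw [hat, hat, mul_dom, letter_mul_assoc h rfl]

/-- The inner down ∘ up cancels in (a down)(up b down). -/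
theorem hat_mul_letter {a b : Letter A.toGradedQuiver} (h : a.dom = b.cod) :
    (C.hat a).mul A (F.letter b) = C.hat (a.mul A b) := by
  rw [← C.upL_mul_hat, ← h, ← letter_mul_assoc (b := C.upL a.dom) (C.hat_dom a) (h.trans (C.hat_cod b).symm),
    hat_mul_upL, mul_hat C h]

theorem hat_diff (a : Letter A.toGradedQuiver) : C.hat (a.diff A) = (C.hat a).diff A := by
  obtain ⟨ac, ad, an, ah⟩ := a
  have e : C.hat ⟨ac, ad, an, ah⟩ =
      Letter.of A.toGradedQuiver (A.comp (add_zero an) ah (C.down ad)) := (of_comp _ _ _ _).symm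
  have h := A.leibniz (add_zero an) (add_zero (an + 1)) (by rw [zero_add]) ah (C.down ad)
  rw [C.d_down, map_zero, smul_zero, add_zero] at h
  rw [e]
  refine Eq.trans ?_ (congrArg (Letter.of A.toGradedQuiver) h).symm
  rw [of_comp]
  rfl

/-- The composition of a letter with the first letter of a word, in a context. -/
noncomputable def mulHead {M : Type*} [Zero M] (φ : List (Letter A.toGradedQuiver) → M)
    (a : Letter A.toGradedQuiver) : List (Letter A.toGradedQuiver) → M
  | [] => 0
  | b :: l => φ (a.mul A b :: l)

/-- The differential `b'` of a word, in a context `φ` and with initial sign `s`. -/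
noncomputable def barCtx {M : Type*} [AddCommGroup M] [Module k M] :
    List (Letter A.toGradedQuiver) → (List (Letter A.toGradedQuiver) → M) → k → M
  | [], _, _ => 0
  | a :: l, φ, s => s • φ (a.diff A :: l) + (s * sgn k a.deg) • mulHead φ a l
      + barCtx l (fun q => φ (a :: q)) (-(s * sgn k a.deg))

/-- The signed sum over the decompositions `l = l₁ l₂` of the words `F(l₁) up l₂`, in a context `φ`
and with initial sign `s`; the object `x` is used if `l` is empty. -/
noncomputable def splitCtx {M : Type*} [AddCommGroup M] [Module k M] :
    List (Letter A.toGradedQuiver) → (List (Letter A.toGradedQuiver) → M) → k → A.Obj → M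
  | [], φ, s, x => s • φ [C.upL x]
  | a :: l, φ, s, _ => s • φ (C.upL a.cod :: a :: l)
      + splitCtx l (fun q => φ (F.letter a :: q)) (-(s * sgn k a.deg)) a.dom

theorem barCtx_cons {M : Type*} [AddCommGroup M] [Module k M] (a : Letter A.toGradedQuiver)
    (l : List (Letter A.toGradedQuiver)) (φ : List (Letter A.toGradedQuiver) → M) (s : k) :
    barCtx (a :: l) φ s = s • φ (a.diff A :: l) + (s * sgn k a.deg) • mulHead φ a l
      + barCtx l (fun q => φ (a :: q)) (-(s * sgn k a.deg)) := rfl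

theorem splitCtx_cons {M : Type*} [AddCommGroup M] [Module k M] (a : Letter A.toGradedQuiver)
    (l : List (Letter A.toGradedQuiver)) (φ : List (Letter A.toGradedQuiver) → M) (s : k)
    (x : A.Obj) :
    C.splitCtx (a :: l) φ s x = s • φ (C.upL a.cod :: a :: l)
      + C.splitCtx l (fun q => φ (F.letter a :: q)) (-(s * sgn k a.deg)) a.dom := rfl

/-! ### Dependence on the context and on the initial sign -/

section Linearity

variable {M : Type*} [AddCommGroup M] [Module k M] {M' : Type*} [AddCommGroup M'] [Module k M']
  (l : List (Letter A.toGradedQuiver)) (φ ψ : List (Letter A.toGradedQuiver) → M) (c s : k)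
  (x : A.Obj)

theorem barCtx_sign : barCtx l φ s = s • barCtx l φ 1 := by
  induction l generalizing φ s with
  | nil => simp [barCtx]
  | cons a l ih =>
    rw [barCtx, barCtx, ih _ (-(s * sgn k a.deg)), ih _ (-(1 * sgn k a.deg))]
    module

theorem splitCtx_sign : C.splitCtx l φ s x = s • C.splitCtx l φ 1 x := by
  induction l generalizing φ s x with
  | nil => simp [splitCtx]
  | cons a l ih =>
    rw [splitCtx, splitCtx, ih _ (-(s * sgn k a.deg)), ih _ (-(1 * sgn k a.deg))]
    module

theorem barCtx_add : barCtx l (fun q => φ q + ψ q) s = barCtx l φ s + barCtx l ψ s := by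
  induction l generalizing φ ψ s with
  | nil => simp [barCtx]
  | cons a l ih =>
    rw [barCtx, barCtx, barCtx, ih]
    cases l <;> simp only [mulHead] <;> module

theorem barCtx_smul : barCtx l (fun q => c • φ q) s = c • barCtx l φ s := by
  induction l generalizing φ s with
  | nil => simp [barCtx]
  | cons a l ih =>
    rw [barCtx, barCtx, ih]
    cases l <;> simp only [mulHead] <;> module

theorem splitCtx_add :
    C.splitCtx l (fun q => φ q + ψ q) s x = C.splitCtx l φ s x + C.splitCtx l ψ s x := by
  induction l generalizing φ ψ s x with
  | nil => simp [splitCtx]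
  | cons a l ih =>
    rw [splitCtx, splitCtx, splitCtx, ih]
    module

theorem splitCtx_smul :
    C.splitCtx l (fun q => c • φ q) s x = c • C.splitCtx l φ s x := by
  induction l generalizing φ s x with
  | nil =>
    simp only [splitCtx]
    module
  | cons a l ih =>
    rw [splitCtx, splitCtx, ih]
    module

theorem map_splitCtx (f : M →ₗ[k] M') :
    f (C.splitCtx l φ s x) = C.splitCtx l (fun q => f (φ q)) s x := by
  induction l generalizing φ s x with
  | nil => simp [splitCtx]
  | cons a l ih => rw [splitCtx, splitCtx, map_add, map_smul, ih]

variable {l φ ψ} in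
-- Every word produced has the same shifted degree, since F preserves degrees and `up` contributes
-- -1. Contexts with degree-dependent signs, such as those from a rotation, may therefore be
-- compared in that degree alone.
theorem splitCtx_congr (h : ∀ r, sdeg r = sdeg l - 1 → φ r = ψ r) :
    C.splitCtx l φ s x = C.splitCtx l ψ s x := by
  induction l generalizing φ ψ s x with
  | nil =>
    rw [splitCtx, splitCtx, h]
    have : (C.upL x).deg = 0 := rfl
    simp [this]
  | cons a l ih =>
    have h1 : (C.upL a.cod).deg = 0 := rfl
    have h2 : (F.letter a).deg = a.deg := rfl
    rw [splitCtx, splitCtx, h, ih]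
    · intro r hr
      refine h _ ?_
      rw [sdeg_cons, sdeg_cons, h2, hr]
      ring
    · rw [sdeg_cons, sdeg_cons, h1]
      ring

variable {l φ} in
theorem splitCtx_mem {S : Submodule k M} (h : ∀ r, sdeg r = sdeg l - 1 → φ r ∈ S) :
    C.splitCtx l φ s x ∈ S := by
  have h' : ∀ r, sdeg r = sdeg l - 1 → S.mkQ (φ r) = 0 := fun r hr =>
    (Submodule.Quotient.mk_eq_zero S).2 (h r hr)
  -- Writing zero as a multiple by 0 lets homogeneity in the context give the vanishing.
  have e := C.splitCtx_congr s x (ψ := fun _ => (0 : k) • (0 : M ⧸ S))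
    (fun r hr => (h' r hr).trans (smul_zero _).symm)
  rw [splitCtx_smul, zero_smul] at e
  rw [← Submodule.Quotient.mk_eq_zero S]
  exact (C.map_splitCtx l φ s x S.mkQ).trans e

variable {φ} in
theorem splitCtx_lin (hφ : ∀ (p q : List (Letter A.toGradedQuiver)) (x y : A.Obj) (n : G) (c : k)
      (f g : A.Hom x y n), φ (p ++ Letter.of A.toGradedQuiver (c • f + g) :: q) =
        c • φ (p ++ Letter.of A.toGradedQuiver f :: q) + φ (p ++ Letter.of A.toGradedQuiver g :: q))
    (p q : List (Letter A.toGradedQuiver)) (x y : A.Obj) (n : G) (f g : A.Hom x y n) (z : A.Obj) :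
    C.splitCtx (p ++ Letter.of A.toGradedQuiver (c • f + g) :: q) φ s z =
      c • C.splitCtx (p ++ Letter.of A.toGradedQuiver f :: q) φ s z +
        C.splitCtx (p ++ Letter.of A.toGradedQuiver g :: q) φ s z := by
  induction p generalizing φ s z with
  | nil =>
    have h1 := hφ [C.upL y] q x y n c f g
    have h2 : (fun r => φ (F.letter (Letter.of A.toGradedQuiver (c • f + g)) :: r)) = fun r =>
        c • φ (F.letter (Letter.of A.toGradedQuiver f) :: r)
          + φ (F.letter (Letter.of A.toGradedQuiver g) :: r) := by
      funext r
      have := hφ [] r (F.obj x) (F.obj y) n c (F.map f) (F.map g)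
      rw [← map_smul, ← map_add] at this
      exact this
    simp only [List.cons_append, List.nil_append] at h1
    change s • φ (C.upL y :: _ :: q) + C.splitCtx q _ (-(s * sgn k n)) x =
      c • (s • φ (C.upL y :: _ :: q) + C.splitCtx q _ (-(s * sgn k n)) x) +
        (s • φ (C.upL y :: _ :: q) + C.splitCtx q _ (-(s * sgn k n)) x)
    rw [h1, h2, splitCtx_add, splitCtx_smul]
    module
  | cons a p ih =>
    have h1 := hφ (C.upL a.cod :: a :: p) q x y n c f g
    have h2 := ih (φ := fun r => φ (F.letter a :: r)) (-(s * sgn k a.deg))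
      (fun p q => hφ (F.letter a :: p) q) a.dom
    simp only [List.cons_append] at h1
    rw [List.cons_append, List.cons_append, List.cons_append, splitCtx, splitCtx, splitCtx, h1, h2]
    module

/-- The letters already passed enter only through the context and the initial sign. In this form b'
and the insertion of `up` recurse on the same tail and can be interchanged. -/
theorem barDiff_eq_barCtx (p : List (Letter A.toGradedQuiver)) :
    barDiff A p l = barCtx l (fun q => mk (p ++ q)) (sgn k (sdeg p)) := by
  induction l generalizing p with
  | nil => rfl
  | cons a l ih =>
    have h := ih (p ++ [a])
    rw [sdeg_concat] at h
    simp only [List.append_assoc, List.cons_append, List.nil_append] at h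
    cases l with
    | nil => simp [barDiff, barCtx, mulHead]
    | cons b l => rw [barDiff, h, barCtx]; rfl

end Linearity

/-- The insertion of `up` anticommutes with the differential of open words. -/
theorem splitCtx_barCtx {M : Type*} [AddCommGroup M] [Module k M]
    (l : List (Letter A.toGradedQuiver)) (hl : l.IsChain (fun s t => s.dom = t.cod))
    (ψ : List (Letter A.toGradedQuiver) → M) (hψ : ∀ p x q, ψ (p ++ (C.upL x).diff A :: q) = 0)
    (s t : k) (x : A.Obj) :
    C.splitCtx l (fun q => barCtx q ψ t) s x + barCtx l (fun q => C.splitCtx q ψ s x) t = 0 := by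
  have hu : ∀ x q, ψ ((C.upL x).diff A :: q) = 0 := fun x q => hψ [] x q
  have hs : ∀ x, sgn k (C.upL x).deg = 1 := fun x => sgn_zero
  induction l generalizing ψ s t x with
  | nil => simp [splitCtx, barCtx, mulHead, hu]
  | cons a l ih =>
    have IH := ih (List.IsChain.of_cons hl) (fun q => ψ (F.letter a :: q))
      (fun p => hψ (F.letter a :: p)) (-(s * sgn k a.deg)) (-(t * sgn k a.deg)) a.dom
      (fun x q => hψ [F.letter a] x q)
    have hd : (F.letter a).deg = a.deg := rfl
    have hda : (a.diff A).deg = a.deg + 1 := rfl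
    have hdc : (a.diff A).cod = a.cod := rfl
    have hdd : (a.diff A).dom = a.dom := rfl
    simp only [splitCtx_cons, barCtx_cons, hu, hs, hd, hda, hdc, hdd, letter_diff, sgn_add,
      splitCtx_add, splitCtx_smul, barCtx_add, barCtx_smul, smul_zero, zero_add] at IH ⊢
    -- These are the products that involve a: F(a)up and up∘a cancel by naturality, and the others
    -- match because F(a)F(b) = F(ab).
    have key : C.splitCtx l (mulHead ψ (F.letter a)) (-(s * sgn k a.deg)) a.dom
        + mulHead (fun q => C.splitCtx q ψ s x) a l
        + (s * sgn k a.deg) • mulHead ψ (C.upL a.cod) (a :: l)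
        - s • mulHead (fun q => ψ (C.upL a.cod :: q)) a l = 0 := by
      cases l with
      | nil =>
        simp only [splitCtx, mulHead, letter_mul_upL]
        module
      | cons b l =>
        have hab : a.dom = b.cod := (List.isChain_cons_cons.1 hl).1
        simp only [splitCtx, mulHead, mul_cod, mul_dom, mul_deg, letter_mul F hab]
        rw [← hab, letter_mul_upL, sgn_add,
          C.splitCtx_sign l (fun q => ψ ((F.letter a).mul A (F.letter b) :: q))
            (-(-(s * sgn k a.deg) * sgn k b.deg)),
          C.splitCtx_sign l (fun q => ψ ((F.letter a).mul A (F.letter b) :: q))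
            (-(s * (sgn k a.deg * sgn k b.deg)))]
        module
    rw [barCtx_sign l (fun q => ψ (C.upL a.cod :: a :: q)) (-(-(t * 1) * sgn k a.deg)),
      barCtx_sign l (fun q => ψ (C.upL a.cod :: a :: q)) (-(t * sgn k a.deg)),
      C.splitCtx_sign l (fun q => ψ ((F.letter a).diff A :: q)) (-(s * sgn k a.deg)),
      C.splitCtx_sign l (fun q => ψ ((F.letter a).diff A :: q))
        (-(s * (sgn k a.deg * sgn k 1))), sgn_one]
    -- Putting ±1 for the sign replaces the relation that its square is 1, so that only linear
    -- algebra remains.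
    rcases sgn_eq_one_or (k := k) a.deg with h | h <;> rw [h] at IH key ⊢
    · linear_combination (norm := module) IH + t • key
    · linear_combination (norm := module) IH - t • key

/-- The homotopy on words, `a₀[a₁|…|aₙ] ↦ ∑ᵢ ± (a₀ down)[F a₁|…|F aᵢ|up|aᵢ₊₁|…|aₙ]`. -/
noncomputable def homWord : List (Letter A.toGradedQuiver) → Chains A.toGradedQuiver
  | [] => 0
  | a :: l => C.splitCtx l (fun q => mk (C.hat a :: q)) (sgn k a.deg) a.dom

theorem homWord_cons (a : Letter A.toGradedQuiver) (l : List (Letter A.toGradedQuiver)) :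
    C.homWord (a :: l) = C.splitCtx l (fun q => mk (C.hat a :: q)) (sgn k a.deg) a.dom := rfl

-- The restriction to cyclic words is needed: F may identify objects, so a word with images of
-- letters can be composable although the original word is not.
open Classical in
theorem respects_homWord :
    Respects (fun l => if IsCyclic l then C.homWord l else 0) where
  lin p q x y n c f g := by
    simp only [isCyclic_lin p q (c • f + g) 0, isCyclic_lin p q f 0, isCyclic_lin p q g 0]
    split_ifs
    · cases p with
      | nil =>
        have h : (fun q => mk (C.hat (Letter.of A.toGradedQuiver (c • f + g)) :: q)) = fun q =>
            c • mk (C.hat (Letter.of A.toGradedQuiver f) :: q) +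
              mk (C.hat (Letter.of A.toGradedQuiver g) :: q) :=
          funext fun q => mk_mul_lin_left A [] q (C.downL x) x y n c f g
        change C.splitCtx q _ (sgn k n) x =
          c • C.splitCtx q _ (sgn k n) x + C.splitCtx q _ (sgn k n) x
        rw [h, splitCtx_add, splitCtx_smul]
      | cons a p =>
        exact C.splitCtx_lin c (sgn k a.deg)
          (fun p q => (respects_mk A.toGradedQuiver).lin (C.hat a :: p) q) p q x y n f g a.dom
    · simp
  nc l hl := if_neg hl

/-- The homotopy between the identity and `F_*`. -/
noncomputable def hom : Chains A.toGradedQuiver →ₗ[k] Chains A.toGradedQuiver :=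
  Chains.lift _ C.respects_homWord

theorem hom_mk {l : List (Letter A.toGradedQuiver)} (hl : IsCyclic l) :
    C.hom (mk l) = C.homWord l := by
  rw [hom, Chains.lift_mk, if_pos hl]

theorem hasDeg_hom : HasDeg C.hom (-1) := by
  refine HasDeg.of_words fun l hl => ?_
  rw [hom_mk C hl]
  cases l with
  | nil => exact zero_mem _
  | cons a l =>
    refine C.splitCtx_mem _ _ fun r hr => mk_mem_grade ?_
    rw [sdeg_cons, sdeg_cons, hr, hat_deg]
    ring

/-- Each term of b' on a cyclic word is again cyclic, so H can be evaluated on it by its formula. -/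
theorem hom_barDiff (p l : List (Letter A.toGradedQuiver)) (h : IsCyclic (p ++ l)) :
    C.hom (barDiff A p l) = barCtx l (fun q => C.homWord (p ++ q)) (sgn k (sdeg p)) := by
  induction l generalizing p with
  | nil => exact map_zero _
  | cons a l ih =>
    have IH := ih (p ++ [a]) (by simpa using h)
    rw [sdeg_concat] at IH
    have h1 : IsCyclic (p ++ a.diff A :: l) := by
      rwa [isCyclic_congr' (p ++ a.diff A :: l) (p ++ a :: l)]
      simp [Letter.diff, Letter.of]
    simp only [List.append_assoc, List.cons_append, List.nil_append] at IH
    cases l with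
    | nil => simp [barDiff, barCtx, mulHead, hom_mk C h1]
    | cons b l =>
      have h2 : IsCyclic (p ++ a.mul A b :: l) :=
        (isCyclic_merge p l a b _ (isCyclic_adj h) (mul_cod A a b) (mul_dom A a b)).1 h
      rw [barDiff, map_add, map_add, map_smul, map_smul, IH, hom_mk C h1, hom_mk C h2, barCtx]
      rfl

theorem isChain_of_isCyclic {Q : GradedQuiver.{u, v} k G} {a : Letter Q} {l : List (Letter Q)}
    (h : IsCyclic (a :: l)) : (a :: l).IsChain (fun s t => s.dom = t.cod) := by
  change List.IsChain _ (a :: (l ++ [a])) at h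
  rw [← List.cons_append] at h
  exact h.left_of_append

/-- The identity comes from inserting `up` directly after a₀, since (a₀ down)up = a₀. The rest
cancels by `splitCtx_barCtx` and by (a₀ down)F(a₁) = (a₀a₁)down. -/
theorem barB_hom (c : Chains A.toGradedQuiver) : barB A (C.hom c) + C.hom (barB A c) = c := by
  suffices h : barB A ∘ₗ C.hom + C.hom ∘ₗ barB A = LinearMap.id from LinearMap.congr_fun h c
  refine Chains.hom_ext fun l hl => ?_
  change barB A (C.hom (mk l)) + C.hom (barB A (mk l)) = mk l
  rw [hom_mk C hl, barB_mk, hom_barDiff C [] l hl, sdeg_nil, sgn_zero]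
  cases l with
  | nil => exact absurd hl (by simp [IsCyclic])
  | cons a l =>
    have hc := isChain_of_isCyclic hl
    have e : ∀ q, barB A (mk (C.hat a :: q)) = (1 : k) • mk ((C.hat a).diff A :: q)
        + (1 * sgn k a.deg) • mulHead mk (C.hat a) q
        + barCtx q (fun q => mk (C.hat a :: q)) (-(1 * sgn k a.deg)) := by
      intro q
      rw [barB_mk, barDiff_eq_barCtx, barCtx, sdeg_nil, sgn_zero, hat_deg]
      rfl
    have hz : ∀ (p : List (Letter A.toGradedQuiver)) x q,
        mk (C.hat a :: (p ++ (C.upL x).diff A :: q)) = 0 := by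
      intro p x q
      have e : (C.upL x).diff A = Letter.of A.toGradedQuiver (0 : A.Hom x (F.obj x) (0 + 1)) :=
        congrArg (Letter.of A.toGradedQuiver) (C.d_up x)
      rw [e]
      exact mk_zero (C.hat a :: p) q _ _ _
    have key := C.splitCtx_barCtx l hc.of_cons (fun q => mk (C.hat a :: q)) hz (sgn k a.deg)
      (-(1 * sgn k a.deg)) a.dom
    have e2 : C.homWord (a.diff A :: l) =
        C.splitCtx l (fun q => mk ((C.hat a).diff A :: q)) (-sgn k a.deg) a.dom := by
      have h1 : (a.diff A).deg = a.deg + 1 := rfl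
      have h2 : (a.diff A).dom = a.dom := rfl
      rw [homWord, hat_diff, h1, h2, sgn_add, sgn_one, mul_neg_one]
    simp only [List.nil_append, barCtx_cons]
    rw [e2, homWord_cons, map_splitCtx]
    simp only [e, splitCtx_add, splitCtx_smul, homWord_cons]
    have e3 : C.splitCtx l (mulHead mk (C.hat a)) (sgn k a.deg) a.dom + mulHead C.homWord a l =
        sgn k a.deg • mk (a :: l) := by
      cases l with
      | nil => simp only [splitCtx, mulHead, hat_mul_upL, add_zero]
      | cons b l =>
        have hab : a.dom = b.cod := isCyclic_adj (p := []) hl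
        simp only [splitCtx, mulHead, homWord, mul_dom, mul_deg, hat_mul_letter C hab]
        rw [← hab, hat_mul_upL, sgn_add,
          C.splitCtx_sign l (fun q => mk (C.hat (a.mul A b) :: q)) (-(sgn k a.deg * sgn k b.deg)),
          C.splitCtx_sign l (fun q => mk (C.hat (a.mul A b) :: q)) (sgn k a.deg * sgn k b.deg)]
        module
    rw [C.splitCtx_sign l (fun q => mk ((C.hat a).diff A :: q)) (sgn k a.deg),
      C.splitCtx_sign l (fun q => mk ((C.hat a).diff A :: q)) (-sgn k a.deg)]
    rcases sgn_eq_one_or (k := k) a.deg with h | h <;> rw [h] at key e3 ⊢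
    · linear_combination (norm := module) key + e3
    · linear_combination (norm := module) key - e3

/-- Separates the insertion at the very end, the only one where the cyclic face moves `up` instead
of the last letter z. The letter c serves only to fix the starting object. -/
theorem splitCtx_concat {M : Type*} [AddCommGroup M] [Module k M]
    (c z : Letter A.toGradedQuiver) (q : List (Letter A.toGradedQuiver))
    (h : (c :: (q ++ [z])).IsChain (fun s t => s.dom = t.cod))
    (φ : List (Letter A.toGradedQuiver) → M) (s : k) :
    C.splitCtx (q ++ [z]) φ s c.dom = C.splitCtx q (fun r => φ (r ++ [z])) s c.dom
      + (s * sgn k (sdeg (q ++ [z]))) • φ ((q ++ [z]).map F.letter ++ [C.upL z.dom]) := by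
  induction q generalizing c φ s with
  | nil =>
    have hc : c.dom = z.cod := (List.isChain_cons_cons.1 h).1
    simp only [splitCtx, List.nil_append, hc, List.map_cons, List.map_nil, sdeg_cons, sdeg_nil,
      add_zero, sgn_sub, sgn_one, List.cons_append]
    module
  | cons a q ih =>
    have IH := ih a h.of_cons (fun r => φ (F.letter a :: r)) (-(s * sgn k a.deg))
    simp only [splitCtx, List.cons_append, List.map_cons, IH, sdeg_cons, sgn_add, sgn_sub, sgn_one]
    module

/-- If `up` is last, its cyclic face is up(a₀ down) = F(a₀) followed by the F(aᵢ), giving -F_*. In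
all other terms aₙ is composed with a₀ down, and they cancel against H of the cyclic face. -/
theorem mulFirst_tInv_hom (c : Chains A.toGradedQuiver) :
    mulFirst A (tInv A.toGradedQuiver (C.hom c)) + C.hom (mulFirst A (tInv A.toGradedQuiver c)) =
      -Chains.map F.toQuiverHom c := by
  suffices h : mulFirst A ∘ₗ tInv A.toGradedQuiver ∘ₗ C.hom +
      C.hom ∘ₗ mulFirst A ∘ₗ tInv A.toGradedQuiver = -Chains.map F.toQuiverHom from
    LinearMap.congr_fun h c
  refine Chains.hom_ext fun l hl => ?_
  change mulFirst A (tInv A.toGradedQuiver (C.hom (mk l))) +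
    C.hom (mulFirst A (tInv A.toGradedQuiver (mk l))) = -Chains.map F.toQuiverHom (mk l)
  rw [hom_mk C hl, Chains.map_mk _ _ hl]
  have hud : ∀ x, (C.upL x).deg = 0 := fun _ => rfl
  cases l with
  | nil => exact absurd hl (by simp [IsCyclic])
  | cons a l =>
    rcases List.eq_nil_or_concat l with rfl | ⟨q, z, rfl⟩
    · have ha : a.dom = a.cod := (List.isChain_cons_cons.1 (show List.IsChain _ [a, a] from hl)).1
      have e1 := tInv_concat [C.hat a] (C.upL a.dom)
      have e2 := tInv_concat [] a
      simp only [List.nil_append, List.cons_append] at e1 e2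
      rw [homWord, splitCtx, map_smul, map_smul, e1, e2, map_smul, map_smul, mulFirst_mk,
        mulFirst_mk_singleton, smul_zero, map_zero, add_zero, hud, sgn_zero, one_smul, ha,
        upL_mul_hat, List.map_cons, smul_smul, ← sgn_add, sdeg_cons, hat_deg, sdeg_nil]
      have : sgn k (a.deg + (0 - 1) * (a.deg - 1 + 0)) = -1 := by
        rw [show a.deg + (0 - 1) * (a.deg - 1 + 0) = 1 by ring, sgn_one]
      rw [this, neg_one_smul]
      rfl
    · rw [List.concat_eq_append] at hl ⊢
      have hza : z.dom = a.cod := by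
        rw [← List.cons_append, isCyclic_swap] at hl
        exact isCyclic_adj (p := []) hl
      have hl' : IsCyclic (z.mul A a :: q) := by
        rw [← List.cons_append, isCyclic_swap] at hl
        exact (isCyclic_merge [] q z a _ hza (mul_cod A z a) (mul_dom A z a)).1 hl
      have hw : ∀ b : Letter A.toGradedQuiver, ∀ r, mulFirst A (tInv A.toGradedQuiver
          (mk (b :: (r ++ [z])))) = (sgn k ((z.deg - 1) * sdeg (b :: r)) * sgn k z.deg) •
            mk (z.mul A b :: r) := by
        intro b r
        rw [← List.cons_append, tInv_concat, map_smul, mulFirst_mk, smul_smul]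
      have e1 : C.splitCtx q (fun r => mulFirst A (tInv A.toGradedQuiver
            (mk (C.hat a :: (r ++ [z]))))) (sgn k a.deg) a.dom =
          C.splitCtx q (fun r => (-(sgn k ((z.deg - 1) * sdeg (a :: q)))) •
            mk (C.hat (z.mul A a) :: r)) (sgn k a.deg) a.dom := by
        refine C.splitCtx_congr _ _ fun r hr => ?_
        rw [hw, mul_hat C hza]
        congr 1
        rw [sdeg_cons, sdeg_cons, hr, hat_deg, ← sgn_add, ← neg_one_mul, ← sgn_one (G := G),
          ← sgn_add]
        exact sgn_eq_of_eq_add (r := 0) (by ring)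
      have e2 : mulFirst A (tInv A.toGradedQuiver (mk (C.hat a :: ((q ++ [z]).map F.letter ++
          [C.upL z.dom])))) = sgn k (a.deg - 1 + sdeg (q ++ [z])) •
            mk ((a :: (q ++ [z])).map F.letter) := by
        rw [← List.cons_append, tInv_concat, map_smul, mulFirst_mk, hud, sgn_zero, one_smul, hza,
          upL_mul_hat, sdeg_cons, sdeg_map, hat_deg, zero_sub, neg_one_mul, sgn_neg]
        rfl
      rw [homWord, map_splitCtx, map_splitCtx, splitCtx_concat C a z q (isChain_of_isCyclic hl), e1,
        e2, hw, map_smul, hom_mk C hl', homWord, splitCtx_smul, mul_dom, mul_deg, smul_smul,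
        C.splitCtx_sign q _ (sgn k a.deg), C.splitCtx_sign q _ (sgn k (z.deg + a.deg)), sgn_add,
        sgn_add, sgn_sub, sgn_one]
      rcases sgn_eq_one_or (k := k) z.deg with h1 | h1 <;>
      rcases sgn_eq_one_or (k := k) a.deg with h2 | h2 <;>
      rcases sgn_eq_one_or (k := k) (sdeg (q ++ [z])) with h3 | h3 <;>
      · rw [h1, h2, h3]
        module

/-- `b H + H b = 1 - F_*`. -/
theorem hochB_hom (c : Chains A.toGradedQuiver) :
    hochB A (C.hom c) + C.hom (hochB A c) = c - Chains.map F.toQuiverHom c := by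
  have h1 := C.barB_hom c
  have h2 := C.mulFirst_tInv_hom c
  simp only [hochB_eq, LinearMap.add_apply, LinearMap.comp_apply, map_add]
  linear_combination (norm := module) h1 + h2

end Conj

end Conjugation

end NegCyc

namespace NegCyc

universe uk u v w u' v' u₁ v₁

/-! ### From a Hochschild homotopy to cohomologous negative cyclic cocycles -/

section Retraction

variable {k : Type uk} [Field k] {G : Type w} [GradingRing G]
  {A : DGCat.{u, v} k G} {B : DGCat.{u', v'} k G} (F : Semifunctor A B) (I : Semifunctor B A)
  (H : Chains A.toGradedQuiver →ₗ[k] Chains A.toGradedQuiver)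

/-- The linear term of the difference between the identity of `C(A)[[u]]` and the sum of
`I_* F_*(u)` and the commutator of `b + u B` with a homotopy `H` from the identity to `I_* F_*`. -/
noncomputable def homotopyDefect : Chains A.toGradedQuiver →ₗ[k] Chains A.toGradedQuiver :=
  Chains.map I.toQuiverHom ∘ₗ F.mapB + (connesB A ∘ₗ H + H ∘ₗ connesB A)

theorem homotopyDefect_apply (c : Chains A.toGradedQuiver) :
    homotopyDefect F I H c =
      Chains.map I.toQuiverHom (F.mapB c) + (connesB A (H c) + H (connesB A c)) := rfl

variable {H} in
theorem hasDeg_homotopyDefect (hH : HasDeg H (-1)) : HasDeg (homotopyDefect F I H) (-2) := by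
  have h : (-1 : G) + -1 = -2 := by norm_num
  exact ((hasDeg_map _).comp (hasDeg_mapB F) (add_zero _)).add
    (((hasDeg_connesB A).comp hH h).add (hH.comp (hasDeg_connesB A) h))

variable {F I H}

theorem connesB_connesB (c : Chains A.toGradedQuiver) : connesB A (connesB A c) = 0 := by
  simp only [connesB_apply, normOp_oneSubT, map_zero]

theorem connesB_homotopyDefect (hI : I.IsUnital) (c : Chains A.toGradedQuiver) :
    connesB A (homotopyDefect F I H c) = homotopyDefect F I H (connesB A c) := by
  simp only [homotopyDefect_apply, map_add, ← hI.map_connesB, connesB_mapB, mapB_connesB,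
    connesB_connesB, map_zero, zero_add, add_zero]

/-- With Δ the defect, 1 + uΔ = I_* F_*(u) + DH + HD commutes with D. The coefficient of u says that
Δ commutes with b, that of u² that it commutes with B. -/
theorem hochB_homotopyDefect (hI : I.IsUnital)
    (hH : ∀ c, hochB A (H c) + H (hochB A c) =
      c - Chains.map I.toQuiverHom (Chains.map F.toQuiverHom c))
    (c : Chains A.toGradedQuiver) :
    hochB A (homotopyDefect F I H c) = homotopyDefect F I H (hochB A c) := by
  have h1 := hH (connesB A c)
  have h2 := congrArg (connesB A) (hH c)
  have h3 := congrArg (Chains.map I.toQuiverHom) (mapB_hochB F c)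
  have h4 := hochB_connesB A (H c)
  have h5 := congrArg H (hochB_connesB A c)
  simp only [map_add, map_sub, map_neg, map_hochB, hI.map_connesB] at h1 h2 h3 h4 h5
  simp only [homotopyDefect_apply, map_add]
  linear_combination (norm := module) h1 - h2 - h3 + h4 - h5

/-- Solve (1 + uΔ)g = f. As 1 + uΔ commutes with D, the solution g is again a cocycle, so DHg is all
that remains of the commutator. -/
theorem exists_sub_map_mapU_eq (hI : I.IsUnital) (hdeg : HasDeg H (-1))
    (hH : ∀ c, hochB A (H c) + H (hochB A c) =
      c - Chains.map I.toQuiverHom (Chains.map F.toQuiverHom c))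
    {e : G} {f : ℕ → Chains A.toGradedQuiver}
    (hf : f ∈ cocycles (Chains.grade A.toGradedQuiver) (negCyc A) e) :
    ∃ g ∈ cocycles (Chains.grade A.toGradedQuiver) (negCyc A) e,
      f - constU (Chains.map I.toQuiverHom) (F.mapU g) = negCyc A (constU H g) := by
  -- The inverse of 1 + uΔ, coefficient by coefficient; no convergence question arises for power
  -- series in u.
  let g : ℕ → Chains A.toGradedQuiver := fun n =>
    Nat.rec (f 0) (fun n c => f (n + 1) - homotopyDefect F I H c) n
  have g0 : g 0 = f 0 := rfl
  have gs : ∀ n, g (n + 1) = f (n + 1) - homotopyDefect F I H (g n) := fun _ => rfl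
  have hf0 : hochB A (f 0) = 0 := by
    rw [← negD_zero (hochB A) (connesB A) f]
    exact congrFun (LinearMap.mem_ker.1 hf.2) 0
  have hfs : ∀ n, hochB A (f (n + 1)) + connesB A (f n) = 0 := fun n => by
    rw [← negD_succ (hochB A) (connesB A) f]
    exact congrFun (LinearMap.mem_ker.1 hf.2) (n + 1)
  have hg0 : hochB A (g 0) = 0 := hf0
  have hgs : ∀ n, hochB A (g (n + 1)) + connesB A (g n) = 0 := by
    intro n
    induction n with
    | zero =>
      rw [gs, map_sub, hochB_homotopyDefect hI hH, hg0, map_zero, sub_zero, g0]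
      exact hfs 0
    | succ n ih =>
      rw [gs, map_sub, hochB_homotopyDefect hI hH, eq_neg_of_add_eq_zero_left ih, map_neg,
        ← connesB_homotopyDefect hI, sub_neg_eq_add, add_assoc, ← map_add, gs n, add_sub_cancel]
      exact hfs (n + 1)
  refine ⟨g, ⟨fun n => ?_, LinearMap.mem_ker.2 (funext fun n => ?_)⟩, funext fun n => ?_⟩
  · induction n with
    | zero => exact hf.1 0
    | succ n ih =>
      rw [gs]
      refine sub_mem (hf.1 _) ?_
      have := hasDeg_homotopyDefect F I hdeg _ _ ih
      rwa [show e - 2 * (n : G) + -2 = e - 2 * ((n + 1 : ℕ) : G) by push_cast; ring] at this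
  · cases n with
    | zero => exact (negD_zero _ _ _).trans hg0
    | succ n => exact (negD_succ _ _ _ _).trans (hgs n)
  · cases n with
    | zero =>
      have h := hH (g 0)
      rw [hg0, map_zero, add_zero] at h
      rw [negCyc, negD_zero, constU_apply, h, Pi.sub_apply, constU_apply, mapU_zero, g0]
    | succ n =>
      have h := hH (g (n + 1))
      have h' : H (hochB A (g (n + 1))) = - H (connesB A (g n)) := by
        rw [eq_neg_of_add_eq_zero_left (hgs n), map_neg]
      have hs := gs n
      rw [homotopyDefect_apply] at hs
      rw [negCyc, negD_succ, constU_apply, constU_apply, Pi.sub_apply, constU_apply, mapU_succ,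
        map_add]
      linear_combination (norm := module) h' - hs - h

theorem mem_gradeU_constU {e : G} (hdeg : HasDeg H (-1)) {g : ℕ → Chains A.toGradedQuiver}
    (hg : g ∈ gradeU (Chains.grade A.toGradedQuiver) e) :
    constU H g ∈ gradeU (Chains.grade A.toGradedQuiver) (e - 1) := fun n => by
  have := hdeg _ _ (hg n)
  rwa [show e - 2 * (n : G) + -1 = e - 1 - 2 * (n : G) by ring] at this

/-- If `F_*(u) I_*` is homotopic to the identity and `I_* F_*` is homotopic to the identity on
Hochschild complexes, then every cocycle of `C(A)[[u]]` is cohomologous to its image under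
`I_* F_*(u)`. -/
theorem exists_negCyc_eq_sub_map_mapU (hI : I.IsUnital) (hdeg : HasDeg H (-1))
    (hH : ∀ c, hochB A (H c) + H (hochB A c) =
      c - Chains.map I.toQuiverHom (Chains.map F.toQuiverHom c))
    (hFI : ∀ z, F.mapU (constU (Chains.map I.toQuiverHom) z) =
      z + (negCyc B (tripleSU B z) + tripleSU B (negCyc B z)))
    {e : G} {f : ℕ → Chains A.toGradedQuiver}
    (hf : f ∈ cocycles (Chains.grade A.toGradedQuiver) (negCyc A) e) :
    ∃ y ∈ gradeU (Chains.grade A.toGradedQuiver) (e - 1),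
      negCyc A y = f - constU (Chains.map I.toQuiverHom) (F.mapU f) := by
  obtain ⟨g, hg, h⟩ := exists_sub_map_mapU_eq hI hdeg hH hf
  have cF := isNegCycMap_mapU F
  have cI := hI.isNegCycMap
  have hz := cF.map_cocycles _ _ hg
  have hHg := mem_gradeU_constU hdeg hg.1
  -- Let K = `tripleSU B`. Apply I_* F_*(u) to f - I_* F_*(u)g = DHg and replace F_*(u)I_* by 1 + DK
  -- + KD, where KD vanishes on the cocycle F_*(u)g. The boundaries collected are those of Hg,
  -- I_*KF_*(u)g and I_*F_*(u)Hg.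
  refine ⟨constU H g - constU (Chains.map I.toQuiverHom) (tripleSU B (F.mapU g)) -
    constU (Chains.map I.toQuiverHom) (F.mapU (constU H g)), sub_mem (sub_mem hHg
      (cI.map_grade _ _ (tripleSU_mem B hz.1))) (cI.map_grade _ _ (cF.map_grade _ _ hHg)), ?_⟩
  have h1 := congrArg (constU (Chains.map I.toQuiverHom)) (congrArg F.mapU h)
  rw [map_sub, hFI, LinearMap.mem_ker.1 hz.2, map_zero, add_zero, map_sub, map_add, cF.comm,
    cI.comm, cI.comm] at h1
  rw [map_sub, map_sub, ← h]
  linear_combination (norm := module) h1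

end Retraction

/-! ### The endofunctor inc ∘ F of {P, N} and the equality of classes -/

section Summand

variable {k : Type uk} [Field k] {G : Type w} [GradingRing G] {A : DGCat.{u, v} k G} {P N : A.Obj}
  (S : DirectSummand A P N)

/-- The semifunctor `f ↦ i ∘ f ∘ j` as an endofunctor of `{P, N}`. -/
def endofunctor : Semifunctor (pairCat A P N) (pairCat A P N) where
  obj _ := PN.N
  map := fun {x y : PN} {n : G} => S.conj x y n
  map_d := fun {x y : PN} {n : G} f => S.conj_d x y n f
  map_comp := fun {x y z : PN} {_ _ _ : G} h f g => S.conj_comp (x := x) (y := y) (z := z) h f g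

theorem map_inclusion_map_functor (c : Chains (pairCat A P N).toGradedQuiver) :
    Chains.map (inclusion A P N).toQuiverHom (Chains.map S.functor.toQuiverHom c) =
      Chains.map (endofunctor S).toQuiverHom c := by
  suffices h : Chains.map (inclusion A P N).toQuiverHom ∘ₗ Chains.map S.functor.toQuiverHom =
    Chains.map (endofunctor S).toQuiverHom from LinearMap.congr_fun h c
  refine Chains.hom_ext fun l hl => ?_
  rw [LinearMap.comp_apply, Chains.map_mk _ _ hl, Chains.map_mk _ _ (isCyclic_map _ hl),
    Chains.map_mk _ _ hl, List.map_map]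
  rfl

/-- The presentation of the endofunctor as a conjugation. -/
def endofunctorConj : Conj (endofunctor S) where
  up := S.up
  down := S.down
  d_up := S.d_up
  d_down := S.d_down
  down_up := S.down_up
  map_eq := fun {x y : PN} {n : G} f => S.conj_apply x y n f

/-- Every cocycle `f` of the negative cyclic complex of `{P, N}` is cohomologous to
`inc_* F_*(u) f`. -/
theorem exists_negCyc_eq_sub_inclusion_mapU {e : G}
    {f : ℕ → Chains (pairCat A P N).toGradedQuiver}
    (hf : f ∈ cocycles (Chains.grade (pairCat A P N).toGradedQuiver) (negCyc (pairCat A P N)) e) :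
    ∃ y ∈ gradeU (Chains.grade (pairCat A P N).toGradedQuiver) (e - 1),
      negCyc (pairCat A P N) y =
        f - constU (Chains.map (inclusion A P N).toQuiverHom) (S.functor.mapU f) :=
  exists_negCyc_eq_sub_map_mapU (isUnital_inclusion A P N) (endofunctorConj S).hasDeg_hom
    (fun c => by rw [(endofunctorConj S).hochB_hom, map_inclusion_map_functor])
    (mapU_inclusion S) hf

/-- F_*(u)γ and η agree only modulo degenerate words in {N}; inc_* preserves degenerate words
because inc is unital. -/
theorem quotU_map_inclusion_mapU_gammaSeries :
    quotU (pairCat A P N) (constU (Chains.map (inclusion A P N).toQuiverHom)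
      (S.functor.mapU (gammaSeries (pairCat A P N) PN.P))) =
        quotU (pairCat A P N) (etaSeries (pairCat A P N) PN.N S.idem) := by
  have h := (quotU_eq_iff _ _ _).1 (quotU_mapU_functor_gammaSeries S)
  rw [← map_inclusion_etaSeries, quotU_eq_iff]
  intro n
  rw [constU_apply, constU_apply, ← map_sub]
  exact (isUnital_inclusion A P N).map_degenerate _ (h n)

theorem quotU_unitSeries_mem_cocycles (B : DGCat.{u', v'} k G) (x : B.Obj) :
    quotU B (unitSeries B x) ∈ cocycles (NChains.grade B) (negCycBar B) 0 :=
  quotU_gammaSeries B x ▸ quotU_mem_cocycles B (gammaSeries_mem_cocycles B x)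

/-- η need not be differentiated: modulo degenerate words it is the image of the cocycle γ under
cochain maps. -/
theorem quotU_etaSeries_mem_cocycles :
    quotU (pairCat A P N) (etaSeries (pairCat A P N) PN.N S.idem) ∈
      cocycles (NChains.grade (pairCat A P N)) (negCycBar (pairCat A P N)) 0 :=
  quotU_map_inclusion_mapU_gammaSeries S ▸ quotU_mem_cocycles _
    ((isUnital_inclusion A P N).isNegCycMap.map_cocycles _ _
      ((isNegCycMap_mapU S.functor).map_cocycles _ _ (gammaSeries_mem_cocycles _ _)))

/-- A primitive of γ_P - inc_* F_*(u)γ_P exists before normalization. Its image in the normalized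
complex is a primitive of 1_P - η_π. -/
theorem cls_unitSeries_eq_cls_etaSeries
    (h1 : quotU (pairCat A P N) (unitSeries (pairCat A P N) PN.P) ∈
      cocycles (NChains.grade (pairCat A P N)) (negCycBar (pairCat A P N)) 0)
    (h2 : quotU (pairCat A P N) (etaSeries (pairCat A P N) PN.N S.idem) ∈
      cocycles (NChains.grade (pairCat A P N)) (negCycBar (pairCat A P N)) 0) :
    (Coh.cls _ _ _ h1 : HNbar (pairCat A P N) 0) = Coh.cls _ _ _ h2 := by
  obtain ⟨y, hy, h⟩ := exists_negCyc_eq_sub_inclusion_mapU S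
    (gammaSeries_mem_cocycles (pairCat A P N) PN.P)
  refine (Submodule.Quotient.eq _).2 ⟨quotU _ y, quotU_mem_gradeU _ hy, ?_⟩
  rw [← quotU_negCyc, h, map_sub, quotU_map_inclusion_mapU_gammaSeries]
  exact congrArg (· - _) (quotU_gammaSeries (pairCat A P N) PN.P)

end Summand

end NegCyc
-- The main theorem
theorem mainTheorem3 {k : Type*} [Field k] {G : Type*} [GradingRing G] (A : DGCat k G)
    {P N : A.Obj} (S : DirectSummand A P N) :
    ∃ (hF : IsNegCycMap (pairCat A P N) (singleCat A N) S.functor.mapU)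
      (hinc : IsNegCycMap (singleCat A N) (pairCat A P N)
        (constU (Chains.map (inclusion A P N).toQuiverHom))),
      (∀ g : G, Coh.map hF g ∘ₗ Coh.map hinc g =
        (LinearMap.id : HN (singleCat A N) g →ₗ[k] HN (singleCat A N) g)) ∧
      (∀ f : ℕ → Chains (pairCat A P N).toGradedQuiver,
        S.functor.mapU f 0 = Chains.map S.functor.toQuiverHom (f 0)) ∧
      quotU (singleCat A N) (S.functor.mapU (gammaSeries (pairCat A P N) PN.P)) =
        quotU (singleCat A N) (etaSeries (singleCat A N) () S.idem) ∧
      ∃ (h1 : quotU (pairCat A P N) (unitSeries (pairCat A P N) PN.P) ∈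
            cocycles (NChains.grade (pairCat A P N)) (negCycBar (pairCat A P N)) 0)
        (h2 : quotU (pairCat A P N) (etaSeries (pairCat A P N) PN.N S.idem) ∈
            cocycles (NChains.grade (pairCat A P N)) (negCycBar (pairCat A P N)) 0),
        (Coh.cls _ _ _ h1 : HNbar (pairCat A P N) 0) = Coh.cls _ _ _ h2 :=
  ⟨isNegCycMap_mapU S.functor, (isUnital_inclusion A P N).isNegCycMap,
    coh_map_comp_inclusion S _ _, fun f => mapU_zero S.functor f, quotU_mapU_functor_gammaSeries S,
    quotU_unitSeries_mem_cocycles (pairCat A P N) PN.P, quotU_etaSeries_mem_cocycles S,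
    cls_unitSeries_eq_cls_etaSeries S _ _⟩
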